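/- Let $B^3\subset\mathbb R^3$ be the closed unit ball with boundary $S^2$, viewed as the Poincaré ball model of hyperbolic space together with its ideal boundary, and let $\mathsf{Conf}_2(B^3)=\{(q_1,q_2)\in B^3\times B^3: q_1\ne q_2\}$, with projections $p_1,p_2$ to $B^3$. For $(q_1,q_2)\in\mathsf{Conf}_2(B^3)$ let $r(q_1,q_2)=(z_1,z_2)$ be the pair of points where the hyperbolic geodesic through $q_1$ and $q_2$ meets $S^2$, with $z_1$ on the side of $q_1$ and $z_2$ on the side of $q_2$. Identify $S^2$ with $\mathbb{CP}^1$ by stereographic projection, so that the complex orientation is that of the outward normal, and put $$\omega=\frac{dz_1\wedge dz_2}{(z_1-z_2)^2}\in\Omega^2(\mathsf{Conf}_2(\mathbb{CP}^1)),\qquad P_0=\frac{1}{2\pi i}\,r^*\omega,$$ with complex conjugate $\bar P_0$. For $\ell\colon S^2\to(0,\infty)$ let $\Theta_\ell(z_1,z_2)=0$ if $d(z_1,z_2)\le(\ell(z_1)+\ell(z_2))/2$ and $\Theta_\ell(z_1,z_2)=1$ otherwise, where $d$ is the spherical (great-circle) distance. Let $\ell_1,\ell_2\colon S^2\to(0,\infty)$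 be smooth, and let $\alpha,\beta\in\Omega(B^3)$ be complex-valued differential forms, possibly of mixed degree, that are smooth up to the boundary. Then for every $\epsilon>0$ the form $$r^*(\Theta_{\epsilon\ell_1}-\Theta_{\epsilon\ell_2})\;P_0\,\bar P_0\;p_1^*\alpha\;p_2^*\beta$$ is absolutely integrable over $\mathsf{Conf}_2(B^3)$, and $$\lim_{\epsilon\to0_+}\int_{\mathsf{Conf}_2(B^3)}r^*(\Theta_{\epsilon\ell_1}-\Theta_{\epsilon\ell_2})\;P_0\,\bar P_0\;p_1^*\alpha\;p_2^*\beta=-\frac1{2\pi}\int_{S^2}\log(\ell_1/\ell_2)\;\alpha^{(1)}|_{S^2}\wedge *\bigl(\beta^{(1)}|_{S^2}\bigr),$$ where $\alpha^{(1)},\beta^{(1)}$ are the 1-form parts, $*$ is the Hodge star of the round unit sphere $S^2$ oriented by the outward normal, and $\mathsf{Conf}_2(B^3)$ carries the orientation of $\mathbb R^3\times\mathbb R^3$ in which the frame consisting of the standard basis of the second factor followed by that of the first factor is positive. Equivalently, for the opposite orientation (the product orientation, first factor followed by second) the limit equals $+\frac1{2\pi}\int_{S^2}\log(\ell_1/\ell_2)\;\alpha^{(1)}|_{S^2}\wedge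 *(\beta^{(1)}|_{S^2})$. -/

import Mathlib

open MeasureTheory Metric Set Filter Topology
open scoped ContDiff Manifold ComplexConjugate

noncomputable section

/-- Euclidean three-space. -/
abbrev E3 : Type := EuclideanSpace ℝ (Fin 3)

/-- The unit sphere `S²`, the boundary of the closed unit ball `B³ = closedBall 0 1`. -/
abbrev S2 : Type := sphere (0 : E3) 1

/-! ### Complex-valued differential forms -/

/-- The algebra of complex-valued (inhomogeneous) alternating forms on a real vector space `V`:
the exterior algebra over `ℂ` of the space of complex-valued covectors. Its product is the wedge
product. A differential form on a subset of `V` is a function `V → Forms V`. -/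
abbrev Forms (V : Type*) [NormedAddCommGroup V] [NormedSpace ℝ V] : Type _ :=
  ExteriorAlgebra ℂ (V →L[ℝ] ℂ)

section Forms

variable {V W : Type*} [NormedAddCommGroup V] [NormedSpace ℝ V]
  [NormedAddCommGroup W] [NormedSpace ℝ W]

/-- A covector as a form of degree one. -/
def oneForm (φ : V →L[ℝ] ℂ) : Forms V := ExteriorAlgebra.ι ℂ φ

/-- The differential `df` of a complex-valued function, as a one-form. -/
def dForm (f : V → ℂ) (x : V) : Forms V := oneForm (fderiv ℝ f x)

/-- Pullback of covectors along a linear map. -/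
def covectorPullback (A : V →L[ℝ] W) : (W →L[ℝ] ℂ) →ₗ[ℂ] (V →L[ℝ] ℂ) where
  toFun φ := φ.comp A
  map_add' _ _ := rfl
  map_smul' _ _ := rfl

/-- Pullback `f^* η` of a differential form `η` along `f`. -/
def formPullback (f : V → W) (η : W → Forms W) (x : V) : Forms V :=
  ExteriorAlgebra.map (covectorPullback (fderiv ℝ f x)) (η (f x))

/-- The alternating map `(φ₁, …, φₙ) ↦ det (φᵢ (vⱼ))`, which is the value of `φ₁ ∧ … ∧ φₙ` on
the vectors `v₁, …, vₙ`. -/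
def detForm {n : ℕ} (v : Fin n → V) : (V →L[ℝ] ℂ) [⋀^Fin n]→ₗ[ℂ] ℂ :=
  Matrix.detRowAlternating.compLinearMap
    { toFun := fun φ j => φ (v j)
      map_add' := fun _ _ => rfl
      map_smul' := fun _ _ => rfl }

/-- The value of the degree `n` part of a form on `n` vectors. -/
def evalForm {n : ℕ} (v : Fin n → V) : Forms V →ₗ[ℂ] ℂ :=
  ExteriorAlgebra.liftAlternating
    (Pi.single (M := fun i => (V →L[ℝ] ℂ) [⋀^Fin i]→ₗ[ℂ] ℂ) n (detForm v))

/-- The one-form part `α^{(1)}` of a form, as a covector. -/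
def degreeOnePart (η : Forms V) : V →L[ℝ] ℂ := ExteriorAlgebra.ιInv η

end Forms

/-- `α ∈ Ω(B³)`: all components of `α` are smooth on the closed unit ball, up to the boundary.
(`Forms E3` is finite dimensional, so the components are given by the linear functionals.) -/
def IsSmoothFormOnBall (α : E3 → Forms E3) : Prop :=
  ∀ L : Forms E3 →ₗ[ℂ] ℂ, ContDiffOn ℝ ∞ (fun x => L (α x)) (closedBall 0 1)

/-! ### Hyperbolic geometry of the Poincaré ball -/

/-- The hyperbolic distance (curvature `-1`) in the Poincaré ball model. -/
def hypDist (x y : E3) : ℝ :=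
  Real.arcosh (1 + 2 * ‖x - y‖ ^ 2 / ((1 - ‖x‖ ^ 2) * (1 - ‖y‖ ^ 2)))

/-- A complete unit-speed hyperbolic geodesic of the Poincaré ball, together with its two ideal
endpoints `γ ⊥` and `γ ⊤`. -/
structure IsGeodesicLine (γ : EReal → E3) : Prop where
  continuous : Continuous γ
  norm_lt_one : ∀ s : ℝ, ‖γ s‖ < 1
  hypDist_eq : ∀ s t : ℝ, hypDist (γ s) (γ t) = |s - t|

/-- `z.1` and `z.2` are the points where the geodesic through `q.1` and `q.2` meets `S²`, with
`z.1` on the side of `q.1` and `z.2` on the side of `q.2`. -/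
def IsEndpointPair (q : E3 × E3) (z : S2 × S2) : Prop :=
  ∃ γ : EReal → E3, IsGeodesicLine γ ∧
    (∃ s t : EReal, s < t ∧ γ s = q.1 ∧ γ t = q.2) ∧ γ ⊥ = z.1 ∧ γ ⊤ = z.2

instance : Nonempty S2 := ⟨⟨EuclideanSpace.single 0 1, by simp⟩⟩

/-- `Conf₂(B³)`, the pairs of distinct points of the closed unit ball. -/
def Conf2 : Set (E3 × E3) := {q | ‖q.1‖ ≤ 1 ∧ ‖q.2‖ ≤ 1 ∧ q.1 ≠ q.2}

/-- The map `r : Conf₂(B³) → Conf₂(S²)`: the pair of endpoints of the hyperbolic geodesic through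
two points (arbitrary outside `Conf₂(B³)`). -/
def rMap (q : E3 × E3) : S2 × S2 := Classical.epsilon (IsEndpointPair q)

/-- The map `r` with values in the ambient space of `S² × S²`. -/
def rAmbient (q : E3 × E3) : E3 × E3 := ((rMap q).1, (rMap q).2)

/-! ### The propagator and the cutoff -/

/-- The stereographic coordinate `S² ∖ {pole} → ℂ` identifying `S²` with `ℂP¹`. The pole is
`(0, 0, -1)`, and the complex orientation is the one given by the outward normal. -/
def stereoCoord (x : E3) : ℂ := (x 0 + Complex.I * x 1) / (1 + x 2)

/-- `ω = dz₁ ∧ dz₂ / (z₁ - z₂)²` on `Conf₂(S²)`, in the stereographic coordinate (the pairs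
containing the pole are not covered by the coordinate; their preimage under `r` is a null set). -/
def omegaForm (p : E3 × E3) : Forms (E3 × E3) :=
  ((stereoCoord p.1 - stereoCoord p.2) ^ 2)⁻¹ •
    (dForm (fun p : E3 × E3 => stereoCoord p.1) p * dForm (fun p : E3 × E3 => stereoCoord p.2) p)

/-- The complex conjugate of `ω`. -/
def omegaBarForm (p : E3 × E3) : Forms (E3 × E3) :=
  ((conj (stereoCoord p.1) - conj (stereoCoord p.2)) ^ 2)⁻¹ •
    (dForm (fun p : E3 × E3 => conj (stereoCoord p.1)) p *
      dForm (fun p : E3 × E3 => conj (stereoCoord p.2)) p)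

/-- `P₀ = r^* ω / (2πi)`. -/
def P0 (q : E3 × E3) : Forms (E3 × E3) :=
  (2 * Real.pi * Complex.I : ℂ)⁻¹ • formPullback rAmbient omegaForm q

/-- The complex conjugate of `P₀`. -/
def P0Bar (q : E3 × E3) : Forms (E3 × E3) :=
  (conj (2 * Real.pi * Complex.I : ℂ))⁻¹ • formPullback rAmbient omegaBarForm q

open Classical in
/-- The cutoff `Θ_ℓ`, defined by the spherical distance (the angle between unit vectors). -/
def Theta (ℓ : S2 → ℝ) (z : S2 × S2) : ℂ :=
  if InnerProductGeometry.angle (z.1 : E3) (z.2 : E3) ≤ (ℓ z.1 + ℓ z.2) / 2 then 0 else 1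

/-- The form `r^*(Θ_{εℓ₁} - Θ_{εℓ₂}) P₀ P̄₀ p₁^*α p₂^*β` on `Conf₂(B³)`. -/
def cutoffForm (ℓ₁ ℓ₂ : S2 → ℝ) (α β : E3 → Forms E3) (ε : ℝ) (q : E3 × E3) :
    Forms (E3 × E3) :=
  (Theta (fun z => ε * ℓ₁ z) (rMap q) - Theta (fun z => ε * ℓ₂ z) (rMap q)) •
    (P0 q * P0Bar q * formPullback Prod.fst α q * formPullback Prod.snd β q)

/-! ### Integration over `Conf₂(B³)` and over `S²` -/

/-- The standard basis of `ℝ³`. -/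
def stdBasis (i : Fin 3) : E3 := EuclideanSpace.single i 1

/-- The standard frame of `ℝ³ × ℝ³` in the order (first factor, second factor); it is positive for
the product orientation. -/
def frame12 : Fin 6 → E3 × E3 :=
  ![(stdBasis 0, 0), (stdBasis 1, 0), (stdBasis 2, 0),
    (0, stdBasis 0), (0, stdBasis 1), (0, stdBasis 2)]

/-- The standard frame of `ℝ³ × ℝ³` in the order (second factor, first factor); it is positive for
the opposite of the product orientation. -/
def frame21 : Fin 6 → E3 × E3 :=
  ![(0, stdBasis 0), (0, stdBasis 1), (0, stdBasis 2),
    (stdBasis 0, 0), (stdBasis 1, 0), (stdBasis 2, 0)]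

/-- The integral over `Conf₂(B³)` of (the degree six part of) a form, for the orientation in which
the orthonormal frame `b` is positive. -/
def integralConf2 (b : Fin 6 → E3 × E3) (F : E3 × E3 → Forms (E3 × E3)) : ℂ :=
  ∫ q in Conf2, evalForm b (F q)

/-- `v ↦ x × v`; for `x ∈ S²` it restricts to the rotation by a right angle of `T_x S²`, oriented
by the outward normal `x`. -/
def crossMap (x : E3) : E3 →L[ℝ] E3 :=
  LinearMap.toContinuousLinearMap
    { toFun := fun v => WithLp.toLp 2 (crossProduct x.ofLp v.ofLp)
      map_add' := fun v w => by simp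
      map_smul' := fun c v => by simp }

/-- The Hodge star on `S²` of (the restriction to `T_x S²` of) a covector at `x`:
`(*φ)(v) = -φ(x × v)`. -/
def hodgeStar (x : E3) (φ : E3 →L[ℝ] ℂ) : E3 →L[ℝ] ℂ := -(φ.comp (crossMap x))

/-- The covector `v ↦ ⟨x, v⟩`. -/
def normalCovector (x : E3) : E3 →L[ℝ] ℂ := Complex.ofRealCLM.comp (innerSL ℝ x)

/-- The integral over `S²`, oriented by the outward normal, of the restriction of a two-form `η`.
With the outward normal `x` and a positive orthonormal frame `e₁, e₂` of `T_x S²`, the surface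
density `η(e₁, e₂)` equals `(x^♭ ∧ η)(x, e₁, e₂)`, the coefficient of `x^♭ ∧ η` with respect to
the standard volume form of `ℝ³`. -/
def integralS2 (η : S2 → Forms E3) : ℂ :=
  ∫ x : S2, evalForm stdBasis (oneForm (normalCovector x) * η x)
    ∂((volume : Measure E3).toSphere)

/-- The two-form `log(ℓ₁/ℓ₂) α^{(1)} ∧ *β^{(1)}` along `S²`. -/
def boundaryForm (ℓ₁ ℓ₂ : S2 → ℝ) (α β : E3 → Forms E3) (x : S2) : Forms E3 :=
  (Real.log (ℓ₁ x / ℓ₂ x) : ℂ) •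
    (oneForm (degreeOnePart (α x)) * oneForm (hodgeStar x (degreeOnePart (β x))))

end

/-! Up to a null set, a point of Conf₂(B³) is an oriented geodesic together with two successive
points on it. For x ≠ y in S² the geodesic is γ(u) = (x + u²y)/(1 + |x − y|u + u²) with log u as arc
length, so the coordinates are (x, y, u, v) with 0 < u < v. `geoPair` packs them as the pair of
vectors (ux, vy) of ℝ³ × ℝ³, to which the change of variables formula and polar coordinates apply.

In these coordinates r is just (x, y). The form P₀P̄₀ already has top degree in (x, y): up to sign
it is dσ(x) dσ(y) / (π²|x − y|⁴). Hence only the components α(γ'(u)) du and β(γ'(v)) dv of α and β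
survive (`evalForm_mul_map_mul_map`, `det_mul_evalForm_geoPair`). As `geoPair` has negative
Jacobian, the integral for the product orientation is −π⁻² ∬ (Θ − Θ) |x − y|⁻⁴ K(x, y), where K(x,
y) is the integral of α(γ'(u)) β(γ'(v)) over 0 < u < v (`integral_cutoffForm`).

Two velocities give K = O(|x − y|²). The y-integral is therefore at worst logarithmically divergent
at the diagonal, and the difference of cutoffs restricts it to an annulus around x of radii
comparable to ε. Put y at distance about εr from x in the direction of a unit tangent vector τ. The
velocity divided by ε tends to r(t(u)τ + n(u)x) with t = 2u/(1 + u²)² and n = (u² − 1)/(1 + u²)²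
(`tendsto_fiberIntegral`). The integral of f(u)f(v) over u < v is half the square of ∫f, hence 1/2
for t and 0 for n; the mixed terms are odd in τ and vanish after integration over the circle of
directions. What remains is a radial integral of dr/r, equal to −log(ℓ₁/ℓ₂) (`integral_stepDiff`),
times ½∫α(τ)β(τ)dφ = (π/2) Σ α(eᵢ)β(eᵢ), and Σ α(eᵢ)β(eᵢ) is the density of α ∧ *β
(`evalForm_mul_hodgeStar`). The constant is −π⁻² · (−π/2) = 1/(2π).

The passage to the limit is dominated convergence three times: over (u, v), over y in rescaled polar
coordinates around x (`tendsto_integral_endpointIntegrand`), and over x. Exchanging the two factors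
of ℝ³ × ℝ³ is an odd permutation of the frame, which gives the other sign. -/

noncomputable section

/-! ### Exterior algebra: evaluation of forms on frames, and selection of the one-form parts. -/

section ExteriorForms

open ExteriorAlgebra

/-- In the trivial square-zero extension, where `ιInv` is computed, a product has linear part a₀m +
m₀a, and m₀ = 0 for a covector. -/
theorem ιInv_mul_ι {M : Type*} [AddCommGroup M] [Module ℂ M] (a : ExteriorAlgebra ℂ M) (m : M) :
    ιInv (a * ι ℂ m) = algebraMapInv a • m := by
  -- `TrivSqZeroExt` needs a central right action of ℂ, which `ιInv` introduces internally in the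
  -- same way.
  let _ : Module ℂᵐᵒᵖ M := Module.compHom _ ((RingHom.id ℂ).fromOpposite mul_comm)
  have _ : IsCentralScalar ℂ M := ⟨fun r m => rfl⟩
  have hfst : (TrivSqZeroExt.fstHom ℂ ℂ M).comp (toTrivSqZeroExt (R := ℂ) (M := M)) =
      algebraMapInv := by
    ext m
    simp [algebraMapInv]
  have h : algebraMapInv a = (toTrivSqZeroExt (R := ℂ) a).fst := by
    rw [← hfst]; rfl
  change ((toTrivSqZeroExt (R := ℂ) (a * ι ℂ m))).snd = _
  rw [map_mul, toTrivSqZeroExt_ι, h]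
  simp

/-- If right multiplication of `X` by the covectors in the image of `T` only produces multiples of
`X * N`, and annihilates `X * N`, then only the parts of degree zero and one of a form contribute
to its product with `X`. -/
theorem mul_map_eq {M M' : Type*} [AddCommGroup M] [Module ℂ M] [AddCommGroup M'] [Module ℂ M']
    (T : M →ₗ[ℂ] M') (X N : ExteriorAlgebra ℂ M') (f : M →ₗ[ℂ] ℂ)
    (h₁ : ∀ m, X * ι ℂ (T m) = f m • (X * N)) (h₂ : ∀ m, X * N * ι ℂ (T m) = 0)
    (A : ExteriorAlgebra ℂ M) :
    X * ExteriorAlgebra.map T A = algebraMapInv A • X + f (ιInv A) • (X * N) := by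
  induction A using CliffordAlgebra.right_induction with
  | algebraMap r =>
    have h0 : ιInv (algebraMap ℂ (ExteriorAlgebra ℂ M) r) = 0 := by
      let _ : Module ℂᵐᵒᵖ M := Module.compHom _ ((RingHom.id ℂ).fromOpposite mul_comm)
      have _ : IsCentralScalar ℂ M := ⟨fun r m => rfl⟩
      change ((toTrivSqZeroExt (R := ℂ) (algebraMap ℂ (ExteriorAlgebra ℂ M) r))).snd = _
      exact congrArg TrivSqZeroExt.snd (AlgHom.commutes _ r)
    change X * ExteriorAlgebra.map T (algebraMap ℂ (ExteriorAlgebra ℂ M) r) =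
      algebraMapInv (algebraMap ℂ (ExteriorAlgebra ℂ M) r) • X +
        f (ιInv (algebraMap ℂ (ExteriorAlgebra ℂ M) r)) • (X * N)
    rw [h0, AlgHom.commutes, algebraMap_leftInverse M r, ← Algebra.commutes, ← Algebra.smul_def]
    simp
  | add a b ha hb =>
    rw [map_add, mul_add, ha, hb, map_add, map_add, map_add, add_smul, add_smul]
    abel
  | mul_ι m a ha =>
    change X * ExteriorAlgebra.map T (a * ι ℂ m) =
      algebraMapInv (a * ι ℂ m) • X + f (ιInv (a * ι ℂ m)) • (X * N)
    rw [ιInv_mul_ι, map_mul, map_apply_ι, ← mul_assoc, ha, add_mul, smul_mul_assoc, smul_mul_assoc,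
      h₁, h₂, map_mul]
    simp [algebraMapInv, smul_smul]

section

variable {V W : Type*} [NormedAddCommGroup V] [NormedSpace ℝ V]
  [NormedAddCommGroup W] [NormedSpace ℝ W]

theorem evalForm_ιMulti {n : ℕ} (v : Fin n → V) (φ : Fin n → V →L[ℝ] ℂ) :
    evalForm v (ιMulti ℂ n φ) = Matrix.det (Matrix.of fun i j => φ i (v j)) := by
  rw [evalForm, liftAlternating_apply_ιMulti, Pi.single_eq_same]
  rfl

theorem evalForm_ιMulti_of_ne {n k : ℕ} (h : k ≠ n) (v : Fin n → V) (φ : Fin k → V →L[ℝ] ℂ) :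
    evalForm v (ιMulti ℂ k φ) = 0 := by
  rw [evalForm, liftAlternating_apply_ιMulti, Pi.single_eq_of_ne h]
  rfl

theorem evalForm_map {n : ℕ} (v : Fin n → V) (A : V →L[ℝ] W) (η : Forms W) :
    evalForm v (ExteriorAlgebra.map (covectorPullback A) η) = evalForm (fun i => A (v i)) η := by
  suffices h : (evalForm v).comp (ExteriorAlgebra.map (covectorPullback A)).toLinearMap =
      evalForm (fun i => A (v i)) from LinearMap.congr_fun h η
  refine lhom_ext fun k => ?_
  ext φ
  by_cases hk : k = n
  · subst hk
    simp only [LinearMap.compAlternatingMap_apply, LinearMap.comp_apply, AlgHom.toLinearMap_apply,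
      map_apply_ιMulti, evalForm_ιMulti]
    rfl
  · simp only [LinearMap.compAlternatingMap_apply, LinearMap.comp_apply, AlgHom.toLinearMap_apply,
      map_apply_ιMulti, evalForm_ιMulti_of_ne hk]

/-- Products of covectors span the exterior algebra, and the evaluations vanish on those of the
wrong degree. So proportionality of evaluations need only be checked on determinants. -/
theorem evalForm_congr_det {n : ℕ} (v v' : Fin n → V) (c : ℂ)
    (h : ∀ φ : Fin n → V →L[ℝ] ℂ, Matrix.det (Matrix.of fun i j => φ i (v' j)) =
      c * Matrix.det (Matrix.of fun i j => φ i (v j))) (η : Forms V) :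
    evalForm v' η = c * evalForm v η := by
  suffices h : evalForm v' = c • evalForm v from LinearMap.congr_fun h η
  refine lhom_ext fun k => ?_
  ext φ
  by_cases hk : k = n
  · subst hk
    simp only [LinearMap.compAlternatingMap_apply, LinearMap.smul_apply, evalForm_ιMulti, h,
      smul_eq_mul]
  · simp only [LinearMap.compAlternatingMap_apply, LinearMap.smul_apply,
      evalForm_ιMulti_of_ne hk, smul_zero]

/-- Forms of top degree transform by the determinant. -/
theorem evalForm_comp_basis {n : ℕ} (b : Module.Basis (Fin n) ℝ V) (A : V →L[ℝ] V) (η : Forms V) :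
    evalForm (fun i => A (b i)) η = ((LinearMap.det (A : V →ₗ[ℝ] V) : ℝ) : ℂ) * evalForm b η := by
  refine evalForm_congr_det _ _ _ (fun φ => ?_) η
  have h : (Matrix.of fun i j => φ i (A (b j))) = (Matrix.of fun i j => φ i (b j)) *
      (LinearMap.toMatrix b b (A : V →ₗ[ℝ] V)).map (fun r : ℝ => (r : ℂ)) := by
    ext i j
    rw [Matrix.mul_apply]
    conv_lhs => rw [Matrix.of_apply, ← b.sum_repr (A (b j)), map_sum]
    refine Finset.sum_congr rfl fun k _ => ?_
    simp [LinearMap.toMatrix_apply, mul_comm]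
  rw [h, Matrix.det_mul, mul_comm, ← LinearMap.det_toMatrix b]
  congr 1
  exact (RingHom.map_det Complex.ofRealHom _).symm

theorem evalForm_comp_perm {n : ℕ} (v : Fin n → V) (σ : Equiv.Perm (Fin n)) (η : Forms V) :
    evalForm (v ∘ σ) η = ((Equiv.Perm.sign σ : ℤ) : ℂ) * evalForm v η := by
  refine evalForm_congr_det _ _ _ (fun φ => ?_) η
  exact Matrix.det_permute' σ (Matrix.of fun i j => φ i (v j))

theorem oneForm_mul_swap (φ ψ : V →L[ℝ] ℂ) : oneForm φ * oneForm ψ = -(oneForm ψ * oneForm φ) :=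
  eq_neg_of_add_eq_zero_left (ι_add_mul_swap φ ψ)

theorem oneForm_mul_self (φ : V →L[ℝ] ℂ) : oneForm φ * oneForm φ = 0 := ι_sq_zero φ

/-- Five covectors in dimension six that vanish on two independent vectors are dependent. -/
theorem prod_oneForm_eq_zero (hV : Module.finrank ℝ V = 6) {w₁ w₂ : V} {ν₁ ν₂ : V →L[ℝ] ℂ}
    (h11 : ν₁ w₁ = 1) (h12 : ν₁ w₂ = 0) (h21 : ν₂ w₁ = 0) (h22 : ν₂ w₂ = 1)
    {φ : Fin 5 → V →L[ℝ] ℂ} (h₁ : ∀ i, φ i w₁ = 0) (h₂ : ∀ i, φ i w₂ = 0) :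
    ιMulti ℂ 5 φ = 0 := by
  have : FiniteDimensional ℝ V := Module.finite_of_finrank_pos (by omega)
  let b := Module.finBasisOfFinrankEq ℝ V hV
  let F : (V →L[ℝ] ℂ) →ₗ[ℂ] (Fin 6 → ℂ) :=
    { toFun := fun φ i => φ (b i)
      map_add' := fun _ _ => rfl
      map_smul' := fun _ _ => rfl }
  have hF : Function.Injective F := by
    intro φ ψ h
    have : (φ : V →ₗ[ℝ] ℂ) = ψ := b.ext fun i => congrFun h i
    ext v
    exact LinearMap.congr_fun this v
  have : FiniteDimensional ℂ (V →L[ℝ] ℂ) := Module.Finite.of_injective F hF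
  have hdim : Module.finrank ℂ (V →L[ℝ] ℂ) ≤ 6 := by
    simpa using LinearMap.finrank_le_finrank_of_injective hF
  -- The covectors vanishing on w₁ and w₂ form the kernel of `G`, and `ν₁`, `ν₂` make `G`
  -- surjective. The kernel therefore has dimension at most 6 − 2 = 4, too small for five
  -- independent covectors.
  let G : (V →L[ℝ] ℂ) →ₗ[ℂ] (Fin 2 → ℂ) :=
    { toFun := fun φ => ![φ w₁, φ w₂]
      map_add' := fun φ ψ => by ext i; fin_cases i <;> simp
      map_smul' := fun c φ => by ext i; fin_cases i <;> simp }
  have hG : LinearMap.range G = ⊤ := by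
    rw [LinearMap.range_eq_top]
    intro z
    refine ⟨z 0 • ν₁ + z 1 • ν₂, ?_⟩
    ext i; fin_cases i <;> simp [G, h11, h12, h21, h22]
  have hker : Module.finrank ℂ (LinearMap.ker G) ≤ 4 := by
    have := LinearMap.finrank_range_add_finrank_ker G
    rw [hG, finrank_top] at this
    simp at this
    omega
  refine AlternatingMap.map_linearDependent _ _ fun hli => ?_
  have hmem : ∀ i, φ i ∈ LinearMap.ker G := by
    intro i
    rw [LinearMap.mem_ker]
    ext j; fin_cases j <;> simp [G, h₁, h₂]
  have hli' : LinearIndependent ℂ (fun i => (⟨φ i, hmem i⟩ : LinearMap.ker G)) :=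
    LinearIndependent.of_comp (LinearMap.ker G).subtype hli
  have := hli'.fintype_card_le_finrank
  simp at this
  omega

theorem covectorPullback_apply (A : V →L[ℝ] W) (φ : W →L[ℝ] ℂ) (v : V) :
    covectorPullback A φ v = φ (A v) := rfl

/-- The value on a frame of the product of four covectors, which vanish on the vectors `w₁` and
`w₂`, and of two forms that are pulled back along maps annihilating `w₂` and `w₁`. -/
theorem evalForm_mul_map_mul_map {W' : Type*} [NormedAddCommGroup W'] [NormedSpace ℝ W']
    (hV : Module.finrank ℝ V = 6) {w₁ w₂ : V} {ν₁ ν₂ : V →L[ℝ] ℂ}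
    (h11 : ν₁ w₁ = 1) (h12 : ν₁ w₂ = 0) (h21 : ν₂ w₁ = 0) (h22 : ν₂ w₂ = 1)
    {φ : Fin 4 → V →L[ℝ] ℂ} (h₁ : ∀ i, φ i w₁ = 0) (h₂ : ∀ i, φ i w₂ = 0)
    (L₁ : V →L[ℝ] W) (L₂ : V →L[ℝ] W') (hL₁ : L₁ w₂ = 0) (hL₂ : L₂ w₁ = 0)
    (A : Forms W) (B : Forms W') (b : Fin 6 → V) :
    evalForm b (oneForm (φ 0) * oneForm (φ 1) * (oneForm (φ 2) * oneForm (φ 3)) *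
      ExteriorAlgebra.map (covectorPullback L₁) A * ExteriorAlgebra.map (covectorPullback L₂) B) =
    degreeOnePart A (L₁ w₁) * degreeOnePart B (L₂ w₂) *
      Matrix.det (Matrix.of fun i j => (![φ 0, φ 1, φ 2, φ 3, ν₁, ν₂] i) (b j)) := by
  obtain ⟨X, hX⟩ : ∃ X : Forms V,
      X = oneForm (φ 0) * oneForm (φ 1) * (oneForm (φ 2) * oneForm (φ 3)) := ⟨_, rfl⟩
  rw [← hX]
  -- `X` absorbs every covector that vanishes on w₁ and w₂, so multiplication of `X` by a covector
  -- sees only its values on these two vectors.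
  have hX0 : ∀ m : V →L[ℝ] ℂ, m w₁ = 0 → m w₂ = 0 → X * oneForm m = 0 := by
    intro m hm₁ hm₂
    have := prod_oneForm_eq_zero hV h11 h12 h21 h22 (φ := ![φ 0, φ 1, φ 2, φ 3, m])
      (by intro i; fin_cases i <;> simp [h₁, hm₁]) (by intro i; fin_cases i <;> simp [h₂, hm₂])
    rw [← this, hX, ιMulti_apply]
    simp [oneForm, mul_assoc]
  have hXm : ∀ m : V →L[ℝ] ℂ, X * oneForm m =
      m w₁ • (X * oneForm ν₁) + m w₂ • (X * oneForm ν₂) := by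
    intro m
    have h := hX0 (m - m w₁ • ν₁ - m w₂ • ν₂) (by simp [h11, h21]) (by simp [h12, h22])
    simp only [oneForm, map_sub, map_smul, mul_sub, mul_smul_comm] at h ⊢
    rw [sub_sub, sub_eq_zero] at h
    exact h
  have hN : ∀ m : V →L[ℝ] ℂ, X * oneForm ν₁ * oneForm m = m w₂ • (X * oneForm ν₁ * oneForm ν₂) := by
    intro m
    rw [mul_assoc, oneForm_mul_swap, mul_neg, ← mul_assoc, hXm, add_mul, smul_mul_assoc,
      smul_mul_assoc, mul_assoc, oneForm_mul_self, mul_assoc, oneForm_mul_swap ν₂ ν₁, mul_neg,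
      mul_assoc X]
    simp
  have hN₂ : ∀ m : V →L[ℝ] ℂ, m w₁ = 0 → X * oneForm ν₂ * oneForm m = 0 := by
    intro m hm
    rw [mul_assoc, oneForm_mul_swap, mul_neg, ← mul_assoc, hXm, hm, zero_smul, zero_add,
      smul_mul_assoc, mul_assoc, oneForm_mul_self]
    simp
  -- Covectors pulled back along `L₁` vanish on w₂, hence act on `X` as multiples of `ν₁`;
  -- symmetrically those pulled back along `L₂` act as multiples of `ν₂`.
  have hA := mul_map_eq (covectorPullback L₁) X (oneForm ν₁)
    ({ toFun := fun m => m (L₁ w₁), map_add' := fun _ _ => rfl, map_smul' := fun _ _ => rfl })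
    (fun m => by
      have := hXm (covectorPullback L₁ m)
      simpa [covectorPullback_apply, hL₁, oneForm] using this)
    (fun m => by
      have := hN (covectorPullback L₁ m)
      simpa [covectorPullback_apply, hL₁, oneForm] using this) A
  have hB := mul_map_eq (covectorPullback L₂) X (oneForm ν₂)
    ({ toFun := fun m => m (L₂ w₂), map_add' := fun _ _ => rfl, map_smul' := fun _ _ => rfl })
    (fun m => by
      have := hXm (covectorPullback L₂ m)
      simpa [covectorPullback_apply, hL₂, oneForm] using this)
    (fun m => hN₂ _ (by simp [covectorPullback_apply, hL₂])) B
  have hB' := mul_map_eq (covectorPullback L₂) (X * oneForm ν₁) (oneForm ν₂)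
    ({ toFun := fun m => m (L₂ w₂), map_add' := fun _ _ => rfl, map_smul' := fun _ _ => rfl })
    (fun m => hN _)
    (fun m => by
      have h := hN (covectorPullback L₂ m)
      have h' : X * oneForm ν₁ * oneForm ν₂ * oneForm (covectorPullback L₂ m) = 0 := by
        rw [mul_assoc, oneForm_mul_swap, mul_neg, ← mul_assoc, h, smul_mul_assoc,
          mul_assoc _ _ (oneForm ν₂), oneForm_mul_self]
        simp
      exact h') B
  -- Of the four terms of the expanded product, those of degree four and five vanish on six vectors.
  -- Only the product of the two one-form parts is left.
  have e4 : evalForm b X = 0 := by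
    have h := evalForm_ιMulti_of_ne (n := 6) (k := 4) (by norm_num) b φ
    rw [ιMulti_apply] at h
    simpa [hX, oneForm, mul_assoc, List.ofFn_succ] using h
  have e5 : ∀ m, evalForm b (X * oneForm m) = 0 := by
    intro m
    have h := evalForm_ιMulti_of_ne (n := 6) (k := 5) (by norm_num) b ![φ 0, φ 1, φ 2, φ 3, m]
    rw [ιMulti_apply] at h
    simpa [hX, oneForm, mul_assoc] using h
  have e6 : evalForm b (X * oneForm ν₁ * oneForm ν₂) =
      Matrix.det (Matrix.of fun i j => (![φ 0, φ 1, φ 2, φ 3, ν₁, ν₂] i) (b j)) := by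
    rw [← evalForm_ιMulti, ιMulti_apply]
    simp [hX, oneForm, mul_assoc]
  rw [hA, add_mul, smul_mul_assoc, smul_mul_assoc, hB, hB']
  simp only [map_add, map_smul, e4, e5, e6, zero_add, smul_eq_mul, mul_zero]
  rw [← mul_assoc]
  rfl

end

end ExteriorForms

/-! ### Geodesics of the Poincaré ball and uniqueness of their endpoints. -/

section Geodesics

/-- The hyperbolic geodesic of the Poincaré ball from `x` to `y` in `S²`, parametrized by the
exponential `u` of the arc length. -/
def geo (x y : E3) (u : ℝ) : E3 := (1 + ‖x - y‖ * u + u ^ 2)⁻¹ • (x + u ^ 2 • y)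

theorem geo_den_pos (x y : E3) {u : ℝ} (hu : 0 ≤ u) : 0 < 1 + ‖x - y‖ * u + u ^ 2 := by
  positivity

theorem inner_eq_of_norm_eq_one {x y : E3} (hx : ‖x‖ = 1) (hy : ‖y‖ = 1) :
    inner ℝ x y = 1 - ‖x - y‖ ^ 2 / 2 := by
  have := norm_sub_sq_real x y
  rw [hx, hy] at this
  linarith

theorem inner_add_smul_add_smul {x y : E3} (hx : ‖x‖ = 1) (hy : ‖y‖ = 1) (a b : ℝ) :
    inner ℝ (x + a • y) (x + b • y) = 1 + a * b + (a + b) * (1 - ‖x - y‖ ^ 2 / 2) := by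
  rw [inner_add_left, inner_add_right, inner_add_right, inner_smul_left, inner_smul_right,
    inner_smul_right, inner_smul_left, real_inner_self_eq_norm_sq, real_inner_self_eq_norm_sq,
    real_inner_comm x y, inner_eq_of_norm_eq_one hx hy, hx, hy]
  simp
  ring

theorem one_sub_norm_geo_sq {x y : E3} (hx : ‖x‖ = 1) (hy : ‖y‖ = 1) {u : ℝ} (hu : 0 ≤ u) :
    1 - ‖geo x y u‖ ^ 2 = 2 * ‖x - y‖ * u / (1 + ‖x - y‖ * u + u ^ 2) := by
  have hD := geo_den_pos x y hu
  rw [geo, norm_smul, mul_pow, ← real_inner_self_eq_norm_sq (x + u ^ 2 • y),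
    inner_add_smul_add_smul hx hy, Real.norm_eq_abs, sq_abs]
  field_simp
  ring

theorem norm_geo_le_one {x y : E3} (hx : ‖x‖ = 1) (hy : ‖y‖ = 1) {u : ℝ} (hu : 0 ≤ u) :
    ‖geo x y u‖ ≤ 1 := by
  have h := one_sub_norm_geo_sq hx hy hu
  have : 0 ≤ 2 * ‖x - y‖ * u / (1 + ‖x - y‖ * u + u ^ 2) := by positivity
  nlinarith [norm_nonneg (geo x y u)]

theorem norm_geo_lt_one {x y : E3} (hx : ‖x‖ = 1) (hy : ‖y‖ = 1) (hxy : x ≠ y) {u : ℝ}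
    (hu : 0 < u) : ‖geo x y u‖ < 1 := by
  have h := one_sub_norm_geo_sq hx hy hu.le
  have hc : 0 < ‖x - y‖ := norm_pos_iff.2 (sub_ne_zero.2 hxy)
  have : 0 < 2 * ‖x - y‖ * u / (1 + ‖x - y‖ * u + u ^ 2) := by positivity
  nlinarith [norm_nonneg (geo x y u)]

/-- The right side is cosh(log u − log v), so this says that log u is arc length. All norms reduce
to inner products of vectors x + a y. -/
theorem one_add_ratio_geo {x y : E3} (hx : ‖x‖ = 1) (hy : ‖y‖ = 1) (hxy : x ≠ y) {u v : ℝ}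
    (hu : 0 < u) (hv : 0 < v) :
    1 + 2 * ‖geo x y u - geo x y v‖ ^ 2 /
      ((1 - ‖geo x y u‖ ^ 2) * (1 - ‖geo x y v‖ ^ 2)) = (u / v + v / u) / 2 := by
  have hc : 0 < ‖x - y‖ := norm_pos_iff.2 (sub_ne_zero.2 hxy)
  have hDu := geo_den_pos x y hu.le
  have hDv := geo_den_pos x y hv.le
  have h1 := one_sub_norm_geo_sq hx hy hu.le
  have h2 := one_sub_norm_geo_sq hx hy hv.le
  have hin : inner ℝ (geo x y u) (geo x y v) = (1 + ‖x - y‖ * u + u ^ 2)⁻¹ *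
      (1 + ‖x - y‖ * v + v ^ 2)⁻¹ *
      (1 + u ^ 2 * v ^ 2 + (u ^ 2 + v ^ 2) * (1 - ‖x - y‖ ^ 2 / 2)) := by
    rw [geo, geo, inner_smul_left, inner_smul_right, inner_add_smul_add_smul hx hy]
    simp
    ring
  rw [norm_sub_sq_real, hin, h1, h2,
    show ‖geo x y u‖ ^ 2 = 1 - 2 * ‖x - y‖ * u / (1 + ‖x - y‖ * u + u ^ 2) by rw [← h1]; ring,
    show ‖geo x y v‖ ^ 2 = 1 - 2 * ‖x - y‖ * v / (1 + ‖x - y‖ * v + v ^ 2) by rw [← h2]; ring]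
  generalize ‖x - y‖ = c at *
  field_simp
  ring

theorem hypDist_geo_exp {x y : E3} (hx : ‖x‖ = 1) (hy : ‖y‖ = 1) (hxy : x ≠ y) (s t : ℝ) :
    hypDist (geo x y (Real.exp s)) (geo x y (Real.exp t)) = |s - t| := by
  rw [hypDist, one_add_ratio_geo hx hy hxy (Real.exp_pos s) (Real.exp_pos t), ← Real.exp_sub,
    ← Real.exp_sub, ← neg_sub s t, ← Real.cosh_eq, ← Real.cosh_abs,
    Real.arcosh_cosh (abs_nonneg _)]

/-- The extension of `geo` to the ideal endpoints. -/
def geoE (x y : E3) (s : EReal) : E3 :=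
  -- This is 1/(1 + u²) for u = exp s, the weight of x. It is continuous on all of `EReal`, with
  -- values 1 at ⊥ and 0 at ⊤, and √(w(1 − w)) = u/(1 + u²) recovers `geo`.
  let w : ℝ := ((1 + EReal.exp s ^ 2)⁻¹).toReal
  (1 + ‖x - y‖ * √(w * (1 - w)))⁻¹ • (w • x + (1 - w) • y)

theorem geoE_bot (x y : E3) : geoE x y ⊥ = x := by simp [geoE]

theorem geoE_top (x y : E3) : geoE x y ⊤ = y := by simp [geoE]

theorem geoE_coe (x y : E3) (s : ℝ) : geoE x y s = geo x y (Real.exp s) := by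
  have hu := Real.exp_pos s
  have hw : ((1 + EReal.exp (s : EReal) ^ 2)⁻¹).toReal = (1 + Real.exp s ^ 2)⁻¹ := by
    rw [EReal.exp_coe, ENNReal.toReal_inv, ENNReal.toReal_add (by simp) (by simp)]
    simp [hu.le]
  rw [geoE, hw, geo]
  generalize Real.exp s = u at *
  have h1 : 1 - (1 + u ^ 2)⁻¹ = u ^ 2 * (1 + u ^ 2)⁻¹ := by field_simp; ring
  have h2 : √((1 + u ^ 2)⁻¹ * (1 - (1 + u ^ 2)⁻¹)) = u * (1 + u ^ 2)⁻¹ := by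
    rw [h1, ← Real.sqrt_sq (show 0 ≤ u * (1 + u ^ 2)⁻¹ by positivity)]
    congr 1; ring
  have hD := geo_den_pos x y hu.le
  rw [h2, h1, mul_comm (u ^ 2), mul_smul, ← smul_add, smul_smul]
  congr 1
  field_simp
  ring

theorem continuous_geoE (x y : E3) : Continuous (geoE x y) := by
  have hw : Continuous fun s : EReal => ((1 + EReal.exp s ^ 2)⁻¹).toReal := by
    have h1 : Continuous fun s : EReal => (1 + EReal.exp s ^ 2)⁻¹ :=
      (continuous_const.add ((ENNReal.continuous_pow 2).comp ENNReal.continuous_exp)).inv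
    exact ENNReal.continuousOn_toReal.comp_continuous h1 fun s => by simp
  have key : Continuous fun w : ℝ =>
      (1 + ‖x - y‖ * √(w * (1 - w)))⁻¹ • (w • x + (1 - w) • y) := by
    have h1 : Continuous fun w : ℝ => 1 + ‖x - y‖ * √(w * (1 - w)) := by fun_prop
    have h2 : Continuous fun w : ℝ => w • x + (1 - w) • y := by fun_prop
    exact (h1.inv₀ fun w => by positivity).smul h2
  exact key.comp hw

theorem isGeodesicLine_geoE {x y : E3} (hx : ‖x‖ = 1) (hy : ‖y‖ = 1) (hxy : x ≠ y) :
    IsGeodesicLine (geoE x y) where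
  continuous := continuous_geoE x y
  norm_lt_one s := by rw [geoE_coe]; exact norm_geo_lt_one hx hy hxy (Real.exp_pos s)
  hypDist_eq s t := by rw [geoE_coe, geoE_coe]; exact hypDist_geo_exp hx hy hxy s t

/-- In Minkowski space, a unit timelike vector is determined by its products with two others if
the three lie at the distances of points on a line. -/
theorem minkowski_eq_of_collinear {P A B : E3} {p a b σ T : ℝ}
    (hP : p ^ 2 - ‖P‖ ^ 2 = 1) (hA : a ^ 2 - ‖A‖ ^ 2 = 1) (hB : b ^ 2 - ‖B‖ ^ 2 = 1)
    (hPA : p * a - inner ℝ P A = Real.cosh σ) (hPB : p * b - inner ℝ P B = Real.cosh (T - σ))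
    (hAB : a * b - inner ℝ A B = Real.cosh T) :
    Real.sinh T * p = Real.sinh (T - σ) * a + Real.sinh σ * b ∧
      Real.sinh T • P = Real.sinh (T - σ) • A + Real.sinh σ • B := by
  -- The Minkowski vector (v, V) measures the failure of the claimed linear relation. It turns out
  -- to be orthogonal to all three given vectors, hence to itself.
  set V : E3 := Real.sinh T • P - Real.sinh (T - σ) • A - Real.sinh σ • B with hV
  set v : ℝ := Real.sinh T * p - Real.sinh (T - σ) * a - Real.sinh σ * b with hv
  have hBA : inner ℝ B A = inner ℝ A B := real_inner_comm _ _
  have hAP : inner ℝ A P = inner ℝ P A := real_inner_comm _ _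
  have hBP : inner ℝ B P = inner ℝ P B := real_inner_comm _ _
  have hVA : v * a - inner ℝ V A = 0 := by
    have : v * a - inner ℝ V A = Real.sinh T * (p * a - inner ℝ P A) -
        Real.sinh (T - σ) * (a ^ 2 - ‖A‖ ^ 2) - Real.sinh σ * (a * b - inner ℝ A B) := by
      simp only [hV, hv, inner_sub_left, inner_smul_left, real_inner_self_eq_norm_sq, hBA]
      simp; ring
    rw [this, hPA, hA, hAB, Real.sinh_sub]; ring
  have hVB : v * b - inner ℝ V B = 0 := by
    have : v * b - inner ℝ V B = Real.sinh T * (p * b - inner ℝ P B) -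
        Real.sinh (T - σ) * (a * b - inner ℝ A B) - Real.sinh σ * (b ^ 2 - ‖B‖ ^ 2) := by
      simp only [hV, hv, inner_sub_left, inner_smul_left, real_inner_self_eq_norm_sq]
      simp; ring
    rw [this, hPB, hB, hAB, Real.sinh_sub, Real.cosh_sub]
    linear_combination Real.sinh σ * Real.cosh_sq T
  have hVP : v * p - inner ℝ V P = 0 := by
    have : v * p - inner ℝ V P = Real.sinh T * (p ^ 2 - ‖P‖ ^ 2) -
        Real.sinh (T - σ) * (p * a - inner ℝ P A) - Real.sinh σ * (p * b - inner ℝ P B) := by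
      simp only [hV, hv, inner_sub_left, inner_smul_left, real_inner_self_eq_norm_sq, hAP, hBP]
      simp; ring
    rw [this, hPA, hP, hPB, Real.sinh_sub, Real.cosh_sub]
    linear_combination -Real.sinh T * Real.cosh_sq σ
  have hVV : v ^ 2 - ‖V‖ ^ 2 = 0 := by
    have : v ^ 2 - ‖V‖ ^ 2 = Real.sinh T * (v * p - inner ℝ V P) -
        Real.sinh (T - σ) * (v * a - inner ℝ V A) - Real.sinh σ * (v * b - inner ℝ V B) := by
      have e : inner ℝ V V = Real.sinh T * inner ℝ V P - Real.sinh (T - σ) * inner ℝ V A -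
          Real.sinh σ * inner ℝ V B := by
        conv_lhs => rw [hV, inner_sub_right, inner_sub_right, inner_smul_right, inner_smul_right,
          inner_smul_right, ← hV]
      rw [← real_inner_self_eq_norm_sq, e]
      linear_combination v * hv
    rw [this, hVA, hVB, hVP]; ring
  -- A null vector orthogonal to a timelike one is zero: Cauchy–Schwarz gives v²a² ≤ v²(a² − 1).
  have hCS : (v * a) ^ 2 ≤ ‖V‖ ^ 2 * ‖A‖ ^ 2 := by
    rw [show v * a = inner ℝ V A by linarith, ← mul_pow, ← sq_abs]
    exact pow_le_pow_left₀ (abs_nonneg _) (abs_real_inner_le_norm V A) 2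
  have hv0 : v ^ 2 ≤ 0 := by
    have h1 : ‖V‖ ^ 2 = v ^ 2 := by linarith
    have h2 : ‖A‖ ^ 2 = a ^ 2 - 1 := by linarith
    rw [h1, h2] at hCS
    nlinarith
  have hv1 : v = 0 := by nlinarith [sq_nonneg v]
  have hV1 : V = 0 := by
    have : ‖V‖ ^ 2 = 0 := by rw [hv1] at hVV; linarith
    simpa using this
  constructor
  · linarith
  · rw [hV, sub_sub, sub_eq_zero] at hV1
    exact hV1

theorem cosh_hypDist {x y : E3} (hx : ‖x‖ < 1) (hy : ‖y‖ < 1) :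
    Real.cosh (hypDist x y) = (1 + ‖x‖ ^ 2) / (1 - ‖x‖ ^ 2) * ((1 + ‖y‖ ^ 2) / (1 - ‖y‖ ^ 2)) -
      inner ℝ ((2 / (1 - ‖x‖ ^ 2)) • x) ((2 / (1 - ‖y‖ ^ 2)) • y) := by
  have h1 : 0 < 1 - ‖x‖ ^ 2 := by nlinarith [norm_nonneg x]
  have h2 : 0 < 1 - ‖y‖ ^ 2 := by nlinarith [norm_nonneg y]
  rw [hypDist, Real.cosh_arcosh (by have : 0 ≤ 2 * ‖x - y‖ ^ 2 /
    ((1 - ‖x‖ ^ 2) * (1 - ‖y‖ ^ 2)) := by positivity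
                                    linarith), norm_sub_sq_real, inner_smul_left, inner_smul_right]
  simp only [conj_trivial]
  field_simp
  ring

/-- A point of hyperbolic space on the line through two points is determined by its distances. -/
theorem eq_of_hypDist_eq {p q a b : E3} (hp : ‖p‖ < 1) (hq : ‖q‖ < 1) (ha : ‖a‖ < 1)
    (hb : ‖b‖ < 1) {σ T : ℝ} (hT : T ≠ 0) (hab : hypDist a b = |T|)
    (hpa : hypDist p a = |σ|) (hqa : hypDist q a = |σ|)
    (hpb : hypDist p b = |T - σ|) (hqb : hypDist q b = |T - σ|) : p = q := by
  have key : ∀ x : E3, ‖x‖ < 1 → ((1 + ‖x‖ ^ 2) / (1 - ‖x‖ ^ 2)) ^ 2 -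
      ‖(2 / (1 - ‖x‖ ^ 2)) • x‖ ^ 2 = 1 := by
    intro x hx
    have h1 : 0 < 1 - ‖x‖ ^ 2 := by nlinarith [norm_nonneg x]
    rw [norm_smul, mul_pow, Real.norm_eq_abs, sq_abs]
    field_simp
    ring
  have hs : Real.sinh T ≠ 0 := by simpa using hT
  have c : ∀ {x y : E3} (_ : ‖x‖ < 1) (_ : ‖y‖ < 1) {r : ℝ} (_ : hypDist x y = |r|),
      (1 + ‖x‖ ^ 2) / (1 - ‖x‖ ^ 2) * ((1 + ‖y‖ ^ 2) / (1 - ‖y‖ ^ 2)) -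
      inner ℝ ((2 / (1 - ‖x‖ ^ 2)) • x) ((2 / (1 - ‖y‖ ^ 2)) • y) = Real.cosh r := by
    intro x y hx hy r h
    rw [← cosh_hypDist hx hy, h, Real.cosh_abs]
  obtain ⟨h1, h2⟩ := minkowski_eq_of_collinear (key p hp) (key a ha) (key b hb) (c hp ha hpa)
    (c hp hb hpb) (c ha hb hab)
  obtain ⟨h3, h4⟩ := minkowski_eq_of_collinear (key q hq) (key a ha) (key b hb) (c hq ha hqa)
    (c hq hb hqb) (c ha hb hab)
  rw [← h3] at h1
  rw [← h4] at h2
  have e1 := mul_left_cancel₀ hs h1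
  have e2 := smul_right_injective E3 hs h2
  have hp1 : 0 < 1 - ‖p‖ ^ 2 := by nlinarith [norm_nonneg p]
  have hq1 : 0 < 1 - ‖q‖ ^ 2 := by nlinarith [norm_nonneg q]
  have e3 : ‖p‖ ^ 2 = ‖q‖ ^ 2 := by
    field_simp at e1
    linarith
  simp only [e3] at e2
  exact smul_right_injective E3 (show 2 / (1 - ‖q‖ ^ 2) ≠ 0 by positivity) e2

/-- A point is determined by its distances to two points of a line on which it lies, so a unit-speed
geodesic line through two points of `geo x y` is `geo x y` up to a shift of the parameter. -/
theorem IsGeodesicLine.eq_geo {γ : EReal → E3} (hγ : IsGeodesicLine γ) {x y : E3} (hx : ‖x‖ = 1)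
    (hy : ‖y‖ = 1) (hxy : x ≠ y) {s t s' t' : ℝ} (hst : s < t) (hst' : s' < t')
    (hs : γ s = geo x y (Real.exp s')) (ht : γ t = geo x y (Real.exp t')) (r : ℝ) :
    γ (r : ℝ) = geo x y (Real.exp (r + (s' - s))) := by
  have h1 := hγ.hypDist_eq s t
  rw [hs, ht, hypDist_geo_exp hx hy hxy, abs_sub_comm, abs_sub_comm s t,
    abs_of_pos (by linarith), abs_of_pos (by linarith)] at h1
  have hg : ∀ r, ‖geo x y (Real.exp r)‖ < 1 := fun r => norm_geo_lt_one hx hy hxy (Real.exp_pos r)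
  refine eq_of_hypDist_eq (a := γ s) (b := γ t) (σ := r - s) (T := t - s) (hγ.norm_lt_one r)
    (hg _) (hγ.norm_lt_one s) (hγ.norm_lt_one t) (by linarith) ?_ ?_ ?_ ?_ ?_
  · rw [hγ.hypDist_eq, abs_sub_comm]
  · rw [hγ.hypDist_eq]
  · rw [hs, hypDist_geo_exp hx hy hxy]; congr 1; ring
  · rw [hγ.hypDist_eq, abs_sub_comm]; congr 1; ring
  · rw [ht, hypDist_geo_exp hx hy hxy, abs_sub_comm]; congr 1; linarith

theorem isEndpointPair_geo {x y : S2} (hxy : x ≠ y) {u v : ℝ} (hu : 0 < u) (huv : u < v) :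
    IsEndpointPair (geo x y u, geo x y v) (x, y) := by
  have hx : ‖(x : E3)‖ = 1 := by simp
  have hy : ‖(y : E3)‖ = 1 := by simp
  refine ⟨geoE x y, isGeodesicLine_geoE hx hy (Subtype.coe_injective.ne hxy),
    ⟨(Real.log u : ℝ), (Real.log v : ℝ), ?_, ?_, ?_⟩, geoE_bot _ _, geoE_top _ _⟩
  · exact EReal.coe_lt_coe_iff.2 (Real.log_lt_log hu huv)
  · rw [geoE_coe, Real.exp_log hu]
  · rw [geoE_coe, Real.exp_log (hu.trans huv)]

/-- Uniqueness of the endpoints, which makes the choice in `rMap` harmless. The two points are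
interior, so they have finite parameters; the geodesic is then a shifted `geoE x y` on the reals,
and continuity at ±∞ carries the equality to the ideal points. -/
theorem IsEndpointPair.eq_of_geo {x y : S2} (hxy : x ≠ y) {u v : ℝ} (hu : 0 < u) (huv : u < v)
    {z : S2 × S2} (h : IsEndpointPair (geo x y u, geo x y v) z) : z = (x, y) := by
  have hx : ‖(x : E3)‖ = 1 := by simp
  have hy : ‖(y : E3)‖ = 1 := by simp
  have hxy' : (x : E3) ≠ y := Subtype.coe_injective.ne hxy
  have hv : 0 < v := hu.trans huv
  obtain ⟨γ, hγ, ⟨s, t, hst, hs, ht⟩, hbot, htop⟩ := h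
  simp only at hs ht
  have hbot1 : ‖γ ⊥‖ = 1 := by rw [hbot]; simp
  have htop1 : ‖γ ⊤‖ = 1 := by rw [htop]; simp
  have hu1 := norm_geo_lt_one hx hy hxy' hu
  have hv1 := norm_geo_lt_one hx hy hxy' hv
  rw [← hs] at hu1
  rw [← ht] at hv1
  have hsb : s ≠ ⊥ := by rintro rfl; linarith
  have hst' : s ≠ ⊤ := by rintro rfl; linarith
  have htb : t ≠ ⊥ := by rintro rfl; linarith
  have htt : t ≠ ⊤ := by rintro rfl; linarith
  lift s to ℝ using ⟨hst', hsb⟩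
  lift t to ℝ using ⟨htt, htb⟩
  have key := hγ.eq_geo hx hy hxy' (EReal.coe_lt_coe_iff.1 hst) (Real.log_lt_log hu huv)
    (by rw [hs, Real.exp_log hu]) (by rw [ht, Real.exp_log hv])
  set d := Real.log u - s
  -- One argument for both ends: the shift by d does not affect limits at ±∞.
  have hlim : ∀ (e : EReal) (l : Filter ℝ), l.NeBot → Tendsto (fun r : ℝ => (r : EReal)) l (𝓝 e) →
      Tendsto (fun r : ℝ => ((r + d : ℝ) : EReal)) l (𝓝 e) → γ e = geoE x y e := by
    intro e l hl h1 h2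
    refine tendsto_nhds_unique ((hγ.continuous.tendsto e).comp h1) ?_
    refine ((continuous_geoE x y).tendsto e).comp h2 |>.congr fun r => ?_
    simp only [Function.comp]
    rw [geoE_coe, key]
  have h1 := hlim ⊥ atBot inferInstance (EReal.tendsto_coe_nhds_bot_iff.2 tendsto_id)
    (EReal.tendsto_coe_nhds_bot_iff.2 (tendsto_atBot_add_const_right _ _ tendsto_id))
  have h2 := hlim ⊤ atTop inferInstance (EReal.tendsto_coe_nhds_top_iff.2 tendsto_id)
    (EReal.tendsto_coe_nhds_top_iff.2 (tendsto_atTop_add_const_right _ _ tendsto_id))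
  rw [geoE_bot, hbot] at h1
  rw [geoE_top, htop] at h2
  exact Prod.ext (Subtype.ext h1) (Subtype.ext h2)

theorem rMap_geo {x y : S2} (hxy : x ≠ y) {u v : ℝ} (hu : 0 < u) (huv : u < v) :
    rMap (geo x y u, geo x y v) = (x, y) :=
  IsEndpointPair.eq_of_geo hxy hu huv
    (Classical.epsilon_spec (p := IsEndpointPair (geo (x : E3) y u, geo (x : E3) y v))
      ⟨_, isEndpointPair_geo hxy hu huv⟩)

theorem geo_injOn {x y : E3} (hx : ‖x‖ = 1) (hy : ‖y‖ = 1) (hxy : x ≠ y) :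
    InjOn (geo x y) (Ioi 0) := by
  intro u hu v hv h
  have h1 := hypDist_geo_exp hx hy hxy (Real.log u) (Real.log v)
  have h2 := hypDist_geo_exp hx hy hxy (Real.log v) (Real.log v)
  rw [Real.exp_log hu, Real.exp_log hv, h] at h1
  rw [Real.exp_log hv] at h2
  rw [h2, sub_self, abs_zero, eq_comm, abs_eq_zero, sub_eq_zero] at h1
  exact Real.log_injOn_pos hu hv h1

end Geodesics

/-! ### The diffeomorphism `geoPair` from endpoints and parameters to pairs of interior points. -/

section Parametrization

/-- Sylvester's identity; it reduces determinants of low-rank perturbations of the identity to small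
ones. -/
theorem LinearMap.det_id_add_comp_comm {V F : Type*} [AddCommGroup V] [Module ℝ V]
    [FiniteDimensional ℝ V] [AddCommGroup F] [Module ℝ F] [FiniteDimensional ℝ F]
    (A : F →ₗ[ℝ] V) (B : V →ₗ[ℝ] F) :
    LinearMap.det (LinearMap.id + A ∘ₗ B) = LinearMap.det (LinearMap.id + B ∘ₗ A) := by
  let b := Module.finBasis ℝ V
  let c := Module.finBasis ℝ F
  rw [← LinearMap.det_toMatrix b, ← LinearMap.det_toMatrix c, map_add, map_add,
    LinearMap.toMatrix_id, LinearMap.toMatrix_id, LinearMap.toMatrix_comp b c b,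
    LinearMap.toMatrix_comp c b c, Matrix.det_one_add_mul_comm]

/-- The determinant of `a ↦ g a + h φ(a) w`. -/
theorem LinearMap.det_smul_id_add_smulRight {V : Type*} [AddCommGroup V] [Module ℝ V]
    [FiniteDimensional ℝ V] {g : ℝ} (hg : g ≠ 0) (φ : V →ₗ[ℝ] ℝ) (w : V) :
    LinearMap.det (g • LinearMap.id + φ.smulRight w) =
      g ^ Module.finrank ℝ V * (1 + φ w / g) := by
  have h : g • LinearMap.id + φ.smulRight w =
      g • (LinearMap.id + (LinearMap.toSpanSingleton ℝ V (g⁻¹ • w)) ∘ₗ φ) := by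
    ext v
    simp [smul_smul]
    rw [mul_comm (φ v), mul_inv_cancel_left₀ hg]
  rw [h, LinearMap.det_smul, LinearMap.det_id_add_comp_comm]
  congr 1
  have h2 : LinearMap.id + φ ∘ₗ LinearMap.toSpanSingleton ℝ V (g⁻¹ • w) =
      (1 + φ w / g) • LinearMap.id := by
    ext
    simp
    ring
  rw [h2, LinearMap.det_smul]
  simp

/-- The direction of a nonzero vector. -/
def dir (p : E3) : E3 := ‖p‖⁻¹ • p

theorem norm_dir {p : E3} (hp : p ≠ 0) : ‖dir p‖ = 1 := by
  rw [dir, norm_smul, norm_inv, norm_norm, inv_mul_cancel₀ (norm_ne_zero_iff.2 hp)]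

theorem norm_smul_dir {p : E3} (hp : p ≠ 0) : ‖p‖ • dir p = p := by
  rw [dir, smul_smul, mul_inv_cancel₀ (norm_ne_zero_iff.2 hp), one_smul]

theorem dir_smul {x : E3} (hx : ‖x‖ = 1) {r : ℝ} (hr : 0 < r) : dir (r • x) = x := by
  rw [dir, norm_smul, hx, Real.norm_of_nonneg hr.le, smul_smul, mul_one, inv_mul_cancel₀ hr.ne',
    one_smul]

theorem hasFDerivAt_norm_dir {p : E3} (hp : p ≠ 0) :
    HasFDerivAt (fun p : E3 => ‖p‖) (innerSL ℝ (dir p)) p := by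
  have h := (hasStrictFDerivAt_norm_sq p).hasFDerivAt.sqrt (by simpa using hp)
  simp only [Real.sqrt_sq (norm_nonneg _)] at h
  refine h.congr_fderiv ?_
  ext v
  simp [dir]
  field_simp

/-- The derivative of `dir`. -/
def dirDeriv (p : E3) : E3 →L[ℝ] E3 :=
  ‖p‖⁻¹ • (ContinuousLinearMap.id ℝ E3 - (innerSL ℝ (dir p)).smulRight (dir p))

theorem dirDeriv_apply (p a : E3) :
    dirDeriv p a = ‖p‖⁻¹ • (a - inner ℝ (dir p) a • dir p) := by
  simp [dirDeriv]

theorem hasFDerivAt_dir {p : E3} (hp : p ≠ 0) : HasFDerivAt dir (dirDeriv p) p := by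
  have hn := norm_ne_zero_iff.2 hp
  have h := ((hasDerivAt_inv hn).comp_hasFDerivAt p (hasFDerivAt_norm_dir hp)).smul
    (hasFDerivAt_id p)
  refine h.congr_fderiv ?_
  ext1 a
  rw [dirDeriv_apply]
  simp only [add_apply, smul_apply,
    ContinuousLinearMap.smulRight_apply, innerSL_apply_apply, ContinuousLinearMap.id_apply, id,
    smul_sub]
  nth_rewrite 3 [dir]
  simp only [smul_smul, smul_eq_mul]
  rw [sub_eq_add_neg, ← neg_smul]
  congr 2
  field_simp

theorem contDiffAt_dir {p : E3} (hp : p ≠ 0) : ContDiffAt ℝ ∞ dir p :=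
  ((contDiffAt_norm ℝ hp).inv (norm_ne_zero_iff.2 hp)).smul contDiffAt_id

/-- The change from the Klein model to the Poincaré model. -/
def kleinToPoincare (k : E3) : E3 := (1 + √(1 - ‖k‖ ^ 2))⁻¹ • k

/-- The derivative is a positive multiple of the identity plus a positive multiple of ⟨k, ·⟩k, so it
preserves orientation. Signs of Jacobians can thus be computed in the Klein model, where geodesics
are straight chords. -/
theorem exists_hasFDerivAt_kleinToPoincare {k : E3} (hk : ‖k‖ < 1) :
    ∃ A : E3 →L[ℝ] E3, HasFDerivAt kleinToPoincare A k ∧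
      0 < LinearMap.det (A : E3 →ₗ[ℝ] E3) := by
  have h1 : 0 < 1 - ‖k‖ ^ 2 := by nlinarith [norm_nonneg k]
  set s := √(1 - ‖k‖ ^ 2) with hs
  have hs0 : 0 < s := Real.sqrt_pos.2 h1
  have hd : HasFDerivAt (fun k : E3 => 1 + √(1 - ‖k‖ ^ 2)) (-(s⁻¹ • innerSL ℝ k)) k := by
    have h := (((hasStrictFDerivAt_norm_sq k).hasFDerivAt.const_sub 1).sqrt h1.ne').const_add 1
    refine h.congr_fderiv ?_
    ext v
    simp [← hs]
    field_simp
  have h := ((hasDerivAt_inv (show 1 + s ≠ 0 by positivity)).comp_hasFDerivAt k hd).smul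
    (hasFDerivAt_id k)
  refine ⟨_, h, ?_⟩
  have e : (((1 + s)⁻¹ • ContinuousLinearMap.id ℝ E3 +
      ((-((1 + s) ^ 2)⁻¹) • (-(s⁻¹ • innerSL ℝ k))).smulRight k : E3 →L[ℝ] E3) : E3 →ₗ[ℝ] E3) =
      (1 + s)⁻¹ • LinearMap.id + LinearMap.smulRight
        ((((1 + s) ^ 2)⁻¹ * s⁻¹) • (innerSL ℝ k : E3 →ₗ[ℝ] ℝ)) k := by
    ext v
    simp [smul_smul]
  have h2 : 0 < LinearMap.det (((1 + s)⁻¹ • ContinuousLinearMap.id ℝ E3 +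
      ((-((1 + s) ^ 2)⁻¹) • (-(s⁻¹ • innerSL ℝ k))).smulRight k : E3 →L[ℝ] E3) : E3 →ₗ[ℝ] E3) := by
    rw [e, LinearMap.det_smul_id_add_smulRight (by positivity)]
    simp only [LinearMap.smul_apply, ContinuousLinearMap.coe_coe, innerSL_apply_apply,
      real_inner_self_eq_norm_sq, smul_eq_mul]
    positivity
  exact h2

/-- The point of the chord from `x` to `y` that corresponds to `geo x y u`. -/
def chord (x y : E3) (u : ℝ) : E3 := (1 - u ^ 2 / (1 + u ^ 2)) • x + (u ^ 2 / (1 + u ^ 2)) • y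

theorem one_sub_norm_chord_sq {x y : E3} (hx : ‖x‖ = 1) (hy : ‖y‖ = 1) (u : ℝ) :
    1 - ‖chord x y u‖ ^ 2 = (‖x - y‖ * u / (1 + u ^ 2)) ^ 2 := by
  have h : chord x y u = (1 + u ^ 2)⁻¹ • (x + u ^ 2 • y) := by
    rw [chord, smul_add, smul_smul]
    congr 2
    · field_simp; ring
    · ring
  rw [h, norm_smul, mul_pow, ← real_inner_self_eq_norm_sq (x + u ^ 2 • y),
    inner_add_smul_add_smul hx hy, Real.norm_eq_abs, sq_abs]
  field_simp
  ring

theorem norm_chord_lt_one {x y : E3} (hx : ‖x‖ = 1) (hy : ‖y‖ = 1) (hxy : x ≠ y) {u : ℝ}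
    (hu : 0 < u) : ‖chord x y u‖ < 1 := by
  have h := one_sub_norm_chord_sq hx hy u
  have hc : 0 < ‖x - y‖ := norm_pos_iff.2 (sub_ne_zero.2 hxy)
  have : 0 < (‖x - y‖ * u / (1 + u ^ 2)) ^ 2 := by positivity
  nlinarith [norm_nonneg (chord x y u)]

theorem kleinToPoincare_chord {x y : E3} (hx : ‖x‖ = 1) (hy : ‖y‖ = 1) {u : ℝ} (hu : 0 ≤ u) :
    kleinToPoincare (chord x y u) = geo x y u := by
  have hD := geo_den_pos x y hu
  rw [kleinToPoincare, one_sub_norm_chord_sq hx hy, Real.sqrt_sq (by positivity), geo, chord,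
    smul_add, smul_add, smul_smul, smul_smul, smul_smul]
  congr 2 <;> field_simp <;> ring

/-- The pair of points on the chord between the directions of `p.1` and `p.2`, with parameters the
norms of `p.1` and `p.2`. -/
def chordPair (p : E3 × E3) : E3 × E3 :=
  (chord (dir p.1) (dir p.2) ‖p.1‖, chord (dir p.1) (dir p.2) ‖p.2‖)

/-- The pair of points on the geodesic between the directions of `p.1` and `p.2`, with parameters
the norms of `p.1` and `p.2`. -/
def geoPair (p : E3 × E3) : E3 × E3 :=
  (geo (dir p.1) (dir p.2) ‖p.1‖, geo (dir p.1) (dir p.2) ‖p.2‖)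

/-- The domain on which `geoPair` is a diffeomorphism onto the interior of `Conf2`. -/
def paramDomain : Set (E3 × E3) := {p | p.1 ≠ 0 ∧ ‖p.1‖ < ‖p.2‖ ∧ dir p.1 ≠ dir p.2}

theorem snd_ne_zero {p : E3 × E3} (hp : p ∈ paramDomain) : p.2 ≠ 0 :=
  norm_pos_iff.1 ((norm_nonneg _).trans_lt hp.2.1)

/-- The determinant of the derivative of `chordPair`, as a purely algebraic statement. -/
theorem det_chord_aux {x y : E3} (hx : ‖x‖ = 1) (hy : ‖y‖ = 1) {u v l m l' m' : ℝ}
    (hu : u ≠ 0) (hv : v ≠ 0) (hlm : m - l ≠ 0) (A : E3 × E3 →ₗ[ℝ] E3 × E3)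
    (hA : ∀ a b, A (a, b) =
      ((1 - l) • u⁻¹ • (a - inner ℝ x a • x) + l • v⁻¹ • (b - inner ℝ y b • y) +
        (l' * inner ℝ x a) • (y - x),
       (1 - m) • u⁻¹ • (a - inner ℝ x a • x) + m • v⁻¹ • (b - inner ℝ y b • y) +
        (m' * inner ℝ y b) • (y - x))) :
    LinearMap.det A =
      -((1 - inner ℝ x y) ^ 2 * (m - l) ^ 2 * l' * m' * (u⁻¹ ^ 2 * v⁻¹ ^ 2)) := by
  have hxx : inner ℝ x x = 1 := by rw [real_inner_self_eq_norm_sq, hx]; norm_num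
  have hyy : inner ℝ y y = 1 := by rw [real_inner_self_eq_norm_sq, hy]; norm_num
  have hyx : inner ℝ y x = inner ℝ x y := real_inner_comm _ _
  let fx : E3 →ₗ[ℝ] ℝ := (innerSL ℝ x : E3 →ₗ[ℝ] ℝ)
  let fy : E3 →ₗ[ℝ] ℝ := (innerSL ℝ y : E3 →ₗ[ℝ] ℝ)
  have hfx : ∀ a, fx a = inner ℝ x a := fun a => rfl
  have hfy : ∀ a, fy a = inner ℝ y a := fun a => rfl
  -- `S` is the identity in the radial directions and scales the tangential ones by u⁻¹ and v⁻¹,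
  -- like the derivatives of the direction maps.
  let S : E3 × E3 →ₗ[ℝ] E3 × E3 :=
    (u⁻¹ • LinearMap.id + fx.smulRight ((1 - u⁻¹) • x)).prodMap
      (v⁻¹ • LinearMap.id + fy.smulRight ((1 - v⁻¹) • y))
  have hS : LinearMap.det S = u⁻¹ ^ 2 * v⁻¹ ^ 2 := by
    rw [LinearMap.det_prodMap, LinearMap.det_smul_id_add_smulRight (inv_ne_zero hu),
      LinearMap.det_smul_id_add_smulRight (inv_ne_zero hv)]
    simp only [hfx, hfy, inner_smul_right, hxx, hyy, finrank_euclideanSpace, Fintype.card_fin]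
    field_simp
    ring
  -- The identity plus `U ∘ W` sends (c, d) to ((1 − l)c + ld, (1 − m)c + md), the mixing of
  -- endpoint variations into chord points.
  let U : E3 →ₗ[ℝ] E3 × E3 := (l • LinearMap.id).prod (-(1 - m) • LinearMap.id)
  let W : E3 × E3 →ₗ[ℝ] E3 := LinearMap.snd ℝ E3 E3 - LinearMap.fst ℝ E3 E3
  have hM : LinearMap.det (LinearMap.id + U ∘ₗ W) = (m - l) ^ 3 := by
    rw [LinearMap.det_id_add_comp_comm]
    have : LinearMap.id + W ∘ₗ U = (m - l) • LinearMap.id := by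
      ext1 a
      simp only [LinearMap.add_apply, LinearMap.id_apply, LinearMap.comp_apply, W, U,
        LinearMap.sub_apply, LinearMap.snd_apply, LinearMap.fst_apply, LinearMap.prod_apply,
        Function.prod_apply, LinearMap.smul_apply]
      module
    rw [this, LinearMap.det_smul]
    simp
  -- The inverse of the mixing matrix with rows (1 − l, l) and (1 − m, m), times diag(l', m'). With
  -- this choice the mixing applied after `P` produces exactly the displacements l' and m' along the
  -- chord, while the −x and −y terms of `P` remove the radial parts kept by `S`.
  let N := !![l' * m / (m - l), -(l * m') / (m - l);
    -(l' * (1 - m)) / (m - l), m' * (1 - l) / (m - l)]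
  let P : (Fin 2 → ℝ) →ₗ[ℝ] E3 × E3 :=
    { toFun := fun z => (-z 0 • x + (N 0 0 * z 0 + N 0 1 * z 1) • (y - x),
        -z 1 • y + (N 1 0 * z 0 + N 1 1 * z 1) • (y - x))
      map_add' := fun z w => by
        simp only [Pi.add_apply, Prod.mk_add_mk]
        congr 1 <;> module
      map_smul' := fun c z => by
        simp only [Pi.smul_apply, smul_eq_mul, RingHom.id_apply, Prod.smul_mk]
        congr 1 <;> module }
  let Q : E3 × E3 →ₗ[ℝ] (Fin 2 → ℝ) :=
    { toFun := fun a => ![inner ℝ x a.1, inner ℝ y a.2]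
      map_add' := fun a b => by simp [inner_add_right]
      map_smul' := fun c a => by simp [inner_smul_right] }
  have hT : LinearMap.det (LinearMap.id + P ∘ₗ Q) =
      -((1 - inner ℝ x y) ^ 2 * (l' * m' / (m - l))) := by
    rw [LinearMap.det_id_add_comp_comm]
    have : LinearMap.id + Q ∘ₗ P = Matrix.toLin' !![(inner ℝ x y - 1) * N 0 0,
        (inner ℝ x y - 1) * N 0 1; (1 - inner ℝ x y) * N 1 0, (1 - inner ℝ x y) * N 1 1] := by
      refine LinearMap.ext fun z => ?_
      ext i
      fin_cases i
      · simp [P, Q, inner_add_right, inner_sub_right, inner_smul_right, hx, hy, hyx,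
          Matrix.mulVec, dotProduct, Fin.sum_univ_two]
        ring
      · simp [P, Q, inner_add_right, inner_sub_right, inner_smul_right, hx, hy, hyx,
          Matrix.mulVec, dotProduct, Fin.sum_univ_two]
        ring
    rw [this, LinearMap.det_toLin', Matrix.det_fin_two]
    simp [N]
    field_simp
    ring
  have key : A = (LinearMap.id + U ∘ₗ W) ∘ₗ (LinearMap.id + P ∘ₗ Q) ∘ₗ S := by
    have e1 : (1 - l) * N 0 0 + l * N 1 0 = l' := by simp [N]; field_simp; ring
    have e2 : (1 - l) * N 0 1 + l * N 1 1 = 0 := by simp [N]; field_simp; ring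
    have e3 : (1 - m) * N 0 0 + m * N 1 0 = 0 := by simp [N]; field_simp; ring
    have e4 : (1 - m) * N 0 1 + m * N 1 1 = m' := by simp [N]; field_simp; ring
    refine LinearMap.ext fun ⟨a, b⟩ => ?_
    rw [hA]
    have hSab : S (a, b) = (u⁻¹ • a + inner ℝ x a • (1 - u⁻¹) • x,
        v⁻¹ • b + inner ℝ y b • (1 - v⁻¹) • y) := rfl
    have hQ : Q (S (a, b)) = ![inner ℝ x a, inner ℝ y b] := by
      rw [hSab]
      simp [Q, inner_add_right, inner_smul_right, hx, hy]
      constructor <;> ring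
    have hT' : (LinearMap.id + P ∘ₗ Q : E3 × E3 →ₗ[ℝ] E3 × E3) (S (a, b)) =
        (u⁻¹ • (a - inner ℝ x a • x) +
          (N 0 0 * inner ℝ x a + N 0 1 * inner ℝ y b) • (y - x),
        v⁻¹ • (b - inner ℝ y b • y) +
          (N 1 0 * inner ℝ x a + N 1 1 * inner ℝ y b) • (y - x)) := by
      rw [LinearMap.add_apply, LinearMap.comp_apply, hQ, LinearMap.id_apply, hSab]
      simp only [P, LinearMap.coe_mk, AddHom.coe_mk, Prod.mk_add_mk, Matrix.cons_val_zero,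
        Matrix.cons_val_one]
      congr 1 <;> module
    rw [LinearMap.comp_apply, LinearMap.comp_apply, hT']
    have hU : ∀ c d : E3, (LinearMap.id + U ∘ₗ W : E3 × E3 →ₗ[ℝ] E3 × E3) (c, d) =
        ((1 - l) • c + l • d, (1 - m) • c + m • d) := by
      intro c d
      simp only [LinearMap.add_apply, LinearMap.id_apply, LinearMap.comp_apply, W, U,
        LinearMap.sub_apply, LinearMap.snd_apply, LinearMap.fst_apply, LinearMap.prod_apply,
        Function.prod_apply, LinearMap.smul_apply, Prod.mk_add_mk]
      congr 1 <;> module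
    rw [hU]
    congr 1
    · rw [← e1]
      linear_combination (norm := module) (-inner ℝ y b * e2) • (y - x)
    · rw [← e4]
      linear_combination (norm := module) (-inner ℝ x a * e3) • (y - x)
  rw [key, LinearMap.det_comp, LinearMap.det_comp, hM, hT, hS]
  field_simp

theorem hasFDerivAt_chordPair {p : E3 × E3} (h1 : p.1 ≠ 0) (h2 : p.2 ≠ 0) :
    ∃ A : E3 × E3 →L[ℝ] E3 × E3, HasFDerivAt chordPair A p ∧
      ∀ a b, A (a, b) =
        ((1 - ‖p.1‖ ^ 2 / (1 + ‖p.1‖ ^ 2)) • dirDeriv p.1 a +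
          (‖p.1‖ ^ 2 / (1 + ‖p.1‖ ^ 2)) • dirDeriv p.2 b +
          (2 * ‖p.1‖ / (1 + ‖p.1‖ ^ 2) ^ 2 * inner ℝ (dir p.1) a) • (dir p.2 - dir p.1),
         (1 - ‖p.2‖ ^ 2 / (1 + ‖p.2‖ ^ 2)) • dirDeriv p.1 a +
          (‖p.2‖ ^ 2 / (1 + ‖p.2‖ ^ 2)) • dirDeriv p.2 b +
          (2 * ‖p.2‖ / (1 + ‖p.2‖ ^ 2) ^ 2 * inner ℝ (dir p.2) b) • (dir p.2 - dir p.1)) := by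
  have hd : ∀ u : ℝ, HasDerivAt (fun u : ℝ => u ^ 2 / (1 + u ^ 2)) (2 * u / (1 + u ^ 2) ^ 2) u := by
    intro u
    have h := ((hasDerivAt_id u).pow 2).div (((hasDerivAt_id u).pow 2).const_add 1)
      (show 1 + u ^ 2 ≠ 0 by positivity)
    refine h.congr_deriv ?_
    simp
    ring
  have hx := (hasFDerivAt_dir h1).comp p (hasFDerivAt_fst (𝕜 := ℝ) (E := E3) (F := E3))
  have hy := (hasFDerivAt_dir h2).comp p (hasFDerivAt_snd (𝕜 := ℝ) (E := E3) (F := E3))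
  have hu := (hd ‖p.1‖).comp_hasFDerivAt p
    ((hasFDerivAt_norm_dir h1).comp p (hasFDerivAt_fst (𝕜 := ℝ) (E := E3) (F := E3)))
  have hv := (hd ‖p.2‖).comp_hasFDerivAt p
    ((hasFDerivAt_norm_dir h2).comp p (hasFDerivAt_snd (𝕜 := ℝ) (E := E3) (F := E3)))
  refine ⟨_, (((hu.const_sub 1).smul hx).add (hu.smul hy)).prodMk
    (((hv.const_sub 1).smul hx).add (hv.smul hy)), fun a b => ?_⟩
  simp only [ContinuousLinearMap.prod_apply, add_apply, smul_apply, neg_apply,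
    ContinuousLinearMap.smulRight_apply, ContinuousLinearMap.comp_apply,
    ContinuousLinearMap.coe_fst', ContinuousLinearMap.coe_snd', innerSL_apply_apply,
    Function.comp_apply, smul_eq_mul]
  congr 1 <;> module

theorem inner_ne_one {x y : E3} (hx : ‖x‖ = 1) (hy : ‖y‖ = 1) (hxy : x ≠ y) :
    1 - inner ℝ x y ≠ 0 := by
  have hc : 0 < ‖x - y‖ := norm_pos_iff.2 (sub_ne_zero.2 hxy)
  rw [inner_eq_of_norm_eq_one hx hy]
  have : 0 < ‖x - y‖ ^ 2 := by positivity
  linarith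

theorem geoPair_eq {p : E3 × E3} (h1 : p.1 ≠ 0) (h2 : p.2 ≠ 0) :
    geoPair p = Prod.map kleinToPoincare kleinToPoincare (chordPair p) := by
  rw [geoPair, chordPair, Prod.map_apply,
    kleinToPoincare_chord (norm_dir h1) (norm_dir h2) (norm_nonneg _),
    kleinToPoincare_chord (norm_dir h1) (norm_dir h2) (norm_nonneg _)]

theorem isOpen_paramDomain : IsOpen paramDomain := by
  rw [isOpen_iff_mem_nhds]
  intro p hp
  have h2 := snd_ne_zero hp
  have c1 : ContinuousAt (fun p : E3 × E3 => dir p.1) p :=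
    ContinuousAt.comp (f := Prod.fst) (contDiffAt_dir hp.1).continuousAt continuousAt_fst
  have c2 : ContinuousAt (fun p : E3 × E3 => dir p.2) p :=
    ContinuousAt.comp (f := Prod.snd) (contDiffAt_dir h2).continuousAt continuousAt_snd
  have e1 : ∀ᶠ q in 𝓝 p, q.1 ≠ 0 := continuousAt_fst.eventually_ne hp.1
  have e2 : ∀ᶠ q in 𝓝 p, ‖q.1‖ < ‖q.2‖ :=
    (isOpen_lt continuous_fst.norm continuous_snd.norm).mem_nhds hp.2.1
  have e3 : ∀ᶠ q in 𝓝 p, dir q.1 ≠ dir q.2 := c1.ne_iff_eventually_ne c2 |>.1 hp.2.2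
  filter_upwards [e1, e2, e3] with q h1 h2 h3 using ⟨h1, h2, h3⟩

theorem contDiffAt_geoPair {p : E3 × E3} (hp : p ∈ paramDomain) : ContDiffAt ℝ ∞ geoPair p := by
  have h1 := hp.1
  have h2 := snd_ne_zero hp
  have hx : ContDiffAt ℝ ∞ (fun p : E3 × E3 => dir p.1) p := (contDiffAt_dir h1).fst'
  have hy : ContDiffAt ℝ ∞ (fun p : E3 × E3 => dir p.2) p := (contDiffAt_dir h2).snd'
  have hu : ContDiffAt ℝ ∞ (fun p : E3 × E3 => ‖p.1‖) p := (contDiffAt_norm ℝ h1).fst'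
  have hv : ContDiffAt ℝ ∞ (fun p : E3 × E3 => ‖p.2‖) p := (contDiffAt_norm ℝ h2).snd'
  have hc : ContDiffAt ℝ ∞ (fun p : E3 × E3 => ‖dir p.1 - dir p.2‖) p :=
    (hx.sub hy).norm ℝ (sub_ne_zero.2 hp.2.2)
  refine ContDiffAt.prodMk ?_ ?_
  · exact (((contDiffAt_const.add (hc.mul hu)).add (hu.pow 2)).inv
      (geo_den_pos _ _ (norm_nonneg _)).ne').smul (hx.add ((hu.pow 2).smul hy))
  · exact (((contDiffAt_const.add (hc.mul hv)).add (hv.pow 2)).inv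
      (geo_den_pos _ _ (norm_nonneg _)).ne').smul (hx.add ((hv.pow 2).smul hy))

/-- This sign decides the sign of the limit. `geoPair` is the pair of chord points followed by two
orientation-preserving maps, and `det_chord_aux` gives minus a product of positive factors. -/
theorem det_fderiv_geoPair_neg {p : E3 × E3} (hp : p ∈ paramDomain) :
    LinearMap.det (fderiv ℝ geoPair p : E3 × E3 →ₗ[ℝ] E3 × E3) < 0 := by
  have h1 := hp.1
  have h2 := snd_ne_zero hp
  have hx := norm_dir h1
  have hy := norm_dir h2
  have hu : 0 < ‖p.1‖ := norm_pos_iff.2 h1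
  have hv : 0 < ‖p.2‖ := norm_pos_iff.2 h2
  obtain ⟨A, hA, hA'⟩ := hasFDerivAt_chordPair h1 h2
  obtain ⟨B, hB, hB'⟩ := exists_hasFDerivAt_kleinToPoincare (norm_chord_lt_one hx hy hp.2.2 hu)
  obtain ⟨C, hC, hC'⟩ := exists_hasFDerivAt_kleinToPoincare (norm_chord_lt_one hx hy hp.2.2 hv)
  have hBC : HasFDerivAt (Prod.map kleinToPoincare kleinToPoincare) (B.prodMap C) (chordPair p) :=
    HasFDerivAt.prodMap _ hB hC
  have hev : geoPair =ᶠ[𝓝 p] Prod.map kleinToPoincare kleinToPoincare ∘ chordPair := by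
    filter_upwards [isOpen_paramDomain.mem_nhds hp] with q hq
    exact geoPair_eq hq.1 (snd_ne_zero hq)
  have hD := (hBC.comp p hA).congr_of_eventuallyEq hev
  have hl : ‖p.1‖ ^ 2 / (1 + ‖p.1‖ ^ 2) < ‖p.2‖ ^ 2 / (1 + ‖p.2‖ ^ 2) := by
    have := pow_lt_pow_left₀ hp.2.1 hu.le (n := 2) two_ne_zero
    rw [div_lt_div_iff₀ (by positivity) (by positivity)]
    linarith
  have hdA := det_chord_aux hx hy hu.ne' hv.ne' (sub_pos.2 hl).ne' (A : E3 × E3 →ₗ[ℝ] E3 × E3)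
    (l' := 2 * ‖p.1‖ / (1 + ‖p.1‖ ^ 2) ^ 2) (m' := 2 * ‖p.2‖ / (1 + ‖p.2‖ ^ 2) ^ 2) (fun a b => by
      rw [ContinuousLinearMap.coe_coe, hA', dirDeriv_apply, dirDeriv_apply])
  rw [hD.fderiv]
  have e : ((B.prodMap C ∘L A : E3 × E3 →L[ℝ] E3 × E3) : E3 × E3 →ₗ[ℝ] E3 × E3) =
      ((B : E3 →ₗ[ℝ] E3).prodMap (C : E3 →ₗ[ℝ] E3)) ∘ₗ (A : E3 × E3 →ₗ[ℝ] E3 × E3) := rfl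
  rw [e, LinearMap.det_comp, LinearMap.det_prodMap, hdA, mul_neg, neg_lt_zero]
  have h3 : 0 < (1 - inner ℝ (dir p.1) (dir p.2)) ^ 2 :=
    sq_pos_of_ne_zero (inner_ne_one hx hy hp.2.2)
  have h4 := pow_pos (sub_pos.2 hl) 2
  positivity

theorem rMap_geoPair {p : E3 × E3} (hp : p ∈ paramDomain) :
    rAmbient (geoPair p) = (dir p.1, dir p.2) := by
  have h2 := snd_ne_zero hp
  have h := rMap_geo (x := ⟨dir p.1, by simp [norm_dir hp.1]⟩)
    (y := ⟨dir p.2, by simp [norm_dir h2]⟩)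
    (fun h => hp.2.2 (congrArg Subtype.val h)) (norm_pos_iff.2 hp.1) hp.2.1
  rw [rAmbient, geoPair, h]

/-- `rMap` recovers the directions of the two vectors, and injectivity along a single geodesic
recovers their norms. -/
theorem injOn_geoPair : InjOn geoPair paramDomain := by
  intro p hp q hq h
  have hp2 := snd_ne_zero hp
  have hq2 := snd_ne_zero hq
  have h1 := rMap_geoPair hp
  rw [h, rMap_geoPair hq, Prod.mk.injEq] at h1
  rw [geoPair, geoPair, h1.1, h1.2, Prod.mk.injEq] at h
  have hinj := geo_injOn (norm_dir hp.1) (norm_dir hp2) hp.2.2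
  have e1 := hinj (norm_pos_iff.2 hp.1) (norm_pos_iff.2 hq.1) h.1
  have e2 := hinj (norm_pos_iff.2 hp2) (norm_pos_iff.2 hq2) h.2
  refine Prod.ext ?_ ?_
  · rw [← norm_smul_dir hp.1, e1, ← h1.1, norm_smul_dir hq.1]
  · rw [← norm_smul_dir hp2, e2, ← h1.2, norm_smul_dir hq2]

theorem exists_norm_add_smul_eq_one {k d : E3} (hk : ‖k‖ < 1) (hd : d ≠ 0) :
    ∃ t : ℝ, 0 < t ∧ ‖k + t • d‖ = 1 := by
  have hd' := norm_pos_iff.2 hd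
  have hc : Continuous fun t : ℝ => ‖k + t • d‖ := by fun_prop
  have h0 : (0 : ℝ) ≤ 2 / ‖d‖ := by positivity
  have h1 : 1 ≤ ‖k + (2 / ‖d‖) • d‖ := by
    have := norm_sub_le (k + (2 / ‖d‖) • d) k
    rw [add_sub_cancel_left, norm_smul, Real.norm_of_nonneg h0, div_mul_cancel₀ _ hd'.ne'] at this
    linarith
  obtain ⟨t, ht, hkt⟩ := intermediate_value_Icc h0 hc.continuousOn
    (show (1 : ℝ) ∈ Icc _ _ from ⟨by simpa using hk.le, h1⟩)
  refine ⟨t, lt_of_le_of_ne ht.1 ?_, hkt⟩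
  rintro rfl
  simp at hkt
  linarith

theorem exists_kleinToPoincare_eq {q : E3} (hq : ‖q‖ < 1) :
    ∃ k : E3, ‖k‖ < 1 ∧ kleinToPoincare k = q := by
  have h0 := norm_nonneg q
  have h2 : 1 - ‖(2 / (1 + ‖q‖ ^ 2)) • q‖ ^ 2 = ((1 - ‖q‖ ^ 2) / (1 + ‖q‖ ^ 2)) ^ 2 := by
    rw [norm_smul, Real.norm_of_nonneg (by positivity)]
    field_simp
    ring
  have h1 : 0 < 1 - ‖q‖ ^ 2 := by nlinarith
  refine ⟨(2 / (1 + ‖q‖ ^ 2)) • q, ?_, ?_⟩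
  · have : 0 < ((1 - ‖q‖ ^ 2) / (1 + ‖q‖ ^ 2)) ^ 2 := by positivity
    nlinarith [norm_nonneg ((2 / (1 + ‖q‖ ^ 2)) • q)]
  · rw [kleinToPoincare, h2, Real.sqrt_sq (by positivity), smul_smul]
    convert one_smul ℝ q
    field_simp
    ring

theorem image_geoPair : geoPair '' paramDomain = {q | ‖q.1‖ < 1 ∧ ‖q.2‖ < 1 ∧ q.1 ≠ q.2} := by
  apply Subset.antisymm
  · rintro _ ⟨p, hp, rfl⟩
    have hp2 := snd_ne_zero hp
    have hx := norm_dir hp.1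
    have hy := norm_dir hp2
    have hu := norm_pos_iff.2 hp.1
    have hv := norm_pos_iff.2 hp2
    exact ⟨norm_geo_lt_one hx hy hp.2.2 hu, norm_geo_lt_one hx hy hp.2.2 hv,
      fun h => hp.2.1.ne (geo_injOn hx hy hp.2.2 hu hv h)⟩
  · rintro ⟨q₁, q₂⟩ ⟨h1, h2, h12⟩
    obtain ⟨k₁, hk1, hkq1⟩ := exists_kleinToPoincare_eq h1
    obtain ⟨k₂, hk2, hkq2⟩ := exists_kleinToPoincare_eq h2
    simp only at hkq1 hkq2 h12
    have hd : k₂ - k₁ ≠ 0 := by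
      rw [sub_ne_zero]
      rintro rfl
      exact h12 (hkq1.symm.trans hkq2)
    -- In the Klein model the line through k₁ and k₂ leaves the ball at x behind k₁ and at y beyond
    -- k₂, at s and t times the vector k₂ − k₁.
    obtain ⟨s, hs, hks⟩ := exists_norm_add_smul_eq_one hk1 (neg_ne_zero.2 hd)
    obtain ⟨t, ht, hkt⟩ := exists_norm_add_smul_eq_one hk2 hd
    set x := k₁ + s • -(k₂ - k₁) with hx
    set y := k₂ + t • (k₂ - k₁) with hy
    have hxy : x ≠ y := by
      rw [Ne, ← sub_eq_zero, ← neg_eq_zero, show -(x - y) = (1 + s + t) • (k₂ - k₁) by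
        rw [hx, hy]; module]
      exact smul_ne_zero (by positivity) hd
    -- The point k₁ divides the chord in the ratio s : (1 + t) and k₂ in the ratio (1 + s) : t. The
    -- parameters u² and v² are these ratios, hence the square roots below.
    have hu : 0 < s / (1 + t) := by positivity
    have hv : 0 < (1 + s) / t := by positivity
    have huv : s / (1 + t) < (1 + s) / t := by
      rw [div_lt_div_iff₀ (by positivity) ht]
      nlinarith
    have d1 : dir (√(s / (1 + t)) • x) = x := dir_smul hks (Real.sqrt_pos.2 hu)
    have d2 : dir (√((1 + s) / t) • y) = y := dir_smul hkt (Real.sqrt_pos.2 hv)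
    have n1 : ‖√(s / (1 + t)) • x‖ = √(s / (1 + t)) := by
      rw [norm_smul, hks, mul_one, Real.norm_of_nonneg (Real.sqrt_nonneg _)]
    have n2 : ‖√((1 + s) / t) • y‖ = √((1 + s) / t) := by
      rw [norm_smul, hkt, mul_one, Real.norm_of_nonneg (Real.sqrt_nonneg _)]
    have hmem : (√(s / (1 + t)) • x, √((1 + s) / t) • y) ∈ paramDomain := by
      refine ⟨?_, ?_, ?_⟩
      · rw [← norm_pos_iff, n1]; exact Real.sqrt_pos.2 hu
      · simp only [n1, n2]; exact Real.sqrt_lt_sqrt hu.le huv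
      · simp only [d1, d2]; exact hxy
    refine ⟨_, hmem, ?_⟩
    rw [geoPair_eq hmem.1 (snd_ne_zero hmem), chordPair]
    simp only [d1, d2, n1, n2, Prod.map_apply, chord, Real.sq_sqrt hu.le, Real.sq_sqrt hv.le]
    rw [← hkq1, ← hkq2]
    have e1 : s / (1 + t) / (1 + s / (1 + t)) = s / (1 + s + t) := by field_simp; ring
    have e2 : (1 + s) / t / (1 + (1 + s) / t) = (1 + s) / (1 + s + t) := by field_simp; ring
    have e3 : s / (1 + s + t) * (1 + s + t) = s := by field_simp
    have e4 : (1 + s) / (1 + s + t) * (1 + s + t) = 1 + s := by field_simp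
    rw [e1, e2]
    congr 2
    · rw [hx, hy]
      linear_combination (norm := module) e3 • (k₂ - k₁)
    · rw [hx, hy]
      linear_combination (norm := module) e4 • (k₂ - k₁)

end Parametrization

/-! ### The integrand in the coordinates given by `geoPair`. -/

section Pullback

/-- The frame `frame12` as a basis. -/
def basis12 : Module.Basis (Fin 6) ℝ (E3 × E3) :=
  ((EuclideanSpace.basisFun (Fin 3) ℝ).toBasis.prod
    (EuclideanSpace.basisFun (Fin 3) ℝ).toBasis).reindex finSumFinEquiv

theorem basis12_eq : (basis12 : Fin 6 → E3 × E3) = frame12 := by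
  funext i
  rw [basis12, Module.Basis.reindex_apply]
  fin_cases i
  · change _ = (stdBasis 0, 0)
    rw [show finSumFinEquiv.symm (⟨0, by norm_num⟩ : Fin (3 + 3)) = Sum.inl 0 from rfl]
    simp [stdBasis]
  · change _ = (stdBasis 1, 0)
    rw [show finSumFinEquiv.symm (⟨1, by norm_num⟩ : Fin (3 + 3)) = Sum.inl 1 from rfl]
    simp [stdBasis]
  · change _ = (stdBasis 2, 0)
    rw [show finSumFinEquiv.symm (⟨2, by norm_num⟩ : Fin (3 + 3)) = Sum.inl 2 from rfl]
    simp [stdBasis]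
  · change _ = ((0 : E3), stdBasis 0)
    rw [show finSumFinEquiv.symm (⟨3, by norm_num⟩ : Fin (3 + 3)) = Sum.inr 0 from rfl]
    simp [stdBasis]
  · change _ = ((0 : E3), stdBasis 1)
    rw [show finSumFinEquiv.symm (⟨4, by norm_num⟩ : Fin (3 + 3)) = Sum.inr 1 from rfl]
    simp [stdBasis]
  · change _ = ((0 : E3), stdBasis 2)
    rw [show finSumFinEquiv.symm (⟨5, by norm_num⟩ : Fin (3 + 3)) = Sum.inr 2 from rfl]
    simp [stdBasis]

theorem evalForm_frame21 (η : Forms (E3 × E3)) : evalForm frame21 η = -evalForm frame12 η := by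
  let σ : Equiv.Perm (Fin 6) := ⟨![3, 4, 5, 0, 1, 2], ![3, 4, 5, 0, 1, 2],
    by intro i; fin_cases i <;> rfl, by intro i; fin_cases i <;> rfl⟩
  have h : frame21 = frame12 ∘ σ := by
    funext i; fin_cases i <;> rfl
  have hs : Equiv.Perm.sign σ = -1 := by decide
  rw [h, evalForm_comp_perm, hs]
  simp

/-- The rows alternate between the two factors, as dz₁, dz₂ do in ω. Sorting them into a block
diagonal matrix takes an odd permutation. -/
theorem det_frame12 (f g : Fin 3 → E3 →L[ℝ] ℂ) :
    Matrix.det (Matrix.of fun i j => ((![f 0 ∘L .fst ℝ E3 E3, g 0 ∘L .snd ℝ E3 E3,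
      f 1 ∘L .fst ℝ E3 E3, g 1 ∘L .snd ℝ E3 E3, f 2 ∘L .fst ℝ E3 E3, g 2 ∘L .snd ℝ E3 E3] :
        Fin 6 → E3 × E3 →L[ℝ] ℂ) i) (frame12 j)) =
    -(Matrix.det (Matrix.of fun i j => f i (stdBasis j)) *
      Matrix.det (Matrix.of fun i j => g i (stdBasis j))) := by
  let σ : Equiv.Perm (Fin 6) := ⟨![0, 3, 1, 4, 2, 5], ![0, 2, 4, 1, 3, 5],
    by intro i; fin_cases i <;> rfl, by intro i; fin_cases i <;> rfl⟩
  have hs : Equiv.Perm.sign σ = -1 := by decide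
  let e : Fin 6 ≃ Fin 3 ⊕ Fin 3 := (finSumFinEquiv (m := 3) (n := 3)).symm
  let F := Matrix.of fun i j => f i (stdBasis j)
  let G := Matrix.of fun i j => g i (stdBasis j)
  have h : (Matrix.of fun i j => ((![f 0 ∘L .fst ℝ E3 E3, g 0 ∘L .snd ℝ E3 E3,
      f 1 ∘L .fst ℝ E3 E3, g 1 ∘L .snd ℝ E3 E3, f 2 ∘L .fst ℝ E3 E3, g 2 ∘L .snd ℝ E3 E3] :
        Fin 6 → E3 × E3 →L[ℝ] ℂ) i) (frame12 j)) =
      ((Matrix.fromBlocks F 0 0 G).submatrix e e).submatrix σ id := by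
    have e0 : e 0 = Sum.inl 0 := rfl
    have e1 : e 1 = Sum.inl 1 := rfl
    have e2 : e 2 = Sum.inl 2 := rfl
    have e3 : e 3 = Sum.inr 0 := rfl
    have e4 : e 4 = Sum.inr 1 := rfl
    have e5 : e 5 = Sum.inr 2 := rfl
    ext i j
    rw [Matrix.submatrix_apply, Matrix.submatrix_apply]
    fin_cases i <;> fin_cases j <;>
      simp [σ, e0, e1, e2, e3, e4, e5, frame12, F, G]
  rw [h, Matrix.det_permute, hs, Matrix.det_submatrix_equiv_self, Matrix.det_fromBlocks_zero₂₁]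
  simp [F, G]

/-- The derivative of the stereographic coordinate. -/
def stereoDeriv (x : E3) : E3 →L[ℝ] ℂ :=
  (((1 + x 2 : ℝ) : ℂ) ^ 2)⁻¹ •
    (((1 + x 2 : ℝ) : ℂ) • (Complex.ofRealCLM ∘L EuclideanSpace.proj 0 +
      Complex.I • (Complex.ofRealCLM ∘L EuclideanSpace.proj 1)) -
    ((x 0 : ℂ) + Complex.I * x 1) • (Complex.ofRealCLM ∘L EuclideanSpace.proj 2))

theorem stereoDeriv_apply (x v : E3) : stereoDeriv x v =
    (((1 + x 2 : ℝ) : ℂ) ^ 2)⁻¹ * ((1 + x 2 : ℝ) * (v 0 + Complex.I * v 1) -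
      (x 0 + Complex.I * x 1) * v 2) := by
  simp only [stereoDeriv, smul_apply, sub_apply, add_apply, ContinuousLinearMap.comp_apply,
    Complex.ofRealCLM_apply, smul_eq_mul]
  rfl

theorem hasFDerivAt_stereoCoord {x : E3} (hx : 1 + x 2 ≠ 0) :
    HasFDerivAt stereoCoord (stereoDeriv x) x := by
  have hp : ∀ i : Fin 3, HasFDerivAt (fun x : E3 => ((x i : ℝ) : ℂ))
      (Complex.ofRealCLM ∘L EuclideanSpace.proj i) x := fun i =>
    (Complex.ofRealCLM ∘L (EuclideanSpace.proj i : E3 →L[ℝ] ℝ)).hasFDerivAt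
  have hx' : (1 + (x 2 : ℂ)) ≠ 0 := by
    rw [← Complex.ofReal_one, ← Complex.ofReal_add]; exact Complex.ofReal_ne_zero.2 hx
  have h := ((hp 0).add ((hp 1).const_mul Complex.I)).mul
    ((hasDerivAt_inv hx').hasFDerivAt.restrictScalars ℝ |>.comp x ((hp 2).const_add 1))
  refine (h.congr_fderiv ?_).congr_of_eventuallyEq (Eventually.of_forall fun y => ?_)
  · ext v
    rw [stereoDeriv_apply]
    simp
    field_simp
    ring
  · simp [stereoCoord, div_eq_mul_inv]

theorem norm_sq_eq_sum (x : E3) : ‖x‖ ^ 2 = x 0 ^ 2 + x 1 ^ 2 + x 2 ^ 2 := by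
  rw [EuclideanSpace.norm_sq_eq, Fin.sum_univ_three]
  simp

theorem inner_eq_sum (x y : E3) : inner ℝ x y = x 0 * y 0 + x 1 * y 1 + x 2 * y 2 := by
  rw [PiLp.inner_apply, Fin.sum_univ_three]
  simp [mul_comm]

/-- The area form of `S²` in the stereographic coordinate. -/
theorem det_stereoDeriv {p : E3} (hp : p ≠ 0) (hx : 1 + dir p 2 ≠ 0) :
    Matrix.det (Matrix.of fun i j => (![stereoDeriv (dir p) ∘L dirDeriv p,
      (Complex.conjCLE : ℂ →L[ℝ] ℂ) ∘L stereoDeriv (dir p) ∘L dirDeriv p,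
      normalCovector (dir p)] : Fin 3 → E3 →L[ℝ] ℂ) i (stdBasis j)) =
    -2 * Complex.I / ((1 + dir p 2 : ℝ) ^ 2 * (‖p‖ : ℂ) ^ 2) := by
  have hn := norm_dir hp
  have hu : (‖p‖ : ℂ) ≠ 0 := by simpa using hp
  have h1 : (dir p 0) ^ 2 + (dir p 1) ^ 2 + (dir p 2) ^ 2 = 1 := by
    rw [← norm_sq_eq_sum, hn]; norm_num
  have hD : ((1 + dir p 2 : ℝ) : ℂ) ≠ 0 := Complex.ofReal_ne_zero.2 hx
  have h1' : (dir p 0 : ℂ) ^ 2 + (dir p 1 : ℂ) ^ 2 + (dir p 2 : ℂ) ^ 2 = 1 := by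
    simpa using congrArg (fun r : ℝ => (r : ℂ)) h1
  rw [Matrix.det_fin_three]
  simp only [Matrix.of_apply, Matrix.cons_val, ContinuousLinearMap.comp_apply, dirDeriv_apply,
    map_smul, map_sub, stereoDeriv_apply, normalCovector, innerSL_apply_apply,
    Complex.ofRealCLM_apply, ContinuousLinearEquiv.coe_coe, Complex.conjCLE_apply, map_mul,
    map_add, map_inv₀, map_pow, Complex.conj_ofReal, Complex.conj_I, inner_eq_sum, stdBasis]
  simp
  have hD' : (1 + (dir p 2 : ℂ)) ≠ 0 := by simpa using hD
  generalize (dir p 0 : ℂ) = a at *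
  generalize (dir p 1 : ℂ) = b at *
  generalize (dir p 2 : ℂ) = c at *
  generalize (‖p‖ : ℂ) = u at *
  field_simp
  linear_combination (-2 * Complex.I * (1 + c)) * h1'

/-- Chordal distance in the stereographic coordinate. The factors 1 + x₃ and 1 + y₃ cancel against
those of `det_stereoDeriv`, leaving the rotation-invariant kernel |x − y|⁻⁴. -/
theorem stereoCoord_sub_mul_conj {x y : E3} (hx : ‖x‖ = 1) (hy : ‖y‖ = 1) (hx' : 1 + x 2 ≠ 0)
    (hy' : 1 + y 2 ≠ 0) :
    (stereoCoord x - stereoCoord y) * (conj (stereoCoord x) - conj (stereoCoord y)) =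
      (‖x - y‖ : ℂ) ^ 2 / ((1 + x 2 : ℝ) * (1 + y 2 : ℝ)) := by
  have h1 : (x 0) ^ 2 + (x 1) ^ 2 + (x 2) ^ 2 = 1 := by rw [← norm_sq_eq_sum, hx]; norm_num
  have h2 : (y 0) ^ 2 + (y 1) ^ 2 + (y 2) ^ 2 = 1 := by rw [← norm_sq_eq_sum, hy]; norm_num
  have hxC : ((1 + x 2 : ℝ) : ℂ) ≠ 0 := Complex.ofReal_ne_zero.2 hx'
  have hyC : ((1 + y 2 : ℝ) : ℂ) ≠ 0 := Complex.ofReal_ne_zero.2 hy'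
  rw [← map_sub, Complex.mul_conj, ← Complex.ofReal_pow, norm_sq_eq_sum, ← Complex.ofReal_mul,
    ← Complex.ofReal_div]
  congr 1
  have e : stereoCoord x - stereoCoord y = ((x 0 / (1 + x 2) - y 0 / (1 + y 2) : ℝ) : ℂ) +
      ((x 1 / (1 + x 2) - y 1 / (1 + y 2) : ℝ) : ℂ) * Complex.I := by
    push_cast
    rw [stereoCoord, stereoCoord]
    ring
  rw [e, Complex.normSq_add_mul_I]
  simp only [PiLp.sub_apply]
  field_simp
  linear_combination (1 + y 2) ^ 2 * h1 + (1 + x 2) ^ 2 * h2 -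
    (1 + x 2) * (1 + y 2) * (h1 + h2)

/-- The derivative of `geo`. -/
def geoDeriv (x y : E3) (u : ℝ) : E3 :=
  ((1 + ‖x - y‖ * u + u ^ 2) ^ 2)⁻¹ • ((2 * u) • (y - x) + ‖x - y‖ • (u ^ 2 • y - x))

theorem hasDerivAt_geo (x y : E3) {u : ℝ} (hu : 0 ≤ u) :
    HasDerivAt (geo x y) (geoDeriv x y u) u := by
  have hD := geo_den_pos x y hu
  have h1 : HasDerivAt (fun u : ℝ => 1 + ‖x - y‖ * u + u ^ 2) (‖x - y‖ + 2 * u) u := by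
    have := (((hasDerivAt_id u).const_mul ‖x - y‖).const_add 1).add ((hasDerivAt_id u).pow 2)
    refine this.congr_deriv ?_
    simp
  have h2 : HasDerivAt (fun u : ℝ => x + u ^ 2 • y) ((2 * u) • y) u := by
    have := (((hasDerivAt_id u).pow 2).smul_const y).const_add x
    refine this.congr_deriv ?_
    simp
  have h := (h1.inv hD.ne').smul h2
  refine h.congr_deriv ?_
  rw [geoDeriv]
  simp only [Pi.inv_apply]
  generalize ‖x - y‖ = c at *
  match_scalars <;> field_simp <;> ring

/-- Moving the first vector radially fixes both endpoints and slides only the first point along the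
geodesic. The zero in the second component is what separates α from β. -/
theorem fderiv_geoPair_fst {p : E3 × E3} (hp : p ∈ paramDomain) :
    fderiv ℝ geoPair p (dir p.1, 0) = (geoDeriv (dir p.1) (dir p.2) ‖p.1‖, 0) := by
  have h := (contDiffAt_geoPair hp).differentiableAt (by simp)
  have hu := norm_pos_iff.2 hp.1
  have hline : HasDerivAt (fun t : ℝ => p + t • ((dir p.1, 0) : E3 × E3)) (dir p.1, 0) 0 := by
    simpa using ((hasDerivAt_id (0 : ℝ)).smul_const ((dir p.1, 0) : E3 × E3)).const_add p
  have h1 := HasFDerivAt.comp_hasDerivAt (f := fun t : ℝ => p + t • ((dir p.1, 0) : E3 × E3)) 0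
    (by simpa using h.hasFDerivAt) hline
  have h2 : HasDerivAt (fun t : ℝ => (geo (dir p.1) (dir p.2) (‖p.1‖ + t),
      geo (dir p.1) (dir p.2) ‖p.2‖)) (geoDeriv (dir p.1) (dir p.2) ‖p.1‖, 0) 0 := by
    refine HasDerivAt.prodMk ?_ (hasDerivAt_const _ _)
    exact HasDerivAt.comp_const_add ‖p.1‖ 0 (by simpa using hasDerivAt_geo _ _ hu.le)
  refine h1.unique (h2.congr_of_eventuallyEq ?_)
  filter_upwards [eventually_gt_nhds (show -‖p.1‖ < 0 by linarith)] with t ht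
  have e : p.1 + t • dir p.1 = (‖p.1‖ + t) • dir p.1 := by
    rw [add_smul, norm_smul_dir hp.1]
  have hpos : 0 < ‖p.1‖ + t := by linarith
  simp only [Function.comp_apply, geoPair, Prod.fst_add, Prod.smul_mk, smul_zero, Prod.snd_add,
    add_zero, e, dir_smul (norm_dir hp.1) hpos]
  rw [norm_smul, norm_dir hp.1, mul_one, Real.norm_of_nonneg hpos.le]

theorem fderiv_geoPair_snd {p : E3 × E3} (hp : p ∈ paramDomain) :
    fderiv ℝ geoPair p (0, dir p.2) = (0, geoDeriv (dir p.1) (dir p.2) ‖p.2‖) := by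
  have h := (contDiffAt_geoPair hp).differentiableAt (by simp)
  have hp2 := snd_ne_zero hp
  have hu := norm_pos_iff.2 hp2
  have hline : HasDerivAt (fun t : ℝ => p + t • ((0, dir p.2) : E3 × E3)) (0, dir p.2) 0 := by
    simpa using ((hasDerivAt_id (0 : ℝ)).smul_const ((0, dir p.2) : E3 × E3)).const_add p
  have h1 := HasFDerivAt.comp_hasDerivAt (f := fun t : ℝ => p + t • ((0, dir p.2) : E3 × E3)) 0
    (by simpa using h.hasFDerivAt) hline
  have h2 : HasDerivAt (fun t : ℝ => (geo (dir p.1) (dir p.2) ‖p.1‖,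
      geo (dir p.1) (dir p.2) (‖p.2‖ + t))) (0, geoDeriv (dir p.1) (dir p.2) ‖p.2‖) 0 := by
    refine HasDerivAt.prodMk (hasDerivAt_const _ _) ?_
    exact HasDerivAt.comp_const_add ‖p.2‖ 0 (by simpa using hasDerivAt_geo _ _ hu.le)
  refine h1.unique (h2.congr_of_eventuallyEq ?_)
  filter_upwards [eventually_gt_nhds (show -‖p.2‖ < 0 by linarith)] with t ht
  have e : p.2 + t • dir p.2 = (‖p.2‖ + t) • dir p.2 := by
    rw [add_smul, norm_smul_dir hp2]
  have hpos : 0 < ‖p.2‖ + t := by linarith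
  simp only [Function.comp_apply, geoPair, Prod.fst_add, Prod.smul_mk, smul_zero, Prod.snd_add,
    add_zero, e, dir_smul (norm_dir hp2) hpos]
  rw [norm_smul, norm_dir hp2, mul_one, Real.norm_of_nonneg hpos.le]

/-- `rMap` is defined by a choice, so its differentiability comes from the inverse function theorem:
near an image point it is the pair of directions after a local inverse of `geoPair`. The chain rule
then identifies the derivative. -/
theorem fderiv_rAmbient_comp {p : E3 × E3} (hp : p ∈ paramDomain) :
    fderiv ℝ rAmbient (geoPair p) ∘L fderiv ℝ geoPair p =
      (dirDeriv p.1).prodMap (dirDeriv p.2) := by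
  have hdirs : HasFDerivAt (Prod.map dir dir) ((dirDeriv p.1).prodMap (dirDeriv p.2)) p :=
    HasFDerivAt.prodMap p (hasFDerivAt_dir hp.1) (hasFDerivAt_dir (snd_ne_zero hp))
  have hc := contDiffAt_geoPair hp
  let A : (E3 × E3) ≃L[ℝ] E3 × E3 := (fderiv ℝ geoPair p).toContinuousLinearEquivOfDetNeZero
    (det_fderiv_geoPair_neg hp).ne
  have hs : HasStrictFDerivAt geoPair (A : E3 × E3 →L[ℝ] E3 × E3) p :=
    hc.hasStrictFDerivAt (by simp)
  have hinv := hs.to_localInverse.hasFDerivAt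
  have himg : hs.localInverse geoPair A p (geoPair p) = p := hs.localInverse_apply_image
  have hev : rAmbient =ᶠ[𝓝 (geoPair p)] Prod.map dir dir ∘ hs.localInverse geoPair A p := by
    have hmem : ∀ᶠ q in 𝓝 (geoPair p), hs.localInverse geoPair A p q ∈ paramDomain := by
      refine hinv.continuousAt.eventually_mem ?_
      rw [himg]
      exact isOpen_paramDomain.mem_nhds hp
    filter_upwards [hmem, hs.eventually_right_inverse] with q hq hq'
    conv_lhs => rw [← hq']
    rw [rMap_geoPair hq]
    rfl
  have hdiff : DifferentiableAt ℝ rAmbient (geoPair p) := by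
    refine DifferentiableAt.congr_of_eventuallyEq ?_ hev
    refine DifferentiableAt.comp _ ?_ hinv.differentiableAt
    rw [himg]
    exact hdirs.differentiableAt
  have h1 := hdiff.hasFDerivAt.comp p (hc.differentiableAt (by simp)).hasFDerivAt
  refine (h1.congr_of_eventuallyEq ?_).unique hdirs
  filter_upwards [isOpen_paramDomain.mem_nhds hp] with q hq
  exact (rMap_geoPair hq).symm

theorem map_covectorPullback_map {U V W : Type*} [NormedAddCommGroup U] [NormedSpace ℝ U]
    [NormedAddCommGroup V] [NormedSpace ℝ V] [NormedAddCommGroup W] [NormedSpace ℝ W]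
    (A : U →L[ℝ] V) (B : V →L[ℝ] W) (η : Forms W) :
    ExteriorAlgebra.map (covectorPullback A) (ExteriorAlgebra.map (covectorPullback B) η) =
      ExteriorAlgebra.map (covectorPullback (B ∘L A)) η :=
  congrArg (fun f : Forms W →ₐ[ℂ] Forms U => f η)
    (ExteriorAlgebra.map_comp_map (covectorPullback B) (covectorPullback A))

theorem map_covectorPullback_oneForm {V W : Type*}
    [NormedAddCommGroup V] [NormedSpace ℝ V] [NormedAddCommGroup W] [NormedSpace ℝ W]
    (A : V →L[ℝ] W) (φ : W →L[ℝ] ℂ) :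
    ExteriorAlgebra.map (covectorPullback A) (oneForm φ) = oneForm (φ ∘L A) :=
  ExteriorAlgebra.map_apply_ι _ _

theorem fderiv_stereoCoord_fst {x : E3} (y : E3) (hx : 1 + x 2 ≠ 0) :
    fderiv ℝ (fun p : E3 × E3 => stereoCoord p.1) (x, y) = stereoDeriv x ∘L .fst ℝ E3 E3 :=
  (HasFDerivAt.comp (g := stereoCoord) (f := Prod.fst) (x, y)
    (hasFDerivAt_stereoCoord hx) hasFDerivAt_fst).fderiv

theorem fderiv_stereoCoord_snd {y : E3} (x : E3) (hy : 1 + y 2 ≠ 0) :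
    fderiv ℝ (fun p : E3 × E3 => stereoCoord p.2) (x, y) = stereoDeriv y ∘L .snd ℝ E3 E3 :=
  (HasFDerivAt.comp (g := stereoCoord) (f := Prod.snd) (x, y)
    (hasFDerivAt_stereoCoord hy) hasFDerivAt_snd).fderiv

theorem fderiv_conj_stereoCoord_fst {x : E3} (y : E3) (hx : 1 + x 2 ≠ 0) :
    fderiv ℝ (fun p : E3 × E3 => conj (stereoCoord p.1)) (x, y) =
      (Complex.conjCLE : ℂ →L[ℝ] ℂ) ∘L stereoDeriv x ∘L .fst ℝ E3 E3 :=
  ((Complex.conjCLE : ℂ →L[ℝ] ℂ).hasFDerivAt.comp (x, y)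
    (HasFDerivAt.comp (g := stereoCoord) (f := Prod.fst) (x, y)
    (hasFDerivAt_stereoCoord hx) hasFDerivAt_fst)).fderiv

theorem fderiv_conj_stereoCoord_snd {y : E3} (x : E3) (hy : 1 + y 2 ≠ 0) :
    fderiv ℝ (fun p : E3 × E3 => conj (stereoCoord p.2)) (x, y) =
      (Complex.conjCLE : ℂ →L[ℝ] ℂ) ∘L stereoDeriv y ∘L .snd ℝ E3 E3 :=
  ((Complex.conjCLE : ℂ →L[ℝ] ℂ).hasFDerivAt.comp (x, y)
    (HasFDerivAt.comp (g := stereoCoord) (f := Prod.snd) (x, y)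
    (hasFDerivAt_stereoCoord hy) hasFDerivAt_snd)).fderiv

/-- The form `P₀ P̄₀ p₁^*α p₂^*β` in the parametrization `geoPair`. -/
theorem det_mul_evalForm_geoPair {p : E3 × E3} (hp : p ∈ paramDomain) (hx : 1 + dir p.1 2 ≠ 0)
    (hy : 1 + dir p.2 2 ≠ 0) (α β : E3 → Forms E3) :
    ((LinearMap.det (fderiv ℝ geoPair p : E3 × E3 →ₗ[ℝ] E3 × E3) : ℝ) : ℂ) *
      evalForm frame12 (P0 (geoPair p) * P0Bar (geoPair p) * formPullback Prod.fst α (geoPair p) *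
        formPullback Prod.snd β (geoPair p)) =
    (Real.pi ^ 2 : ℂ)⁻¹ * ((‖dir p.1 - dir p.2‖ : ℂ) ^ 4)⁻¹ *
      ((‖p.1‖ : ℂ) ^ 2 * (‖p.2‖ : ℂ) ^ 2)⁻¹ *
      (degreeOnePart (α (geoPair p).1) (geoDeriv (dir p.1) (dir p.2) ‖p.1‖) *
        degreeOnePart (β (geoPair p).2) (geoDeriv (dir p.1) (dir p.2) ‖p.2‖)) := by
  have hp2 := snd_ne_zero hp
  have hnx := norm_dir hp.1
  have hny := norm_dir hp2
  have hxx : inner ℝ (dir p.1) (dir p.1) = 1 := by rw [real_inner_self_eq_norm_sq, hnx]; norm_num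
  have hyy : inner ℝ (dir p.2) (dir p.2) = 1 := by rw [real_inner_self_eq_norm_sq, hny]; norm_num
  set A := fderiv ℝ geoPair p with hA
  set ψ₁ := stereoDeriv (dir p.1) ∘L dirDeriv p.1 with hψ₁
  set ψ₂ := stereoDeriv (dir p.2) ∘L dirDeriv p.2 with hψ₂
  have hd1 : dirDeriv p.1 (dir p.1) = 0 := by rw [dirDeriv_apply, hxx]; simp
  have hd2 : dirDeriv p.2 (dir p.2) = 0 := by rw [dirDeriv_apply, hyy]; simp
  let f : Fin 3 → E3 →L[ℝ] ℂ :=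
    ![ψ₁, (Complex.conjCLE : ℂ →L[ℝ] ℂ) ∘L ψ₁, normalCovector (dir p.1)]
  let g : Fin 3 → E3 →L[ℝ] ℂ :=
    ![ψ₂, (Complex.conjCLE : ℂ →L[ℝ] ℂ) ∘L ψ₂, normalCovector (dir p.2)]
  have hω : ExteriorAlgebra.map (covectorPullback A) (P0 (geoPair p)) =
      ((2 * Real.pi * Complex.I : ℂ)⁻¹ *
        ((stereoCoord (dir p.1) - stereoCoord (dir p.2)) ^ 2)⁻¹) •
        (oneForm (f 0 ∘L .fst ℝ E3 E3) * oneForm (g 0 ∘L .snd ℝ E3 E3)) := by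
    rw [P0, map_smul, formPullback, map_covectorPullback_map, hA, fderiv_rAmbient_comp hp,
      rMap_geoPair hp, omegaForm, map_smul, map_mul, dForm, dForm, fderiv_stereoCoord_fst _ hx,
      fderiv_stereoCoord_snd _ hy, map_covectorPullback_oneForm, map_covectorPullback_oneForm,
      smul_smul]
    rfl
  have hω' : ExteriorAlgebra.map (covectorPullback A) (P0Bar (geoPair p)) =
      ((conj (2 * Real.pi * Complex.I : ℂ))⁻¹ *
        ((conj (stereoCoord (dir p.1)) - conj (stereoCoord (dir p.2))) ^ 2)⁻¹) •
        (oneForm (f 1 ∘L .fst ℝ E3 E3) * oneForm (g 1 ∘L .snd ℝ E3 E3)) := by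
    rw [P0Bar, map_smul, formPullback, map_covectorPullback_map, hA, fderiv_rAmbient_comp hp,
      rMap_geoPair hp, omegaBarForm, map_smul, map_mul (ExteriorAlgebra.map _), dForm, dForm,
      fderiv_conj_stereoCoord_fst _ hx, fderiv_conj_stereoCoord_snd _ hy,
      map_covectorPullback_oneForm, map_covectorPullback_oneForm, smul_smul]
    rfl
  have hα : ExteriorAlgebra.map (covectorPullback A) (formPullback Prod.fst α (geoPair p)) =
      ExteriorAlgebra.map (covectorPullback (.fst ℝ E3 E3 ∘L A)) (α (geoPair p).1) := by
    rw [formPullback, map_covectorPullback_map, fderiv_fst]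
  have hβ : ExteriorAlgebra.map (covectorPullback A) (formPullback Prod.snd β (geoPair p)) =
      ExteriorAlgebra.map (covectorPullback (.snd ℝ E3 E3 ∘L A)) (β (geoPair p).2) := by
    rw [formPullback, map_covectorPullback_map, fderiv_snd]
  have hw1 := fderiv_geoPair_fst hp
  have hw2 := fderiv_geoPair_snd hp
  -- The vectors w₁ and w₂ are the two radial directions. The four covectors from P₀P̄₀ vanish on
  -- them because they factor through the direction maps.
  have key := evalForm_mul_map_mul_map (V := E3 × E3) (by simp)
    (w₁ := (dir p.1, 0)) (w₂ := (0, dir p.2))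
    (ν₁ := f 2 ∘L .fst ℝ E3 E3) (ν₂ := g 2 ∘L .snd ℝ E3 E3)
    (by simp [f, normalCovector, hnx]) (by simp [f])
    (by simp [g]) (by simp [g, normalCovector, hny])
    (φ := ![f 0 ∘L .fst ℝ E3 E3, g 0 ∘L .snd ℝ E3 E3, f 1 ∘L .fst ℝ E3 E3, g 1 ∘L .snd ℝ E3 E3])
    (by intro i; fin_cases i <;> simp [f, g, hψ₁, hd1])
    (by intro i; fin_cases i <;> simp [f, g, hψ₂, hd2])
    (.fst ℝ E3 E3 ∘L A) (.snd ℝ E3 E3 ∘L A) (by simp [hA, hw2]) (by simp [hA, hw1])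
    (α (geoPair p).1) (β (geoPair p).2) frame12
  rw [← basis12_eq, ← evalForm_comp_basis, ← evalForm_map,
    map_mul (ExteriorAlgebra.map _), map_mul (ExteriorAlgebra.map _),
    map_mul (ExteriorAlgebra.map _), hω, hω', hα,
    hβ, smul_mul_smul_comm, smul_mul_assoc, smul_mul_assoc, map_smul, smul_eq_mul, basis12_eq]
  have e1 : (.fst ℝ E3 E3 ∘L A) (dir p.1, 0) = geoDeriv (dir p.1) (dir p.2) ‖p.1‖ := by
    rw [ContinuousLinearMap.comp_apply, hA, hw1]; rfl
  have e2 : (.snd ℝ E3 E3 ∘L A) (0, dir p.2) = geoDeriv (dir p.1) (dir p.2) ‖p.2‖ := by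
    rw [ContinuousLinearMap.comp_apply, hA, hw2]; rfl
  rw [e1, e2] at key
  have hdet := det_frame12 f g
  simp only [Matrix.cons_val] at key
  rw [key, hdet, det_stereoDeriv hp.1 hx, det_stereoDeriv hp2 hy]
  have hz := stereoCoord_sub_mul_conj hnx hny hx hy
  have hπ : (Real.pi : ℂ) ≠ 0 := Complex.ofReal_ne_zero.2 Real.pi_ne_zero
  have hX : ((1 + dir p.1 2 : ℝ) : ℂ) ≠ 0 := Complex.ofReal_ne_zero.2 hx
  have hY : ((1 + dir p.2 2 : ℝ) : ℂ) ≠ 0 := Complex.ofReal_ne_zero.2 hy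
  have hu : (‖p.1‖ : ℂ) ≠ 0 := by simpa using hp.1
  have hv : (‖p.2‖ : ℂ) ≠ 0 := by simpa using hp2
  have hc : (‖dir p.1 - dir p.2‖ : ℂ) ≠ 0 := by
    simpa [sub_eq_zero] using hp.2.2
  have e3 : (2 * Real.pi * Complex.I : ℂ)⁻¹ *
        ((stereoCoord (dir p.1) - stereoCoord (dir p.2)) ^ 2)⁻¹ *
        ((conj (2 * Real.pi * Complex.I : ℂ))⁻¹ *
        ((conj (stereoCoord (dir p.1)) - conj (stereoCoord (dir p.2))) ^ 2)⁻¹) =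
      (4 * (Real.pi : ℂ) ^ 2)⁻¹ * (((stereoCoord (dir p.1) - stereoCoord (dir p.2)) *
      (conj (stereoCoord (dir p.1)) - conj (stereoCoord (dir p.2)))) ^ 2)⁻¹ := by
    have : (2 * Real.pi * Complex.I : ℂ) * conj (2 * Real.pi * Complex.I : ℂ) =
        4 * (Real.pi : ℂ) ^ 2 := by
      simp only [map_mul, Complex.conj_I, Complex.conj_ofReal, map_ofNat]
      linear_combination (-4 * (Real.pi : ℂ) ^ 2) * Complex.I_sq
    rw [← this]
    simp only [mul_inv, mul_pow]
    ring
  rw [e3, hz]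
  generalize ((1 + dir p.1 2 : ℝ) : ℂ) = X at *
  generalize ((1 + dir p.2 2 : ℝ) : ℂ) = Y at *
  generalize (‖dir p.1 - dir p.2‖ : ℂ) = c at *
  generalize (‖p.1‖ : ℂ) = u at *
  generalize (‖p.2‖ : ℂ) = v at *
  field_simp
  rw [Complex.I_sq]
  ring

end Pullback

/-! ### Polar coordinates on both factors, and the change of variables on `Conf2`. -/

section Polar

/-- The area measure of `S²`. -/
abbrev sphereMeasure : Measure S2 := (volume : Measure E3).toSphere

/-- The radial part of Lebesgue measure in polar coordinates. -/
def radialMeasure : Measure ℝ :=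
  (volume.restrict (Ioi 0)).withDensity fun r => ENNReal.ofReal (r ^ 2)

instance : SFinite radialMeasure := by unfold radialMeasure; infer_instance

theorem map_volumeIoiPow :
    (Measure.volumeIoiPow 2).map (Subtype.val : Ioi (0 : ℝ) → ℝ) = radialMeasure := by
  have hm : Measurable fun r : ℝ => ENNReal.ofReal (r ^ 2) := by fun_prop
  ext s hs
  rw [Measure.map_apply measurable_subtype_coe hs, Measure.volumeIoiPow, radialMeasure,
    withDensity_apply _ (measurable_subtype_coe hs), withDensity_apply _ hs,
    Measure.restrict_restrict hs]
  rw [← lintegral_indicator (measurable_subtype_coe hs), ← lintegral_indicator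
    (hs.inter measurableSet_Ioi)]
  have : ∀ r : Ioi (0 : ℝ), (Subtype.val ⁻¹' s).indicator
      (fun r : Ioi (0 : ℝ) => ENNReal.ofReal (r.1 ^ 2)) r =
      (s.indicator fun r : ℝ => ENNReal.ofReal (r ^ 2)) r.1 := fun r => rfl
  simp_rw [this]
  rw [lintegral_subtype_comap measurableSet_Ioi, ← lintegral_indicator measurableSet_Ioi,
    indicator_indicator, inter_comm]

theorem measurePreserving_polar :
    MeasurePreserving (fun z : S2 × ℝ => z.2 • (z.1 : E3)) (sphereMeasure.prod radialMeasure)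
      volume := by
  have hmeas : Measurable fun z : S2 × ℝ => z.2 • (z.1 : E3) := by fun_prop
  refine ⟨hmeas, ?_⟩
  have h1 := (volume : Measure E3).measurePreserving_homeomorphUnitSphereProd
  have h2 : MeasurePreserving (Prod.map id Subtype.val : S2 × Ioi (0 : ℝ) → S2 × ℝ)
      (sphereMeasure.prod (Measure.volumeIoiPow 2)) (sphereMeasure.prod radialMeasure) :=
    (MeasurePreserving.id sphereMeasure).prod ⟨measurable_subtype_coe, map_volumeIoiPow⟩
  have h3 : Module.finrank ℝ E3 - 1 = 2 := by simp
  rw [h3] at h1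
  rw [← h2.map_eq, ← h1.map_eq, Measure.map_map h2.measurable h1.measurable,
    Measure.map_map hmeas (h2.measurable.comp h1.measurable)]
  have h4 : (fun z : S2 × ℝ => z.2 • (z.1 : E3)) ∘ Prod.map id Subtype.val ∘
      (homeomorphUnitSphereProd E3) = Subtype.val := by
    funext p
    exact congrArg Subtype.val ((homeomorphUnitSphereProd E3).symm_apply_apply p)
  rw [h4, map_comap_subtype_coe (measurableSet_singleton _).compl, restrict_compl_singleton]

theorem measurePreserving_prodProdProdComm {α β γ δ : Type*} [MeasurableSpace α]
    [MeasurableSpace β] [MeasurableSpace γ] [MeasurableSpace δ] (μ : Measure α) (ν : Measure β)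
    (κ : Measure γ) (τ : Measure δ) [SFinite μ] [SFinite ν] [SFinite κ] [SFinite τ] :
    MeasurePreserving (fun z : (α × β) × (γ × δ) => ((z.1.1, z.2.1), (z.1.2, z.2.2)))
      ((μ.prod ν).prod (κ.prod τ)) ((μ.prod κ).prod (ν.prod τ)) := by
  have h1 := measurePreserving_prodAssoc μ ν (κ.prod τ)
  have h2 := (measurePreserving_prodAssoc ν κ τ).symm
  have h3 := (Measure.measurePreserving_swap (μ := ν) (ν := κ)).prod (MeasurePreserving.id τ)
  have h4 := measurePreserving_prodAssoc κ ν τ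
  have h5 := (measurePreserving_prodAssoc μ κ (ν.prod τ)).symm
  exact h5.comp (((MeasurePreserving.id μ).prod (h4.comp (h3.comp h2))).comp h1)

theorem measurePreserving_polar_pair :
    MeasurePreserving (fun z : (S2 × S2) × (ℝ × ℝ) => (z.2.1 • (z.1.1 : E3), z.2.2 • (z.1.2 : E3)))
      ((sphereMeasure.prod sphereMeasure).prod (radialMeasure.prod radialMeasure)) volume :=
  (measurePreserving_polar.prod measurePreserving_polar).comp
    (measurePreserving_prodProdProdComm _ _ _ _)

/-- The direction of a vector, as a point of `S²`. -/
def dirS (p : E3) : S2 :=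
  ⟨if p = 0 then EuclideanSpace.single 0 1 else dir p, by
    split_ifs with h
    · simp
    · simpa using norm_dir h⟩

theorem coe_dirS {p : E3} (hp : p ≠ 0) : (dirS p : E3) = dir p := by simp [dirS, hp]

theorem dirS_smul (x : S2) {r : ℝ} (hr : 0 < r) : dirS (r • (x : E3)) = x := by
  have hx : ‖(x : E3)‖ = 1 := by simp
  have : r • (x : E3) ≠ 0 := smul_ne_zero hr.ne' (by rw [← norm_pos_iff, hx]; norm_num)
  exact Subtype.ext ((coe_dirS this).trans (dir_smul hx hr))

theorem measurable_dir : Measurable dir := by unfold dir; fun_prop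

theorem measurable_dirS : Measurable dirS :=
  (Measurable.ite (measurableSet_singleton 0) measurable_const measurable_dir).subtype_mk

/-- The domain of the parameters of two successive points on a geodesic. -/
def paramWedge : Set (ℝ × ℝ) := {w | 0 < w.1 ∧ w.1 < w.2}

theorem measurableSet_paramWedge : MeasurableSet paramWedge :=
  (measurableSet_lt measurable_const measurable_fst).inter
    (measurableSet_lt measurable_fst measurable_snd)

instance : (volume : Measure (E3 × E3)).IsAddHaarMeasure :=
  Measure.prod.instIsAddHaarMeasure (volume : Measure E3) (volume : Measure E3)

theorem conf2_ae_eq : (geoPair '' paramDomain : Set (E3 × E3)) =ᵐ[volume] Conf2 := by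
  rw [image_geoPair]
  have h1 : (volume : Measure (E3 × E3)) (sphere 0 1 ×ˢ univ) = 0 := by
    rw [Measure.volume_eq_prod, Measure.prod_prod, Measure.addHaar_sphere, zero_mul]
  have h2 : (volume : Measure (E3 × E3)) (univ ×ˢ sphere 0 1) = 0 := by
    rw [Measure.volume_eq_prod, Measure.prod_prod, Measure.addHaar_sphere, mul_zero]
  filter_upwards [measure_eq_zero_iff_ae_notMem.1 h1, measure_eq_zero_iff_ae_notMem.1 h2]
    with q hq1 hq2
  simp only [mem_prod, mem_sphere_iff_norm, sub_zero, mem_univ, and_true, true_and] at hq1 hq2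
  apply propext
  change (‖q.1‖ < 1 ∧ ‖q.2‖ < 1 ∧ q.1 ≠ q.2) ↔ (‖q.1‖ ≤ 1 ∧ ‖q.2‖ ≤ 1 ∧ q.1 ≠ q.2)
  rw [lt_iff_le_and_ne, lt_iff_le_and_ne]
  tauto

/-- A vector pointing to the pole lies in the hyperplane where the first coordinate vanishes, which
is null. -/
theorem ae_dir_ne_pole :
    ∀ᵐ p : E3 × E3, p.1 ≠ 0 → p.2 ≠ 0 → 1 + dir p.1 2 ≠ 0 ∧ 1 + dir p.2 2 ≠ 0 := by
  have key : ∀ L : E3 × E3 →L[ℝ] E3, Function.Surjective L →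
      ∀ᵐ p : E3 × E3, L p ≠ 0 → 1 + dir (L p) 2 ≠ 0 := by
    intro L hL
    let φ : E3 × E3 →L[ℝ] ℝ := EuclideanSpace.proj (0 : Fin 3) ∘L L
    have hφ : LinearMap.ker (φ : E3 × E3 →ₗ[ℝ] ℝ) ≠ ⊤ := by
      intro h
      obtain ⟨q, hq⟩ := hL (stdBasis 0)
      have : φ q = 0 := LinearMap.mem_ker.1 (h ▸ Submodule.mem_top : q ∈ LinearMap.ker
        (φ : E3 × E3 →ₗ[ℝ] ℝ))
      simp [φ, hq, stdBasis] at this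
    have h0 := Measure.addHaar_submodule (volume : Measure (E3 × E3)) _ hφ
    filter_upwards [measure_eq_zero_iff_ae_notMem.1 h0] with p hp hp0 h
    apply hp
    have hn := norm_sq_eq_sum (dir (L p))
    rw [norm_dir hp0, show dir (L p) 2 = -1 by linarith] at hn
    have h1 : dir (L p) 0 = 0 := by nlinarith [sq_nonneg (dir (L p) 0), sq_nonneg (dir (L p) 1)]
    have h2 : (‖L p‖ • dir (L p)) 0 = 0 := by simp [h1]
    rw [norm_smul_dir hp0] at h2
    exact h2
  filter_upwards [key (.fst ℝ E3 E3) Prod.fst_surjective, key (.snd ℝ E3 E3) Prod.snd_surjective]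
    with p h1 h2 h3 h4 using ⟨h1 h3, h2 h4⟩

/-- Integration over `Conf2` in terms of the endpoints of the geodesics and of the parameters on
the geodesics. -/
theorem integrableOn_conf2_and_integral_eq {F : E3 × E3 → ℂ} {h : (S2 × S2) × (ℝ × ℝ) → ℂ}
    (hmeas : Measurable h) (hdiag : ∀ x w, h ((x, x), w) = 0)
    (hF : ∀ᵐ p : E3 × E3, p ∈ paramDomain → |(fderiv ℝ geoPair p).det| • F (geoPair p) =
      (‖p.1‖ ^ 2 * ‖p.2‖ ^ 2)⁻¹ • h ((dirS p.1, dirS p.2), (‖p.1‖, ‖p.2‖)))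
    (hint : Integrable h ((sphereMeasure.prod sphereMeasure).prod (volume.restrict paramWedge))) :
    IntegrableOn F Conf2 ∧ ∫ q in Conf2, F q =
      ∫ z, h z ∂((sphereMeasure.prod sphereMeasure).prod (volume.restrict paramWedge)) := by
  have hd : ∀ p ∈ paramDomain, HasFDerivWithinAt geoPair (fderiv ℝ geoPair p) paramDomain p :=
    fun p hp => ((contDiffAt_geoPair hp).differentiableAt (by simp)).hasFDerivAt.hasFDerivWithinAt
  have hms := isOpen_paramDomain.measurableSet
  have hcongr : (fun p => |(fderiv ℝ geoPair p).det| • F (geoPair p))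
      =ᵐ[volume.restrict paramDomain]
      fun p => (‖p.1‖ ^ 2 * ‖p.2‖ ^ 2)⁻¹ • h ((dirS p.1, dirS p.2), (‖p.1‖, ‖p.2‖)) :=
    (ae_restrict_iff' hms).2 hF
  rw [← integrableOn_congr_set_ae conf2_ae_eq, ← setIntegral_congr_set conf2_ae_eq,
    integrableOn_image_iff_integrableOn_abs_det_fderiv_smul volume hms hd injOn_geoPair,
    integral_image_eq_integral_abs_det_fderiv_smul volume hms hd injOn_geoPair,
    integrableOn_congr_fun_ae hcongr, integral_congr_ae hcongr]
  set G : E3 × E3 → ℂ := paramDomain.indicator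
    fun p => (‖p.1‖ ^ 2 * ‖p.2‖ ^ 2)⁻¹ • h ((dirS p.1, dirS p.2), (‖p.1‖, ‖p.2‖)) with hG
  rw [← integrable_indicator_iff hms, ← integral_indicator hms, ← hG]
  have hGm : Measurable G := by
    have h1 : Measurable fun p : E3 × E3 => ((dirS p.1, dirS p.2), (‖p.1‖, ‖p.2‖)) :=
      ((measurable_dirS.comp measurable_fst).prodMk (measurable_dirS.comp measurable_snd)).prodMk
        (measurable_fst.norm.prodMk measurable_snd.norm)
    have h2 : Measurable fun p : E3 × E3 => (‖p.1‖ ^ 2 * ‖p.2‖ ^ 2)⁻¹ := by fun_prop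
    exact (h2.smul (hmeas.comp h1)).indicator hms
  have hpol := measurePreserving_polar_pair
  -- The density u²v² of polar coordinates, which cancels the factor in `hF`.
  set w : (S2 × S2) × (ℝ × ℝ) → ENNReal :=
    fun z => ENNReal.ofReal (z.2.1 ^ 2) * ENNReal.ofReal (z.2.2 ^ 2) with hw
  have hwm : Measurable w := by fun_prop
  have hmeq : (sphereMeasure.prod sphereMeasure).prod (radialMeasure.prod radialMeasure) =
      ((sphereMeasure.prod sphereMeasure).prod
        (volume.restrict (Ioi (0 : ℝ) ×ˢ Ioi (0 : ℝ)))).withDensity w := by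
    rw [radialMeasure, prod_withDensity (by fun_prop) (by fun_prop),
      prod_withDensity_right (by fun_prop), Measure.prod_restrict, ← Measure.volume_eq_prod]
  have hwt : ∀ᵐ z ∂((sphereMeasure.prod sphereMeasure).prod
      (volume.restrict (Ioi (0 : ℝ) ×ˢ Ioi (0 : ℝ)))), w z < ⊤ :=
    Eventually.of_forall fun z => ENNReal.mul_lt_top ENNReal.ofReal_lt_top ENNReal.ofReal_lt_top
  have hpos : ∀ᵐ z ∂((sphereMeasure.prod sphereMeasure).prod
      (volume.restrict (Ioi (0 : ℝ) ×ˢ Ioi (0 : ℝ)))), 0 < z.2.1 ∧ 0 < z.2.2 := by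
    have : ∀ᵐ v ∂(volume.restrict (Ioi (0 : ℝ) ×ˢ Ioi (0 : ℝ))), 0 < v.1 ∧ 0 < v.2 :=
      ae_restrict_of_forall_mem (measurableSet_Ioi.prod measurableSet_Ioi) fun v hv => hv
    exact Measure.quasiMeasurePreserving_snd.ae this
  have hcomp : (fun z : (S2 × S2) × (ℝ × ℝ) => (w z).toReal •
      G (z.2.1 • (z.1.1 : E3), z.2.2 • (z.1.2 : E3))) =ᵐ[(sphereMeasure.prod sphereMeasure).prod
      (volume.restrict (Ioi (0 : ℝ) ×ˢ Ioi (0 : ℝ)))]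
      (univ ×ˢ paramWedge).indicator h := by
    filter_upwards [hpos] with ⟨⟨x, y⟩, ⟨u, v⟩⟩ ⟨hu, hv⟩
    simp only at hu hv ⊢
    have hx : ‖(x : E3)‖ = 1 := by simp
    have hy : ‖(y : E3)‖ = 1 := by simp
    have hwz : (w ((x, y), (u, v))).toReal = u ^ 2 * v ^ 2 := by
      simp [hw, ENNReal.toReal_ofReal, sq_nonneg]
    have hnu : ‖u • (x : E3)‖ = u := by rw [norm_smul, hx, mul_one, Real.norm_of_nonneg hu.le]
    have hnv : ‖v • (y : E3)‖ = v := by rw [norm_smul, hy, mul_one, Real.norm_of_nonneg hv.le]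
    rw [hwz, hG]
    by_cases huv : u < v
    · rw [indicator_of_mem (show ((x, y), (u, v)) ∈ univ ×ˢ paramWedge from ⟨trivial, hu, huv⟩)]
      -- Coinciding endpoints lie outside `paramDomain`, and `h` vanishes there by `hdiag`; both
      -- sides are zero.
      by_cases hxy : x = y
      · subst hxy
        rw [hdiag, indicator_of_notMem, smul_zero]
        rintro ⟨-, -, h3⟩
        exact h3 (by rw [dir_smul hx hu, dir_smul hx hv])
      · have hmem : (u • (x : E3), v • (y : E3)) ∈ paramDomain := by
          refine ⟨?_, ?_, ?_⟩
          · rw [← norm_pos_iff, hnu]; exact hu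
          · simp only [hnu, hnv]; exact huv
          · simp only [dir_smul hx hu, dir_smul hy hv]
            exact fun h => hxy (Subtype.ext h)
        rw [indicator_of_mem hmem]
        simp only [hnu, hnv, dirS_smul x hu, dirS_smul y hv]
        rw [smul_smul, mul_inv_cancel₀ (by positivity), one_smul]
    · rw [indicator_of_notMem (s := univ ×ˢ paramWedge) (fun h => huv h.2.2),
        indicator_of_notMem, smul_zero]
      rintro ⟨-, h2, -⟩
      simp only [hnu, hnv] at h2
      exact huv h2
  have hrestr : ((sphereMeasure.prod sphereMeasure).prod
      (volume.restrict (Ioi (0 : ℝ) ×ˢ Ioi (0 : ℝ)))).restrict (univ ×ˢ paramWedge) =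
      (sphereMeasure.prod sphereMeasure).prod (volume.restrict paramWedge) := by
    rw [← Measure.prod_restrict, Measure.restrict_univ,
      Measure.restrict_restrict measurableSet_paramWedge]
    congr 2
    exact inter_eq_left.2 fun v hv => ⟨hv.1, hv.1.trans hv.2⟩
  have hmsw : MeasurableSet (univ ×ˢ paramWedge : Set ((S2 × S2) × (ℝ × ℝ))) :=
    MeasurableSet.univ.prod measurableSet_paramWedge
  constructor
  · rw [← hpol.integrable_comp hGm.aestronglyMeasurable, hmeq,
      integrable_withDensity_iff_integrable_smul' hwm hwt]
    refine Integrable.congr ?_ hcomp.symm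
    rw [integrable_indicator_iff hmsw, IntegrableOn, hrestr]
    exact hint
  · rw [← hpol.map_eq, integral_map hpol.measurable.aemeasurable
      (by rw [hpol.map_eq]; exact hGm.aestronglyMeasurable), hmeq,
      integral_withDensity_eq_integral_toReal_smul hwm hwt, integral_congr_ae hcomp,
      integral_indicator hmsw, hrestr]

end Polar

/-! ### Reduction to a double integral over S² × S² with a singular kernel. -/

section Kernel

theorem norm_coe_sphere (x : S2) : ‖(x : E3)‖ = 1 := by simp

/-- The Euclidean speed of a unit-speed hyperbolic curve is (1 − |γ|²)/2, and passing from arc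
length to u divides by u. The factor |x − y| gained here tames the kernel |x − y|⁻⁴. -/
theorem norm_geoDeriv {x y : E3} (hx : ‖x‖ = 1) (hy : ‖y‖ = 1) {u : ℝ} (hu : 0 ≤ u) :
    ‖geoDeriv x y u‖ = ‖x - y‖ / (1 + ‖x - y‖ * u + u ^ 2) := by
  have hD := geo_den_pos x y hu
  have hin := inner_eq_of_norm_eq_one hx hy
  have h1 : ‖(2 * u) • (y - x) + ‖x - y‖ • (u ^ 2 • y - x)‖ ^ 2 =
      (‖x - y‖ * (1 + ‖x - y‖ * u + u ^ 2)) ^ 2 := by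
    have e : (2 * u) • (y - x) + ‖x - y‖ • (u ^ 2 • y - x) =
        (2 * u + ‖x - y‖ * u ^ 2) • y - (2 * u + ‖x - y‖) • x := by module
    rw [e, norm_sub_sq_real, norm_smul, norm_smul, inner_smul_left, inner_smul_right, hx, hy,
      real_inner_comm, hin, Real.norm_eq_abs, Real.norm_eq_abs, mul_one, mul_one, sq_abs, sq_abs]
    simp only [conj_trivial]
    ring
  have h2 : ‖(2 * u) • (y - x) + ‖x - y‖ • (u ^ 2 • y - x)‖ =
      ‖x - y‖ * (1 + ‖x - y‖ * u + u ^ 2) :=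
    (pow_left_inj₀ (norm_nonneg _) (by positivity) two_ne_zero).1 h1
  rw [geoDeriv, norm_smul, h2, Real.norm_of_nonneg (by positivity)]
  field_simp

theorem norm_geoDeriv_le {x y : E3} (hx : ‖x‖ = 1) (hy : ‖y‖ = 1) {u : ℝ} (hu : 0 ≤ u) :
    ‖geoDeriv x y u‖ ≤ ‖x - y‖ * (1 + u ^ 2)⁻¹ := by
  rw [norm_geoDeriv hx hy hu, ← div_eq_mul_inv]
  have : 0 ≤ ‖x - y‖ * u := by positivity
  gcongr
  linarith

/-- The integrand `α(γ'(u)) β(γ'(v))` on the pairs of points of a geodesic. -/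
def fiberIntegrand (a b : E3 → E3 →L[ℝ] ℂ) (x y : E3) (w : ℝ × ℝ) : ℂ :=
  a (geo x y w.1) (geoDeriv x y w.1) * b (geo x y w.2) (geoDeriv x y w.2)

/-- The integral of `fiberIntegrand` over the pairs of successive points of a geodesic. -/
def fiberIntegral (a b : E3 → E3 →L[ℝ] ℂ) (x y : E3) : ℂ :=
  ∫ w in paramWedge, fiberIntegrand a b x y w

theorem integrable_wedgeWeight :
    Integrable (fun w : ℝ × ℝ => (1 + w.1 ^ 2)⁻¹ * (1 + w.2 ^ 2)⁻¹) volume :=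
  integrable_inv_one_add_sq.mul_prod integrable_inv_one_add_sq

theorem norm_fiberIntegrand_le {a b : E3 → E3 →L[ℝ] ℂ} {C : ℝ} (ha : ∀ x, ‖a x‖ ≤ C)
    (hb : ∀ x, ‖b x‖ ≤ C) {x y : E3} (hx : ‖x‖ = 1) (hy : ‖y‖ = 1) {w : ℝ × ℝ}
    (hw : w ∈ paramWedge) :
    ‖fiberIntegrand a b x y w‖ ≤
      C ^ 2 * ‖x - y‖ ^ 2 * ((1 + w.1 ^ 2)⁻¹ * (1 + w.2 ^ 2)⁻¹) := by
  have hC : 0 ≤ C := (norm_nonneg _).trans (ha 0)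
  have h1 : ‖a (geo x y w.1) (geoDeriv x y w.1)‖ ≤ C * (‖x - y‖ * (1 + w.1 ^ 2)⁻¹) :=
    (ContinuousLinearMap.le_opNorm _ _).trans
      (mul_le_mul (ha _) (norm_geoDeriv_le hx hy hw.1.le) (norm_nonneg _) hC)
  have h2 : ‖b (geo x y w.2) (geoDeriv x y w.2)‖ ≤ C * (‖x - y‖ * (1 + w.2 ^ 2)⁻¹) :=
    (ContinuousLinearMap.le_opNorm _ _).trans
      (mul_le_mul (hb _) (norm_geoDeriv_le hx hy (hw.1.trans hw.2).le) (norm_nonneg _) hC)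
  rw [fiberIntegrand, norm_mul]
  refine (mul_le_mul h1 h2 (norm_nonneg _) (by positivity)).trans (le_of_eq ?_)
  ring

theorem norm_fiberIntegral_le {a b : E3 → E3 →L[ℝ] ℂ} {C : ℝ} (ha : ∀ x, ‖a x‖ ≤ C)
    (hb : ∀ x, ‖b x‖ ≤ C) {x y : E3} (hx : ‖x‖ = 1) (hy : ‖y‖ = 1) :
    ‖fiberIntegral a b x y‖ ≤ C ^ 2 * ‖x - y‖ ^ 2 *
      ∫ w in paramWedge, (1 + w.1 ^ 2)⁻¹ * (1 + w.2 ^ 2)⁻¹ := by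
  rw [fiberIntegral, ← integral_const_mul]
  refine norm_integral_le_of_norm_le (integrable_wedgeWeight.integrableOn.const_mul _) ?_
  exact ae_restrict_of_forall_mem measurableSet_paramWedge fun w hw =>
    norm_fiberIntegrand_le ha hb hx hy hw

theorem measurable_fiberIntegrand {a b : E3 → E3 →L[ℝ] ℂ} (ha : Continuous a) (hb : Continuous b) :
    Measurable fun z : (S2 × S2) × (ℝ × ℝ) => fiberIntegrand a b z.1.1 z.1.2 z.2 := by
  have key : ∀ {a : E3 → E3 →L[ℝ] ℂ}, Continuous a →
      Measurable fun z : (S2 × S2) × ℝ => a (geo z.1.1 z.1.2 z.2) (geoDeriv z.1.1 z.1.2 z.2) := by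
    intro a ha
    have h1 : Continuous fun q : E3 × E3 => a q.1 q.2 :=
      (ha.comp continuous_fst).clm_apply continuous_snd
    have h2 : Measurable fun z : (S2 × S2) × ℝ => geo z.1.1 z.1.2 z.2 := by
      unfold geo; fun_prop
    have h3 : Measurable fun z : (S2 × S2) × ℝ => geoDeriv z.1.1 z.1.2 z.2 := by
      unfold geoDeriv; fun_prop
    exact h1.measurable.comp (h2.prodMk h3)
  have h1 : Measurable fun z : (S2 × S2) × (ℝ × ℝ) => (z.1, z.2.1) := by fun_prop
  have h2 : Measurable fun z : (S2 × S2) × (ℝ × ℝ) => (z.1, z.2.2) := by fun_prop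
  have h3 := (key ha).comp h1
  have h4 := (key hb).comp h2
  exact h3.mul h4

/-- The difference of the two cutoffs. -/
def cutoffDiff (ℓ₁ ℓ₂ : S2 → ℝ) (ε : ℝ) (x y : S2) : ℂ :=
  Theta (fun z => ε * ℓ₁ z) (x, y) - Theta (fun z => ε * ℓ₂ z) (x, y)

theorem norm_cutoffDiff_le (ℓ₁ ℓ₂ : S2 → ℝ) (ε : ℝ) (x y : S2) : ‖cutoffDiff ℓ₁ ℓ₂ ε x y‖ ≤ 1 := by
  rw [cutoffDiff, Theta, Theta]
  split_ifs <;> simp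

theorem cutoffDiff_ne_zero {ℓ₁ ℓ₂ : S2 → ℝ} {m M : ℝ} (h₁ : ∀ z, m ≤ ℓ₁ z ∧ ℓ₁ z ≤ M)
    (h₂ : ∀ z, m ≤ ℓ₂ z ∧ ℓ₂ z ≤ M) {ε : ℝ} (hε : 0 < ε) {x y : S2}
    (h : cutoffDiff ℓ₁ ℓ₂ ε x y ≠ 0) :
    ε * m ≤ InnerProductGeometry.angle (x : E3) y ∧
      InnerProductGeometry.angle (x : E3) y ≤ ε * M := by
  have key : ∀ {ℓ : S2 → ℝ}, (∀ z, m ≤ ℓ z ∧ ℓ z ≤ M) →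
      ε * m ≤ (ε * ℓ x + ε * ℓ y) / 2 ∧ (ε * ℓ x + ε * ℓ y) / 2 ≤ ε * M := by
    intro ℓ hℓ
    have h1 := mul_le_mul_of_nonneg_left (hℓ x).1 hε.le
    have h2 := mul_le_mul_of_nonneg_left (hℓ x).2 hε.le
    have h3 := mul_le_mul_of_nonneg_left (hℓ y).1 hε.le
    have h4 := mul_le_mul_of_nonneg_left (hℓ y).2 hε.le
    constructor <;> linarith
  have k₁ := key h₁
  have k₂ := key h₂
  constructor
  · by_contra! hlt
    apply h
    rw [cutoffDiff, Theta, Theta, if_pos (hlt.le.trans k₁.1), if_pos (hlt.le.trans k₂.1), sub_zero]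
  · by_contra! hlt
    apply h
    rw [cutoffDiff, Theta, Theta, if_neg (not_le.2 (k₁.2.trans_lt hlt)),
      if_neg (not_le.2 (k₂.2.trans_lt hlt)), sub_self]

/-- The chord is 2 sin(θ/2), and Jordan's inequality bounds the sine from below. -/
theorem angle_le_norm_sub {x y : E3} (hx : ‖x‖ = 1) (hy : ‖y‖ = 1) :
    2 / Real.pi * InnerProductGeometry.angle x y ≤ ‖x - y‖ := by
  set θ := InnerProductGeometry.angle x y with hθ
  have h0 : 0 ≤ θ := InnerProductGeometry.angle_nonneg x y
  have hπ : θ ≤ Real.pi := InnerProductGeometry.angle_le_pi x y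
  have hin : inner ℝ x y = Real.cos θ := by
    rw [hθ, InnerProductGeometry.cos_angle, hx, hy]; simp
  have hs : 0 ≤ Real.sin (θ / 2) := Real.sin_nonneg_of_nonneg_of_le_pi (by linarith) (by linarith)
  have h1 : ‖x - y‖ ^ 2 = (2 * Real.sin (θ / 2)) ^ 2 := by
    rw [norm_sub_sq_real, hx, hy, hin]
    have := Real.cos_sq' (θ / 2)
    have h2 := Real.cos_sq (θ / 2)
    rw [show 2 * (θ / 2) = θ by ring] at h2
    nlinarith
  have h2 : ‖x - y‖ = 2 * Real.sin (θ / 2) :=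
    (pow_left_inj₀ (norm_nonneg _) (by positivity) two_ne_zero).1 h1
  have h3 := Real.mul_le_sin (x := θ / 2) (by linarith) (by linarith)
  rw [h2]
  linarith

theorem measurable_cutoffDiff {ℓ₁ ℓ₂ : S2 → ℝ} (h₁ : Continuous ℓ₁) (h₂ : Continuous ℓ₂) (ε : ℝ) :
    Measurable fun z : S2 × S2 => cutoffDiff ℓ₁ ℓ₂ ε z.1 z.2 := by
  have hang : Continuous fun z : S2 × S2 => InnerProductGeometry.angle (z.1 : E3) (z.2 : E3) := by
    unfold InnerProductGeometry.angle
    refine Real.continuous_arccos.comp ?_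
    simp only [norm_coe_sphere]
    fun_prop
  have key : ∀ {ℓ : S2 → ℝ}, Continuous ℓ →
      Measurable fun z : S2 × S2 => Theta (fun z => ε * ℓ z) z := by
    intro ℓ hℓ
    refine Measurable.ite ?_ measurable_const measurable_const
    exact (isClosed_le hang (by fun_prop)).measurableSet
  exact (key h₁).sub (key h₂)

/-- The integrand of the integral over `Conf2` in terms of endpoints and parameters. -/
def kernelIntegrand (ℓ₁ ℓ₂ : S2 → ℝ) (a b : E3 → E3 →L[ℝ] ℂ) (ε : ℝ)
    (z : (S2 × S2) × (ℝ × ℝ)) : ℂ :=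
  -(Real.pi ^ 2 : ℂ)⁻¹ * (cutoffDiff ℓ₁ ℓ₂ ε z.1.1 z.1.2 *
    ((‖(z.1.1 : E3) - z.1.2‖ : ℂ) ^ 4)⁻¹ * fiberIntegrand a b z.1.1 z.1.2 z.2)

/-- The cutoff difference vanishes near the diagonal, so for fixed ε the kernel is bounded; in the
parameters the integrand is dominated by 1/((1 + u²)(1 + v²)). -/
theorem integrable_kernelIntegrand {ℓ₁ ℓ₂ : S2 → ℝ} (hc₁ : Continuous ℓ₁) (hc₂ : Continuous ℓ₂)
    {m M : ℝ} (hm : 0 < m) (h₁ : ∀ z, m ≤ ℓ₁ z ∧ ℓ₁ z ≤ M) (h₂ : ∀ z, m ≤ ℓ₂ z ∧ ℓ₂ z ≤ M)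
    {a b : E3 → E3 →L[ℝ] ℂ} (hac : Continuous a) (hbc : Continuous b) {C : ℝ}
    (ha : ∀ x, ‖a x‖ ≤ C) (hb : ∀ x, ‖b x‖ ≤ C) {ε : ℝ} (hε : 0 < ε) :
    Measurable (kernelIntegrand ℓ₁ ℓ₂ a b ε) ∧ Integrable (kernelIntegrand ℓ₁ ℓ₂ a b ε)
      ((sphereMeasure.prod sphereMeasure).prod (volume.restrict paramWedge)) := by
  have hmeas : Measurable (kernelIntegrand ℓ₁ ℓ₂ a b ε) := by
    have h1 := (measurable_cutoffDiff hc₁ hc₂ ε).comp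
      (measurable_fst : Measurable (Prod.fst : (S2 × S2) × (ℝ × ℝ) → S2 × S2))
    have h2 : Measurable fun z : (S2 × S2) × (ℝ × ℝ) =>
        ((‖(z.1.1 : E3) - z.1.2‖ : ℂ) ^ 4)⁻¹ := by fun_prop
    exact ((h1.mul h2).mul (measurable_fiberIntegrand hac hbc)).const_mul _
  refine ⟨hmeas, ?_⟩
  -- A lower bound for |x − y| where the cutoffs differ: the angle is at least εm there, and the
  -- chord at least 2/π times the angle.
  set κ := 2 / Real.pi * (ε * m) with hκ
  have hκ0 : 0 < κ := by positivity
  have hC : 0 ≤ C := (norm_nonneg _).trans (ha 0)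
  have hg : Integrable (fun z : (S2 × S2) × (ℝ × ℝ) => (Real.pi ^ 2)⁻¹ * (κ ^ 2)⁻¹ * C ^ 2 *
      ((1 + z.2.1 ^ 2)⁻¹ * (1 + z.2.2 ^ 2)⁻¹))
      ((sphereMeasure.prod sphereMeasure).prod (volume.restrict paramWedge)) :=
    ((integrable_wedgeWeight.integrableOn (s := paramWedge)).comp_snd _).const_mul _
  refine hg.mono' hmeas.aestronglyMeasurable ?_
  have hw : ∀ᵐ z ∂((sphereMeasure.prod sphereMeasure).prod (volume.restrict paramWedge)),
      z.2 ∈ paramWedge :=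
    Measure.quasiMeasurePreserving_snd.ae (ae_restrict_mem measurableSet_paramWedge)
  filter_upwards [hw] with ⟨⟨x, y⟩, w⟩ hw
  simp only at hw
  simp only [kernelIntegrand]
  have hpos : 0 ≤ (1 + w.1 ^ 2)⁻¹ * (1 + w.2 ^ 2)⁻¹ := by positivity
  by_cases h0 : cutoffDiff ℓ₁ ℓ₂ ε x y = 0
  · rw [h0]
    simp only [zero_mul, mul_zero, norm_zero]
    positivity
  · have hc : κ ≤ ‖(x : E3) - y‖ := by
      refine le_trans ?_ (angle_le_norm_sub (norm_coe_sphere x) (norm_coe_sphere y))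
      exact mul_le_mul_of_nonneg_left (cutoffDiff_ne_zero h₁ h₂ hε h0).1 (by positivity)
    have hf := norm_fiberIntegrand_le ha hb (norm_coe_sphere x) (norm_coe_sphere y) hw
    have hc0 : 0 < ‖(x : E3) - y‖ := hκ0.trans_le hc
    have h1 : ‖cutoffDiff ℓ₁ ℓ₂ ε x y * ((‖(x : E3) - y‖ : ℂ) ^ 4)⁻¹ * fiberIntegrand a b x y w‖ ≤
        (κ ^ 2)⁻¹ * C ^ 2 * ((1 + w.1 ^ 2)⁻¹ * (1 + w.2 ^ 2)⁻¹) := by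
      rw [norm_mul, norm_mul, norm_inv, norm_pow, Complex.norm_real, norm_norm]
      calc _ ≤ 1 * (‖(x : E3) - y‖ ^ 4)⁻¹ *
            (C ^ 2 * ‖(x : E3) - y‖ ^ 2 * ((1 + w.1 ^ 2)⁻¹ * (1 + w.2 ^ 2)⁻¹)) := by
            gcongr
            exact norm_cutoffDiff_le _ _ _ _ _
        _ = (‖(x : E3) - y‖ ^ 2)⁻¹ * C ^ 2 * ((1 + w.1 ^ 2)⁻¹ * (1 + w.2 ^ 2)⁻¹) := by
            field_simp
        _ ≤ _ := by gcongr
    rw [norm_mul, norm_neg, norm_inv, norm_pow, Complex.norm_real, Real.norm_eq_abs, sq_abs]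
    refine (mul_le_mul_of_nonneg_left h1 (by positivity)).trans (le_of_eq ?_)
    ring

theorem rMap_geoPair_dirS {p : E3 × E3} (hp : p ∈ paramDomain) :
    rMap (geoPair p) = (dirS p.1, dirS p.2) := by
  have h := rMap_geoPair hp
  rw [rAmbient, Prod.mk.injEq] at h
  refine Prod.ext (Subtype.ext ?_) (Subtype.ext ?_)
  · rw [h.1, coe_dirS hp.1]
  · rw [h.2, coe_dirS (snd_ne_zero hp)]

theorem kernelIntegrand_self {ℓ₁ ℓ₂ : S2 → ℝ} {m M : ℝ} (hm : 0 < m)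
    (h₁ : ∀ z, m ≤ ℓ₁ z ∧ ℓ₁ z ≤ M) (h₂ : ∀ z, m ≤ ℓ₂ z ∧ ℓ₂ z ≤ M)
    (a b : E3 → E3 →L[ℝ] ℂ) {ε : ℝ} (hε : 0 < ε) (x : S2) (w : ℝ × ℝ) :
    kernelIntegrand ℓ₁ ℓ₂ a b ε ((x, x), w) = 0 := by
  have : cutoffDiff ℓ₁ ℓ₂ ε x x = 0 := by
    by_contra h
    have h1 := (cutoffDiff_ne_zero h₁ h₂ hε h).1
    rw [InnerProductGeometry.angle_self (by rw [← norm_pos_iff]; simp)] at h1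
    have : 0 < ε * m := by positivity
    linarith
  simp [kernelIntegrand, this]

/-- The change of variables uses |det| and the pullback of forms uses det. These are opposite,
whence the minus sign in `kernelIntegrand`. -/
theorem det_smul_cutoffForm_geoPair (ℓ₁ ℓ₂ : S2 → ℝ) {a b : E3 → E3 →L[ℝ] ℂ} {α β : E3 → Forms E3}
    (hα : ∀ x, ‖x‖ ≤ 1 → a x = degreeOnePart (α x))
    (hβ : ∀ x, ‖x‖ ≤ 1 → b x = degreeOnePart (β x)) (ε : ℝ) :
    ∀ᵐ p : E3 × E3, p ∈ paramDomain → |(fderiv ℝ geoPair p).det| •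
      evalForm frame12 (cutoffForm ℓ₁ ℓ₂ α β ε (geoPair p)) = (‖p.1‖ ^ 2 * ‖p.2‖ ^ 2)⁻¹ •
        kernelIntegrand ℓ₁ ℓ₂ a b ε ((dirS p.1, dirS p.2), (‖p.1‖, ‖p.2‖)) := by
  have hπ : (Real.pi : ℂ) ≠ 0 := Complex.ofReal_ne_zero.2 Real.pi_ne_zero
  filter_upwards [ae_dir_ne_pole] with p hpole hp
  have hp2 := snd_ne_zero hp
  obtain ⟨hx, hy⟩ := hpole hp.1 hp2
  have key := det_mul_evalForm_geoPair hp hx hy α β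
  have hd : |(fderiv ℝ geoPair p).det| =
      -LinearMap.det (fderiv ℝ geoPair p : E3 × E3 →ₗ[ℝ] E3 × E3) :=
    abs_of_neg (det_fderiv_geoPair_neg hp)
  have hα' := hα _ (norm_geo_le_one (norm_dir hp.1) (norm_dir hp2) (norm_nonneg p.1))
  have hβ' := hβ _ (norm_geo_le_one (norm_dir hp.1) (norm_dir hp2) (norm_nonneg p.2))
  rw [hd, cutoffForm, rMap_geoPair_dirS hp, map_smul, kernelIntegrand, fiberIntegrand]
  simp only [coe_dirS hp.1, coe_dirS hp2]
  rw [hα', hβ', Complex.real_smul, Complex.real_smul, smul_eq_mul, Complex.ofReal_neg, cutoffDiff]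
  simp only [geoPair] at key ⊢
  generalize degreeOnePart (α (geo (dir p.1) (dir p.2) ‖p.1‖))
    (geoDeriv (dir p.1) (dir p.2) ‖p.1‖) = A at *
  generalize degreeOnePart (β (geo (dir p.1) (dir p.2) ‖p.2‖))
    (geoDeriv (dir p.1) (dir p.2) ‖p.2‖) = B at *
  push_cast
  linear_combination (-(Theta (fun z => ε * ℓ₁ z) (dirS p.1, dirS p.2) -
    Theta (fun z => ε * ℓ₂ z) (dirS p.1, dirS p.2))) * key

/-- The integral over `Conf2` as an integral over pairs of endpoints. -/
theorem integral_cutoffForm {ℓ₁ ℓ₂ : S2 → ℝ} (hc₁ : Continuous ℓ₁) (hc₂ : Continuous ℓ₂)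
    {m M : ℝ} (hm : 0 < m) (h₁ : ∀ z, m ≤ ℓ₁ z ∧ ℓ₁ z ≤ M) (h₂ : ∀ z, m ≤ ℓ₂ z ∧ ℓ₂ z ≤ M)
    {a b : E3 → E3 →L[ℝ] ℂ} (hac : Continuous a) (hbc : Continuous b) {C : ℝ}
    (ha : ∀ x, ‖a x‖ ≤ C) (hb : ∀ x, ‖b x‖ ≤ C) {α β : E3 → Forms E3}
    (hα : ∀ x, ‖x‖ ≤ 1 → a x = degreeOnePart (α x))
    (hβ : ∀ x, ‖x‖ ≤ 1 → b x = degreeOnePart (β x)) {ε : ℝ} (hε : 0 < ε) :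
    IntegrableOn (fun q => evalForm frame12 (cutoffForm ℓ₁ ℓ₂ α β ε q)) Conf2 ∧
    integralConf2 frame12 (cutoffForm ℓ₁ ℓ₂ α β ε) = -(Real.pi ^ 2 : ℂ)⁻¹ *
      ∫ x, ∫ y, cutoffDiff ℓ₁ ℓ₂ ε x y * ((‖(x : E3) - y‖ : ℂ) ^ 4)⁻¹ * fiberIntegral a b x y
        ∂sphereMeasure ∂sphereMeasure ∧
    AEStronglyMeasurable (fun x => ∫ y, cutoffDiff ℓ₁ ℓ₂ ε x y * ((‖(x : E3) - y‖ : ℂ) ^ 4)⁻¹ *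
        fiberIntegral a b x y ∂sphereMeasure) sphereMeasure := by
  obtain ⟨hmeas, hint⟩ := integrable_kernelIntegrand hc₁ hc₂ hm h₁ h₂ hac hbc ha hb hε
  have hπ : (Real.pi : ℂ) ≠ 0 := Complex.ofReal_ne_zero.2 Real.pi_ne_zero
  have hdiag := kernelIntegrand_self (a := a) (b := b) hm h₁ h₂ hε
  have hF := det_smul_cutoffForm_geoPair ℓ₁ ℓ₂ hα hβ ε
  obtain ⟨hI, hE⟩ := integrableOn_conf2_and_integral_eq
    (F := fun q => evalForm frame12 (cutoffForm ℓ₁ ℓ₂ α β ε q)) hmeas hdiag hF hint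
  have hinner : ∀ z : S2 × S2, ∫ w in paramWedge, kernelIntegrand ℓ₁ ℓ₂ a b ε (z, w) =
      -(Real.pi ^ 2 : ℂ)⁻¹ * (cutoffDiff ℓ₁ ℓ₂ ε z.1 z.2 *
        ((‖(z.1 : E3) - z.2‖ : ℂ) ^ 4)⁻¹ * fiberIntegral a b z.1 z.2) := by
    intro z
    simp only [kernelIntegrand]
    rw [integral_const_mul, integral_const_mul, fiberIntegral]
  have hint2 := hint.integral_prod_left
  simp only [hinner] at hint2
  have hint3 : Integrable (fun z : S2 × S2 => cutoffDiff ℓ₁ ℓ₂ ε z.1 z.2 *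
        ((‖(z.1 : E3) - z.2‖ : ℂ) ^ 4)⁻¹ * fiberIntegral a b z.1 z.2)
      (sphereMeasure.prod sphereMeasure) := by
    have h := hint2.const_mul (-(Real.pi ^ 2 : ℂ))
    refine h.congr (Eventually.of_forall fun z => ?_)
    have h2 : (Real.pi ^ 2 : ℂ) ≠ 0 := pow_ne_zero 2 hπ
    simp only
    rw [← mul_assoc, neg_mul_neg, mul_inv_cancel₀ h2, one_mul]
  refine ⟨hI, ?_, hint3.integral_prod_left.aestronglyMeasurable⟩
  rw [integralConf2, hE, integral_prod _ hint]
  simp only [hinner]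
  rw [integral_const_mul, integral_prod _ hint3]

end Kernel

/-! ### Gnomonic and scaled polar coordinates on a hemisphere. -/

section Gnomonic

variable (b : OrthonormalBasis (Fin 3) ℝ E3)

/-- The vector of the plane of the first two basis vectors with given coordinates. -/
def planeVec (w : ℝ × ℝ) : E3 := w.1 • b 0 + w.2 • b 1

/-- The gnomonic chart of the hemisphere around `b 2`. -/
def gnomonic (w : ℝ × ℝ) : S2 := dirS (b 2 + planeVec b w)

theorem inner_basis (i j : Fin 3) : inner ℝ (b i) (b j) = if i = j then 1 else 0 :=
  orthonormal_iff_ite.1 b.orthonormal i j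

theorem inner_planeVec (w : ℝ × ℝ) : inner ℝ (b 2) (planeVec b w) = 0 := by
  simp [planeVec, inner_add_right, inner_smul_right]

theorem inner_add_planeVec (h : ℝ) (w : ℝ × ℝ) :
    inner ℝ (b 2) (h • b 2 + planeVec b w) = h := by
  rw [inner_add_right, inner_planeVec, inner_smul_right, inner_basis, if_pos rfl]
  ring

theorem norm_planeVec_sq (w : ℝ × ℝ) : ‖planeVec b w‖ ^ 2 = w.1 ^ 2 + w.2 ^ 2 := by
  rw [← real_inner_self_eq_norm_sq, planeVec, inner_add_left, inner_add_right, inner_add_right]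
  simp only [inner_smul_left, inner_smul_right, inner_basis]
  simp
  ring

theorem norm_add_planeVec_sq (w : ℝ × ℝ) :
    ‖b 2 + planeVec b w‖ ^ 2 = 1 + w.1 ^ 2 + w.2 ^ 2 := by
  rw [norm_add_sq_real, inner_planeVec, norm_planeVec_sq, b.norm_eq_one]
  ring

theorem add_planeVec_ne_zero (w : ℝ × ℝ) : b 2 + planeVec b w ≠ 0 := by
  intro h
  have := norm_add_planeVec_sq b w
  rw [h, norm_zero] at this
  nlinarith [sq_nonneg w.1, sq_nonneg w.2]

theorem inner_gnomonic (w : ℝ × ℝ) :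
    inner ℝ (b 2) (gnomonic b w : E3) = (√(1 + w.1 ^ 2 + w.2 ^ 2))⁻¹ := by
  have h := inner_add_planeVec b 1 w
  rw [one_smul] at h
  rw [gnomonic, coe_dirS (add_planeVec_ne_zero b w), dir, inner_smul_right, h, mul_one,
    ← norm_add_planeVec_sq, Real.sqrt_sq (norm_nonneg _)]

theorem continuous_planeVec : Continuous (planeVec b) := by unfold planeVec; fun_prop

theorem measurable_gnomonic : Measurable (gnomonic b) :=
  measurable_dirS.comp ((continuous_planeVec b).measurable.const_add _)

theorem measurePreserving_coordinates :
    MeasurePreserving (fun z : ℝ × (ℝ × ℝ) => z.1 • b 2 + planeVec b z.2) volume volume := by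
  have h1 := (volume_preserving_piFinSuccAbove (fun _ : Fin 3 => ℝ) 2).symm
  have h2 := (MeasurePreserving.id (volume : Measure ℝ)).prod
    (volume_preserving_finTwoArrow ℝ).symm
  have h3 := b.measurePreserving_repr_symm.comp ((PiLp.volume_preserving_toLp (Fin 3)).comp
    (h1.comp h2))
  suffices e : (fun z : ℝ × (ℝ × ℝ) => z.1 • b 2 + planeVec b z.2) = (⇑b.repr.symm ∘
      WithLp.toLp 2 ∘ ⇑(MeasurableEquiv.piFinSuccAbove (fun _ : Fin 3 => ℝ) 2).symm ∘
        Prod.map id ⇑(MeasurableEquiv.finTwoArrow (α := ℝ)).symm) by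
    rw [e]
    exact h3
  funext z
  apply b.repr.injective
  simp only [Function.comp_apply, LinearIsometryEquiv.apply_symm_apply]
  ext i
  rw [b.repr_apply_apply]
  fin_cases i
  · simp [planeVec, inner_add_right, inner_smul_right]
    rfl
  · simp [planeVec, inner_add_right, inner_smul_right]
    rfl
  · simp [planeVec, inner_add_right, inner_smul_right]

/-- For c > 0 this is the integral of ρ² up to 1/c. For c ≤ 0 the set misses the positive axis, and
the right side vanishes too because `ENNReal.ofReal` truncates and 0⁻¹ = 0; thus the opposite
hemisphere needs no separate treatment. -/
theorem radialMeasure_setOf {c : ℝ} : radialMeasure {ρ | 0 < ρ * c ∧ ρ * c < 1} =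
    ENNReal.ofReal (1 / 3) * ENNReal.ofReal ((c ^ 3)⁻¹) := by
  have hm : MeasurableSet {ρ : ℝ | 0 < ρ * c ∧ ρ * c < 1} :=
    (by fun_prop : Measurable fun ρ : ℝ => ρ * c) measurableSet_Ioo
  rw [radialMeasure, withDensity_apply _ hm, Measure.restrict_restrict hm]
  rcases le_or_gt c 0 with hc | hc
  · have : {ρ : ℝ | 0 < ρ * c ∧ ρ * c < 1} ∩ Ioi 0 = ∅ := by
      ext ρ
      simp only [mem_inter_iff, mem_ofPred_eq, mem_Ioi, mem_empty_iff_false, iff_false]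
      rintro ⟨⟨h, -⟩, h0⟩
      nlinarith
    rw [this, ENNReal.ofReal_of_nonpos (p := (c ^ 3)⁻¹)]
    · simp
    · exact inv_nonpos.2 (Odd.pow_nonpos (by decide) hc)
  · have : {ρ : ℝ | 0 < ρ * c ∧ ρ * c < 1} ∩ Ioi 0 = Ioo 0 c⁻¹ := by
      ext ρ
      simp only [mem_inter_iff, mem_ofPred_eq, mem_Ioi, mem_Ioo]
      rw [← lt_div_iff₀ hc, one_div]
      constructor
      · rintro ⟨⟨-, h⟩, h0⟩
        exact ⟨h0, h⟩
      · rintro ⟨h0, h⟩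
        exact ⟨⟨by positivity, h⟩, h0⟩
    rw [this, ← ofReal_integral_eq_lintegral_ofReal, ← integral_Ioc_eq_integral_Ioo,
      ← intervalIntegral.integral_of_le (by positivity), integral_pow,
      ← ENNReal.ofReal_mul (by norm_num)]
    · congr 1
      norm_num
      ring
    · exact ((continuous_pow 2).integrableOn_Icc).mono_set Ioo_subset_Icc_self
    · exact Eventually.of_forall fun x => sq_nonneg x

/-- The image of Lebesgue measure under the gnomonic chart. -/
theorem map_gnomonic : (volume : Measure (ℝ × ℝ)).map (gnomonic b) =
    sphereMeasure.withDensity fun y => ENNReal.ofReal ((inner ℝ (b 2) (y : E3) ^ 3)⁻¹) := by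
  classical
  ext s hs
  -- The part of the cone over s of height between 0 and 1 along `b 2`. Its volume is computed in
  -- polar coordinates, and by slices at height h, which are copies of the chart preimage of s
  -- scaled by h. Both carry the factor 1/3, which cancels.
  set T : Set E3 := {p | (0 < inner ℝ (b 2) p ∧ inner ℝ (b 2) p < 1) ∧ dirS p ∈ s} with hT
  have hTm : MeasurableSet T :=
    ((by fun_prop : Measurable fun p : E3 => inner ℝ (b 2) p) measurableSet_Ioo).inter
      (measurable_dirS hs)
  have h1 : volume T = ENNReal.ofReal (1 / 3) *
      ∫⁻ y in s, ENNReal.ofReal ((inner ℝ (b 2) (y : E3) ^ 3)⁻¹) ∂sphereMeasure := by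
    rw [← measurePreserving_polar.measure_preimage hTm.nullMeasurableSet,
      Measure.prod_apply (measurePreserving_polar.measurable hTm),
      ← lintegral_const_mul _ (by fun_prop), ← lintegral_indicator hs]
    refine lintegral_congr fun y => ?_
    rw [indicator_apply, ← radialMeasure_setOf]
    have hpos : ∀ᵐ ρ ∂radialMeasure, (0 : ℝ) < ρ :=
      (withDensity_absolutelyContinuous _ _).ae_le (ae_restrict_mem measurableSet_Ioi)
    split_ifs with hy
    · refine measure_congr ?_
      filter_upwards [hpos] with ρ hρ
      apply propext
      change (((0 < inner ℝ (b 2) (ρ • (y : E3)) ∧ inner ℝ (b 2) (ρ • (y : E3)) < 1) ∧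
        dirS (ρ • (y : E3)) ∈ s) ↔ (0 < ρ * inner ℝ (b 2) (y : E3) ∧
          ρ * inner ℝ (b 2) (y : E3) < 1))
      rw [inner_smul_right, dirS_smul y hρ]
      simp [hy]
    · refine measure_mono_null_ae ?_ measure_empty
      filter_upwards [hpos] with ρ hρ h
      apply hy
      have h' : dirS (ρ • (y : E3)) ∈ s := h.2
      rwa [dirS_smul y hρ] at h'
  have h2 : volume T = ENNReal.ofReal (1 / 3) * volume (gnomonic b ⁻¹' s) := by
    have hmp := measurePreserving_coordinates b
    rw [← hmp.measure_preimage hTm.nullMeasurableSet, Measure.volume_eq_prod,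
      Measure.prod_apply (hmp.measurable hTm)]
    have : ∀ h : ℝ, volume (Prod.mk h ⁻¹' ((fun z : ℝ × (ℝ × ℝ) => z.1 • b 2 + planeVec b z.2) ⁻¹'
        T)) = (Ioo (0 : ℝ) 1).indicator
          (fun h => ENNReal.ofReal (h ^ 2) * volume (gnomonic b ⁻¹' s)) h := by
      intro h
      rw [indicator_apply]
      split_ifs with hh
      · have h0 : h⁻¹ ≠ 0 := inv_ne_zero hh.1.ne'
        have e := Measure.addHaar_preimage_smul (volume : Measure (ℝ × ℝ)) h0 (gnomonic b ⁻¹' s)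
        have e2 : Prod.mk h ⁻¹' ((fun z : ℝ × (ℝ × ℝ) => z.1 • b 2 + planeVec b z.2) ⁻¹' T) =
            (fun w : ℝ × ℝ => h⁻¹ • w) ⁻¹' (gnomonic b ⁻¹' s) := by
          ext w
          change ((0 < inner ℝ (b 2) (h • b 2 + planeVec b w) ∧
            inner ℝ (b 2) (h • b 2 + planeVec b w) < 1) ∧ dirS (h • b 2 + planeVec b w) ∈ s) ↔
            gnomonic b (h⁻¹ • w) ∈ s
          have e3 : h • b 2 + planeVec b w = (h * ‖b 2 + planeVec b (h⁻¹ • w)‖) •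
              (gnomonic b (h⁻¹ • w) : E3) := by
            rw [gnomonic, coe_dirS (add_planeVec_ne_zero _ _), mul_smul,
              norm_smul_dir (add_planeVec_ne_zero _ _), smul_add, planeVec, planeVec]
            simp only [Prod.smul_fst, Prod.smul_snd, smul_eq_mul, smul_add, smul_smul]
            field_simp [hh.1.ne']
          have e4 : dirS (h • b 2 + planeVec b w) = gnomonic b (h⁻¹ • w) := by
            rw [e3, dirS_smul _ (mul_pos hh.1 (norm_pos_iff.2 (add_planeVec_ne_zero _ _)))]
          rw [inner_add_planeVec, e4]
          exact ⟨fun H => H.2, fun H => ⟨hh, H⟩⟩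
        rw [e2, e]
        congr 2
        simp
      · refine measure_mono_null (t := ∅) ?_ measure_empty
        intro w hw
        have hw' : 0 < inner ℝ (b 2) (h • b 2 + planeVec b w) ∧
            inner ℝ (b 2) (h • b 2 + planeVec b w) < 1 := hw.1
        rw [inner_add_planeVec] at hw'
        exact hh hw'
    simp_rw [this]
    rw [lintegral_indicator measurableSet_Ioo, lintegral_mul_const _ (by fun_prop),
      ← ofReal_integral_eq_lintegral_ofReal, ← integral_Ioc_eq_integral_Ioo,
      ← intervalIntegral.integral_of_le (by norm_num), integral_pow]
    · norm_num
    · exact ((continuous_pow 2).integrableOn_Icc).mono_set Ioo_subset_Icc_self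
    · exact Eventually.of_forall fun x => sq_nonneg x
  rw [Measure.map_apply (measurable_gnomonic b) hs, withDensity_apply _ hs]
  have h3 := h2.symm.trans h1
  exact (ENNReal.mul_right_inj (by norm_num) ENNReal.ofReal_ne_top).1 h3

/-- Integration over a hemisphere in the gnomonic chart. -/
theorem integral_sphere_eq_integral_gnomonic {f : S2 → ℂ} (hf : Measurable f)
    (h0 : ∀ y : S2, inner ℝ (b 2) (y : E3) ≤ 0 → f y = 0) :
    ∫ y, f y ∂sphereMeasure = ∫ w, ((√(1 + w.1 ^ 2 + w.2 ^ 2))⁻¹ ^ 3) • f (gnomonic b w) := by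
  set g : S2 → ℂ := fun y => (inner ℝ (b 2) (y : E3) ^ 3) • f y with hg
  have hgm : Measurable g := by
    have : Measurable fun y : S2 => inner ℝ (b 2) (y : E3) ^ 3 := by fun_prop
    exact this.smul hf
  have h1 : ∫ w, g (gnomonic b w) = ∫ y, g y ∂((volume : Measure (ℝ × ℝ)).map (gnomonic b)) :=
    (integral_map (measurable_gnomonic b).aemeasurable hgm.aestronglyMeasurable).symm
  rw [map_gnomonic, integral_withDensity_eq_integral_toReal_smul (by fun_prop)
    (Eventually.of_forall fun _ => ENNReal.ofReal_lt_top)] at h1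
  simp only [hg, inner_gnomonic] at h1
  rw [h1]
  refine integral_congr_ae (Eventually.of_forall fun y => ?_)
  simp only
  rcases le_or_gt (inner ℝ (b 2) (y : E3)) 0 with h | h
  · rw [h0 y h]; simp
  · rw [ENNReal.toReal_ofReal (by positivity), smul_smul, inv_mul_cancel₀ (by positivity), one_smul]

/-- The unit vectors in the plane of the first two basis vectors. -/
def circleVec (φ : ℝ) : E3 := Real.cos φ • b 0 + Real.sin φ • b 1

/-- Integration over a hemisphere in scaled geodesic polar coordinates. -/
theorem integral_sphere_eq_integral_polar {f : S2 → ℂ} (hf : Measurable f)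
    (h0 : ∀ y : S2, inner ℝ (b 2) (y : E3) ≤ 0 → f y = 0) {ε : ℝ} (hε : 0 < ε) :
    ∫ y, f y ∂sphereMeasure = ∫ p in Ioi (0 : ℝ) ×ˢ Ioo (-Real.pi) Real.pi,
      (p.1 * ε ^ 2 * (√(1 + (ε * p.1) ^ 2))⁻¹ ^ 3) •
        f (dirS (b 2 + (ε * p.1) • circleVec b p.2)) := by
  rw [integral_sphere_eq_integral_gnomonic b hf h0]
  have h1 := Measure.integral_comp_smul (volume : Measure (ℝ × ℝ))
    (fun w => ((√(1 + w.1 ^ 2 + w.2 ^ 2))⁻¹ ^ 3) • f (gnomonic b w)) ε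
  have h2 : ∀ z : ℂ, ε ^ 2 • |(ε ^ Module.finrank ℝ (ℝ × ℝ))⁻¹| • z = z := by
    intro z
    simp [abs_of_pos hε, hε.ne']
  rw [← h2 (∫ w, _), ← h1, ← integral_comp_polarCoord_symm, ← integral_smul]
  refine integral_congr_ae (Eventually.of_forall fun p => ?_)
  simp only [polarCoord_symm_apply, Prod.smul_fst, Prod.smul_snd, smul_eq_mul]
  have h3 : 1 + (ε * (p.1 * Real.cos p.2)) ^ 2 + (ε * (p.1 * Real.sin p.2)) ^ 2 =
      1 + (ε * p.1) ^ 2 := by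
    have := Real.sin_sq_add_cos_sq p.2
    linear_combination (ε * p.1) ^ 2 * this
  have h4 : gnomonic b (ε • (p.1 * Real.cos p.2, p.1 * Real.sin p.2)) =
      dirS (b 2 + (ε * p.1) • circleVec b p.2) := by
    rw [gnomonic, planeVec, circleVec]
    simp only [Prod.smul_fst, Prod.smul_snd, smul_eq_mul, smul_add, smul_smul, mul_assoc]
  rw [h3, h4, smul_smul, smul_smul]
  congr 1
  ring

end Gnomonic

/-! ### Integrals of the limiting velocity profiles over successive parameters. -/

section Weights

theorem setIntegral_paramWedge {h : ℝ × ℝ → ℝ} (hint : IntegrableOn h paramWedge) :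
    ∫ w in paramWedge, h w = ∫ u in Ioi (0 : ℝ), ∫ v in Ioi u, h (u, v) := by
  classical
  rw [← integral_indicator measurableSet_paramWedge, Measure.volume_eq_prod,
    integral_prod _ ((integrable_indicator_iff measurableSet_paramWedge).2 hint),
    ← integral_indicator measurableSet_Ioi]
  refine integral_congr_ae (Eventually.of_forall fun u => ?_)
  simp only [indicator_apply, mem_Ioi]
  split_ifs with hu
  · rw [← integral_indicator measurableSet_Ioi]
    refine integral_congr_ae (Eventually.of_forall fun v => ?_)
    simp only [indicator_apply, mem_Ioi]
    have : (u, v) ∈ paramWedge ↔ u < v := ⟨fun h => h.2, fun h => ⟨hu, h⟩⟩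
    simp only [this]
  · have : ∀ v, (u, v) ∉ paramWedge := fun v h => hu h.1
    simp [this]

/-- The tangential component of the limit of the velocities of short geodesics. -/
def tangentWeight (u : ℝ) : ℝ := 2 * u * ((1 + u ^ 2) ^ 2)⁻¹

/-- The normal component of the limit of the velocities of short geodesics. -/
def normalWeight (u : ℝ) : ℝ := (u ^ 2 - 1) * ((1 + u ^ 2) ^ 2)⁻¹

theorem abs_tangentWeight_le (u : ℝ) : |tangentWeight u| ≤ (1 + u ^ 2)⁻¹ := by
  have h : |2 * u| ≤ 1 + u ^ 2 := by
    rw [abs_le]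
    constructor <;> nlinarith [sq_nonneg (u - 1), sq_nonneg (u + 1)]
  have h0 : 0 < 1 + u ^ 2 := by positivity
  rw [tangentWeight, abs_mul, abs_of_pos (inv_pos.2 (pow_pos h0 2))]
  calc _ ≤ (1 + u ^ 2) * ((1 + u ^ 2) ^ 2)⁻¹ := by gcongr
    _ = _ := by field_simp

theorem abs_normalWeight_le (u : ℝ) : |normalWeight u| ≤ (1 + u ^ 2)⁻¹ := by
  have h : |u ^ 2 - 1| ≤ 1 + u ^ 2 := by
    rw [abs_le]
    constructor <;> nlinarith [sq_nonneg u]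
  have h0 : 0 < 1 + u ^ 2 := by positivity
  rw [normalWeight, abs_mul, abs_of_pos (inv_pos.2 (pow_pos h0 2))]
  calc _ ≤ (1 + u ^ 2) * ((1 + u ^ 2) ^ 2)⁻¹ := by gcongr
    _ = _ := by field_simp

theorem measurable_tangentWeight : Measurable tangentWeight := by unfold tangentWeight; fun_prop

theorem measurable_normalWeight : Measurable normalWeight := by unfold normalWeight; fun_prop

theorem integrable_of_abs_le {f : ℝ → ℝ} (hf : Measurable f)
    (h : ∀ u, |f u| ≤ (1 + u ^ 2)⁻¹) : Integrable f :=
  integrable_inv_one_add_sq.mono' hf.aestronglyMeasurable (Eventually.of_forall h)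

theorem integrable_mul_of_abs_le {f g : ℝ → ℝ} (hf : Measurable f) (hg : Measurable g)
    (h : ∀ u, |f u| ≤ (1 + u ^ 2)⁻¹) (h' : ∀ u, |g u| ≤ (1 + u ^ 2)⁻¹) :
    Integrable (fun w : ℝ × ℝ => f w.1 * g w.2) :=
  (integrable_of_abs_le hf h).mul_prod (integrable_of_abs_le hg h')

theorem hasDerivAt_neg_inv_one_add_sq (u : ℝ) :
    HasDerivAt (fun u : ℝ => -(1 + u ^ 2)⁻¹) (tangentWeight u) u := by
  have h := (((hasDerivAt_pow 2 u).const_add 1).inv (by positivity)).neg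
  refine h.congr_deriv ?_
  rw [tangentWeight]
  simp
  ring

theorem hasDerivAt_neg_mul_inv_one_add_sq (u : ℝ) :
    HasDerivAt (fun u : ℝ => -(u * (1 + u ^ 2)⁻¹)) (normalWeight u) u := by
  have h := ((hasDerivAt_id u).mul (((hasDerivAt_pow 2 u).const_add 1).inv (by positivity))).neg
  refine h.congr_deriv ?_
  rw [normalWeight]
  simp
  field_simp
  ring

theorem tendsto_inv_one_add_sq : Tendsto (fun u : ℝ => (1 + u ^ 2)⁻¹) atTop (𝓝 0) :=
  (tendsto_atTop_add_const_left _ 1 (tendsto_pow_atTop two_ne_zero)).inv_tendsto_atTop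

theorem tendsto_mul_inv_one_add_sq : Tendsto (fun u : ℝ => u * (1 + u ^ 2)⁻¹) atTop (𝓝 0) := by
  refine squeeze_zero' (g := fun u : ℝ => u⁻¹) ?_ ?_ tendsto_inv_atTop_zero
  · filter_upwards [eventually_gt_atTop 0] with u hu
    positivity
  · filter_upwards [eventually_gt_atTop 0] with u hu
    rw [mul_inv_le_iff₀ (by positivity), inv_mul_eq_div, le_div_iff₀ hu]
    nlinarith

theorem integral_Ioi_tangentWeight (u : ℝ) : ∫ v in Ioi u, tangentWeight v = (1 + u ^ 2)⁻¹ := by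
  rw [integral_Ioi_of_hasDerivAt_of_tendsto' (fun v _ => hasDerivAt_neg_inv_one_add_sq v)
    (integrable_of_abs_le measurable_tangentWeight abs_tangentWeight_le).integrableOn
    tendsto_inv_one_add_sq.neg]
  ring

theorem integral_Ioi_normalWeight (u : ℝ) :
    ∫ v in Ioi u, normalWeight v = u * (1 + u ^ 2)⁻¹ := by
  rw [integral_Ioi_of_hasDerivAt_of_tendsto' (fun v _ => hasDerivAt_neg_mul_inv_one_add_sq v)
    (integrable_of_abs_le measurable_normalWeight abs_normalWeight_le).integrableOn
    tendsto_mul_inv_one_add_sq.neg]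
  ring

/-- Half the square of the total integral of the weight, which is 1: the integrand left after the
inner integration is an exact derivative. -/
theorem integral_tangentWeight_mul_tangentWeight :
    ∫ w in paramWedge, tangentWeight w.1 * tangentWeight w.2 = 1 / 2 := by
  have hm := measurable_tangentWeight
  rw [setIntegral_paramWedge (integrable_mul_of_abs_le hm hm abs_tangentWeight_le
    abs_tangentWeight_le).integrableOn]
  simp only [integral_const_mul, integral_Ioi_tangentWeight]
  have hd : ∀ u ∈ Ici (0 : ℝ), HasDerivAt (fun u : ℝ => -((1 + u ^ 2)⁻¹ ^ 2 / 2))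
      (tangentWeight u * (1 + u ^ 2)⁻¹) u := by
    intro u _
    refine (((hasDerivAt_neg_inv_one_add_sq u).pow 2).div_const 2).neg.congr_deriv
      ?_ |>.congr_of_eventuallyEq ?_
    · simp
      ring
    · exact Eventually.of_forall fun u => by simp
  have hi : Integrable (fun u : ℝ => tangentWeight u * (1 + u ^ 2)⁻¹) := by
    refine integrable_of_abs_le (hm.mul (by fun_prop)) fun u => ?_
    have h0 : (1 + u ^ 2)⁻¹ ≤ 1 := inv_le_one_of_one_le₀ (by nlinarith [sq_nonneg u])
    rw [abs_mul, abs_of_pos (by positivity : 0 < (1 + u ^ 2)⁻¹)]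
    calc _ ≤ (1 + u ^ 2)⁻¹ * 1 := by
          gcongr
          exact abs_tangentWeight_le u
      _ = _ := mul_one _
  have ht : Tendsto (fun u : ℝ => -((1 + u ^ 2)⁻¹ ^ 2 / 2)) atTop (𝓝 (-(0 ^ 2 / 2))) :=
    ((tendsto_inv_one_add_sq.pow 2).div_const 2).neg
  rw [integral_Ioi_of_hasDerivAt_of_tendsto' hd hi.integrableOn ht]
  norm_num

/-- Again half the square of the total integral, now 0 because u/(1 + u²) vanishes at both ends: a
short geodesic starts and ends on the sphere. This removes the normal-normal term. -/
theorem integral_normalWeight_mul_normalWeight :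
    ∫ w in paramWedge, normalWeight w.1 * normalWeight w.2 = 0 := by
  have hm := measurable_normalWeight
  rw [setIntegral_paramWedge (integrable_mul_of_abs_le hm hm abs_normalWeight_le
    abs_normalWeight_le).integrableOn]
  simp only [integral_const_mul, integral_Ioi_normalWeight]
  have hd : ∀ u ∈ Ici (0 : ℝ), HasDerivAt (fun u : ℝ => -((u * (1 + u ^ 2)⁻¹) ^ 2 / 2))
      (normalWeight u * (u * (1 + u ^ 2)⁻¹)) u := by
    intro u _
    refine (((hasDerivAt_neg_mul_inv_one_add_sq u).pow 2).div_const 2).neg.congr_deriv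
      ?_ |>.congr_of_eventuallyEq ?_
    · simp
      ring
    · exact Eventually.of_forall fun u => by simp
  have hi : Integrable (fun u : ℝ => normalWeight u * (u * (1 + u ^ 2)⁻¹)) := by
    refine integrable_of_abs_le (hm.mul (by fun_prop)) fun u => ?_
    have h0 : |u * (1 + u ^ 2)⁻¹| ≤ 1 := by
      rw [abs_mul, abs_of_pos (by positivity : 0 < (1 + u ^ 2)⁻¹), mul_inv_le_iff₀ (by positivity),
        abs_le]
      constructor <;> nlinarith [sq_nonneg (u - 1), sq_nonneg (u + 1)]
    rw [abs_mul]
    calc _ ≤ (1 + u ^ 2)⁻¹ * 1 := by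
          gcongr
          exact abs_normalWeight_le u
      _ = _ := mul_one _
  have ht : Tendsto (fun u : ℝ => -((u * (1 + u ^ 2)⁻¹) ^ 2 / 2)) atTop (𝓝 (-(0 ^ 2 / 2))) :=
    ((tendsto_mul_inv_one_add_sq.pow 2).div_const 2).neg
  rw [integral_Ioi_of_hasDerivAt_of_tendsto' hd hi.integrableOn ht]
  norm_num

/-- The integral over the wedge of the limit of `fiberIntegrand`. -/
theorem integral_weights (A A' B B' : ℂ) :
    ∫ w in paramWedge, ((tangentWeight w.1 : ℂ) * A + (normalWeight w.1 : ℂ) * A') *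
        ((tangentWeight w.2 : ℂ) * B + (normalWeight w.2 : ℂ) * B') =
      1 / 2 * (A * B) +
      (∫ w in paramWedge, tangentWeight w.1 * normalWeight w.2 : ℝ) * (A * B') +
      (∫ w in paramWedge, normalWeight w.1 * tangentWeight w.2 : ℝ) * (A' * B) := by
  have hm := measurable_tangentWeight
  have hm' := measurable_normalWeight
  have key : ∀ {f g : ℝ → ℝ}, Measurable f → Measurable g → (∀ u, |f u| ≤ (1 + u ^ 2)⁻¹) →
      (∀ u, |g u| ≤ (1 + u ^ 2)⁻¹) → ∀ z : ℂ,
      Integrable (fun w : ℝ × ℝ => ((f w.1 * g w.2 : ℝ) : ℂ) * z) (volume.restrict paramWedge) ∧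
      ∫ w in paramWedge, ((f w.1 * g w.2 : ℝ) : ℂ) * z =
        (∫ w in paramWedge, f w.1 * g w.2 : ℝ) * z := by
    intro f g hf hg hf' hg' z
    refine ⟨(integrable_mul_of_abs_le hf hg hf' hg').ofReal.integrableOn.mul_const z, ?_⟩
    rw [integral_mul_const]
    congr 1
    exact integral_ofReal
  obtain ⟨i1, e1⟩ := key hm hm abs_tangentWeight_le abs_tangentWeight_le (A * B)
  obtain ⟨i2, e2⟩ := key hm hm' abs_tangentWeight_le abs_normalWeight_le (A * B')
  obtain ⟨i3, e3⟩ := key hm' hm abs_normalWeight_le abs_tangentWeight_le (A' * B)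
  obtain ⟨i4, e4⟩ := key hm' hm' abs_normalWeight_le abs_normalWeight_le (A' * B')
  have e : ∀ w : ℝ × ℝ, ((tangentWeight w.1 : ℂ) * A + (normalWeight w.1 : ℂ) * A') *
        ((tangentWeight w.2 : ℂ) * B + (normalWeight w.2 : ℂ) * B') =
      ((tangentWeight w.1 * tangentWeight w.2 : ℝ) : ℂ) * (A * B) +
      ((tangentWeight w.1 * normalWeight w.2 : ℝ) : ℂ) * (A * B') +
      ((normalWeight w.1 * tangentWeight w.2 : ℝ) : ℂ) * (A' * B) +
      ((normalWeight w.1 * normalWeight w.2 : ℝ) : ℂ) * (A' * B') := by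
    intro w
    push_cast
    ring
  simp only [e]
  have sum : ∀ {g₁ g₂ g₃ g₄ : ℝ × ℝ → ℂ} {μ : Measure (ℝ × ℝ)}, Integrable g₁ μ →
      Integrable g₂ μ → Integrable g₃ μ → Integrable g₄ μ →
      ∫ w, g₁ w + g₂ w + g₃ w + g₄ w ∂μ =
        ∫ w, g₁ w ∂μ + ∫ w, g₂ w ∂μ + ∫ w, g₃ w ∂μ + ∫ w, g₄ w ∂μ := by
    intro g₁ g₂ g₃ g₄ μ h₁ h₂ h₃ h₄
    have h₁₂ : Integrable (fun w => g₁ w + g₂ w) μ := h₁.add h₂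
    have h₁₂₃ : Integrable (fun w => g₁ w + g₂ w + g₃ w) μ := h₁₂.add h₃
    rw [integral_add h₁₂₃ h₄, integral_add h₁₂ h₃, integral_add h₁ h₂]
  rw [sum i1 i2 i3 i4, e1, e2, e3, e4, integral_tangentWeight_mul_tangentWeight,
    integral_normalWeight_mul_normalWeight]
  push_cast
  ring

end Weights

/-! ### Asymptotics of the fiber integral for short geodesics. -/

section LocalLimits

/-- Rescaled fiber integrals along a family of points approaching `x` with velocity `τ`. -/
theorem tendsto_fiberIntegral {a b : E3 → E3 →L[ℝ] ℂ} (hac : Continuous a) (hbc : Continuous b)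
    {C : ℝ} (ha : ∀ x, ‖a x‖ ≤ C) (hb : ∀ x, ‖b x‖ ≤ C) {x : S2} {y : ℝ → S2} {τ : E3}
    (hy : Tendsto (fun ε : ℝ => ε⁻¹ • ((y ε : E3) - x)) (𝓝[>] 0) (𝓝 τ)) :
    Tendsto (fun ε : ℝ => ((ε : ℂ) ^ 2)⁻¹ * fiberIntegral a b x (y ε)) (𝓝[>] 0)
      (𝓝 (1 / 2 * (a x τ * b x τ) +
        (∫ w in paramWedge, tangentWeight w.1 * normalWeight w.2 : ℝ) *
          (a x τ * (‖τ‖ * b x x)) +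
        (∫ w in paramWedge, normalWeight w.1 * tangentWeight w.2 : ℝ) *
          (‖τ‖ * a x x * b x τ))) := by
  rw [← integral_weights]
  simp only [fiberIntegral, ← integral_const_mul]
  have hε0 : Tendsto (fun ε : ℝ => ε) (𝓝[>] 0) (𝓝 0) :=
    tendsto_nhdsWithin_of_tendsto_nhds tendsto_id
  have hpos : ∀ᶠ ε : ℝ in 𝓝[>] 0, 0 < ε := self_mem_nhdsWithin
  have hd : Tendsto (fun ε : ℝ => (y ε : E3) - x) (𝓝[>] 0) (𝓝 0) := by
    have := hε0.smul hy
    rw [zero_smul] at this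
    refine this.congr' ?_
    filter_upwards [hpos] with ε hε
    rw [smul_inv_smul₀ hε.ne']
  have hyx : Tendsto (fun ε : ℝ => (y ε : E3)) (𝓝[>] 0) (𝓝 x) := by
    simpa using hd.add_const (x : E3)
  have hc : Tendsto (fun ε : ℝ => ‖(x : E3) - y ε‖) (𝓝[>] 0) (𝓝 0) := by
    have := hd.norm
    simpa [norm_sub_rev] using this
  have hcε : Tendsto (fun ε : ℝ => ε⁻¹ * ‖(x : E3) - y ε‖) (𝓝[>] 0) (𝓝 ‖τ‖) := by
    refine hy.norm.congr' ?_
    filter_upwards [hpos] with ε hε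
    rw [norm_smul, norm_sub_rev, Real.norm_of_nonneg (inv_pos.2 hε).le]
  have hgeo : ∀ u : ℝ, Tendsto (fun ε : ℝ => geo x (y ε) u) (𝓝[>] 0) (𝓝 x) := by
    intro u
    have h1 : Tendsto (fun ε : ℝ => 1 + ‖(x : E3) - y ε‖ * u + u ^ 2) (𝓝[>] 0)
        (𝓝 (1 + u ^ 2)) := by simpa using ((hc.mul_const u).const_add 1).add_const (u ^ 2)
    have h2 := (h1.inv₀ (by positivity)).smul ((hyx.const_smul (u ^ 2)).const_add (x : E3))
    have e : (x : E3) + u ^ 2 • (x : E3) = (1 + u ^ 2) • (x : E3) := by module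
    rw [e, inv_smul_smul₀ (by positivity)] at h2
    exact h2
  have hder : ∀ u : ℝ, Tendsto (fun ε : ℝ => ε⁻¹ • geoDeriv x (y ε) u) (𝓝[>] 0)
      (𝓝 (tangentWeight u • τ + normalWeight u • ‖τ‖ • (x : E3))) := by
    intro u
    have h1 : Tendsto (fun ε : ℝ => (1 + ‖(x : E3) - y ε‖ * u + u ^ 2) ^ 2) (𝓝[>] 0)
        (𝓝 ((1 + u ^ 2) ^ 2)) := by
      simpa using (((hc.mul_const u).const_add 1).add_const (u ^ 2)).pow 2
    have h2 := (h1.inv₀ (by positivity)).smul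
      ((hy.const_smul (2 * u)).add (hcε.smul ((hyx.const_smul (u ^ 2)).sub_const (x : E3))))
    have e : ((1 + u ^ 2) ^ 2)⁻¹ •
        ((2 * u) • τ + ‖τ‖ • (u ^ 2 • (x : E3) - x)) =
        tangentWeight u • τ + normalWeight u • ‖τ‖ • (x : E3) := by
      rw [tangentWeight, normalWeight]
      module
    rw [e] at h2
    refine h2.congr fun ε => ?_
    rw [geoDeriv]
    module
  have hval : ∀ {a : E3 → E3 →L[ℝ] ℂ}, Continuous a → ∀ u : ℝ,
      Tendsto (fun ε : ℝ => (ε : ℂ)⁻¹ * a (geo x (y ε) u) (geoDeriv x (y ε) u)) (𝓝[>] 0)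
        (𝓝 ((tangentWeight u : ℂ) * a x τ + (normalWeight u : ℂ) * (‖τ‖ * a x x))) := by
    intro a hac u
    have h0 : Continuous fun q : E3 × E3 => a q.1 q.2 :=
      (hac.comp continuous_fst).clm_apply continuous_snd
    have h1 := (h0.tendsto _).comp ((hgeo u).prodMk_nhds (hder u))
    simp only [Function.comp_def, map_add, map_smul, Complex.real_smul, Complex.ofReal_inv] at h1
    exact h1
  -- The domination: the integrand is at most C²|x − y|² times a fixed integrable weight, and |x −
  -- y|/ε stays below ‖τ‖ + 1 for small ε.
  have hbd : ∀ᶠ ε : ℝ in 𝓝[>] 0, ε⁻¹ * ‖(x : E3) - y ε‖ ≤ ‖τ‖ + 1 :=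
    hcε.eventually_le_const (lt_add_one _)
  refine tendsto_integral_filter_of_dominated_convergence
    (fun w => C ^ 2 * (‖τ‖ + 1) ^ 2 * ((1 + w.1 ^ 2)⁻¹ * (1 + w.2 ^ 2)⁻¹)) ?_ ?_
    (integrable_wedgeWeight.integrableOn.const_mul _) ?_
  · refine Eventually.of_forall fun ε => ?_
    have h := (measurable_fiberIntegrand hac hbc).comp
      (measurable_const.prodMk measurable_id : Measurable fun w : ℝ × ℝ => ((x, y ε), w))
    exact (h.const_mul _).aestronglyMeasurable
  · filter_upwards [hpos, hbd] with ε hε hεb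
    refine ae_restrict_of_forall_mem measurableSet_paramWedge fun w hw => ?_
    have h := norm_fiberIntegrand_le ha hb (norm_coe_sphere x) (norm_coe_sphere (y ε)) hw
    rw [norm_mul, norm_inv, norm_pow, Complex.norm_real, Real.norm_of_nonneg hε.le]
    calc _ ≤ (ε ^ 2)⁻¹ * (C ^ 2 * ‖(x : E3) - y ε‖ ^ 2 *
          ((1 + w.1 ^ 2)⁻¹ * (1 + w.2 ^ 2)⁻¹)) := by gcongr
      _ = C ^ 2 * (ε⁻¹ * ‖(x : E3) - y ε‖) ^ 2 * ((1 + w.1 ^ 2)⁻¹ * (1 + w.2 ^ 2)⁻¹) := by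
        ring
      _ ≤ _ := by gcongr
  · refine Eventually.of_forall fun w => ?_
    refine ((hval hac w.1).mul (hval hbc w.2)).congr fun ε => ?_
    rw [fiberIntegrand]
    ring

end LocalLimits

/-! ### The rescaled cutoffs in polar coordinates around a point. -/

section Cutoff

variable (b : OrthonormalBasis (Fin 3) ℝ E3)

theorem smul_circleVec (t φ : ℝ) :
    t • circleVec b φ = planeVec b (t * Real.cos φ, t * Real.sin φ) := by
  rw [circleVec, planeVec]
  module

theorem norm_circleVec (φ : ℝ) : ‖circleVec b φ‖ = 1 := by
  have h := norm_planeVec_sq b (1 * Real.cos φ, 1 * Real.sin φ)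
  rw [← smul_circleVec, one_smul, one_mul, one_mul, Real.cos_sq_add_sin_sq] at h
  exact (pow_eq_one_iff_of_nonneg (norm_nonneg _) two_ne_zero).1 h

theorem inner_circleVec (φ : ℝ) : inner ℝ (b 2) (circleVec b φ) = 0 := by
  rw [← one_smul ℝ (circleVec b φ), smul_circleVec, inner_planeVec]

/-- The point of the unit sphere at distance `arctan t` from `b 2` in the direction `φ`. -/
def polarPoint (t φ : ℝ) : S2 := dirS (b 2 + t • circleVec b φ)

theorem polarPoint_eq_gnomonic (t φ : ℝ) :
    polarPoint b t φ = gnomonic b (t * Real.cos φ, t * Real.sin φ) := by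
  rw [polarPoint, smul_circleVec, gnomonic]

theorem measurable_polarPoint (ε : ℝ) :
    Measurable fun p : ℝ × ℝ => polarPoint b (ε * p.1) p.2 := by
  simp only [polarPoint_eq_gnomonic]
  exact (measurable_gnomonic b).comp (by fun_prop)

theorem add_smul_circleVec_ne_zero (t φ : ℝ) : b 2 + t • circleVec b φ ≠ 0 := by
  rw [smul_circleVec]
  exact add_planeVec_ne_zero b _

theorem inner_polarPoint (t φ : ℝ) :
    inner ℝ (b 2) (polarPoint b t φ : E3) = (√(1 + t ^ 2))⁻¹ := by
  rw [polarPoint_eq_gnomonic, inner_gnomonic]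
  congr 2
  linear_combination t ^ 2 * Real.cos_sq_add_sin_sq φ

theorem angle_polarPoint {t : ℝ} (ht : 0 ≤ t) (φ : ℝ) :
    InnerProductGeometry.angle (b 2) (polarPoint b t φ : E3) = Real.arctan t := by
  have h0 := add_smul_circleVec_ne_zero b t φ
  rw [polarPoint, coe_dirS h0, dir,
    InnerProductGeometry.angle_smul_right_of_pos _ _ (inv_pos.2 (norm_pos_iff.2 h0)),
    InnerProductGeometry.angle_add_eq_arctan_of_inner_eq_zero, norm_smul, norm_circleVec,
    b.norm_eq_one, Real.norm_of_nonneg ht, mul_one, div_one]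
  · rw [inner_smul_right, inner_circleVec, mul_zero]
  · rw [← norm_pos_iff, b.norm_eq_one]
    exact one_pos

/-- At the unit vector `b 2` the derivative of `dir` is the projection to the tangent plane, which
fixes the circle vector. -/
theorem tendsto_polarPoint_velocity (r φ : ℝ) :
    Tendsto (fun ε : ℝ => ε⁻¹ • ((polarPoint b (ε * r) φ : E3) - b 2)) (𝓝[>] 0)
      (𝓝 (r • circleVec b φ)) := by
  have h2 : b 2 ≠ 0 := by
    rw [← norm_pos_iff, b.norm_eq_one]
    exact one_pos
  have hline : HasDerivAt (fun ε : ℝ => b 2 + (ε * r) • circleVec b φ) (r • circleVec b φ) 0 := by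
    have h := (((hasDerivAt_id (0 : ℝ)).mul_const r).smul_const (circleVec b φ)).const_add (b 2)
    simpa using h
  have hd : HasDerivAt (fun ε : ℝ => dir (b 2 + (ε * r) • circleVec b φ))
      (r • circleVec b φ) 0 := by
    have h0 : b 2 + ((0 : ℝ) * r) • circleVec b φ = b 2 := by simp
    have h := (hasFDerivAt_dir (p := b 2 + ((0 : ℝ) * r) • circleVec b φ)
      (by rwa [h0])).comp_hasDerivAt (0 : ℝ) hline
    refine h.congr_deriv ?_
    have hdir : dir (b 2) = b 2 := by rw [dir, b.norm_eq_one, inv_one, one_smul]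
    rw [h0, dirDeriv_apply, hdir, b.norm_eq_one, inner_smul_right, inner_circleVec]
    simp
  have h := hd.tendsto_slope_zero_right
  refine h.congr fun ε => ?_
  rw [polarPoint, coe_dirS (add_smul_circleVec_ne_zero b _ _), zero_add, zero_mul, zero_smul,
    add_zero]
  congr 2
  rw [dir, b.norm_eq_one, inv_one, one_smul]

variable {b} {x : S2}

theorem tendsto_polarPoint (hx : b 2 = x) (r φ : ℝ) :
    Tendsto (fun ε : ℝ => polarPoint b (ε * r) φ) (𝓝[>] 0) (𝓝 x) := by
  rw [tendsto_subtype_rng]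
  have hε0 : Tendsto (fun ε : ℝ => ε) (𝓝[>] 0) (𝓝 0) :=
    tendsto_nhdsWithin_of_tendsto_nhds tendsto_id
  have h := (hε0.smul (tendsto_polarPoint_velocity b r φ)).add_const (b 2)
  rw [zero_smul, zero_add, hx] at h
  refine h.congr' ?_
  filter_upwards [self_mem_nhdsWithin] with ε hε
  rw [smul_inv_smul₀ (ne_of_gt hε), sub_add_cancel]

/-- The limit of the rescaled cutoff at `x` at distance `r`. -/
def stepDiff (l₁ l₂ r : ℝ) : ℝ := (if r ≤ l₁ then 0 else 1) - (if r ≤ l₂ then 0 else 1)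

/-- After division by ε the distance arctan(εr) tends to r and the mean of the two radii tends to
ℓ(x). Away from the jump r = ℓ x the strict inequality persists, so the cutoff is eventually
constant. -/
theorem tendsto_Theta (hx : b 2 = x) {ℓ : S2 → ℝ} (hc : Continuous ℓ) {r : ℝ} (hr : 0 < r)
    (hrℓ : r ≠ ℓ x) (φ : ℝ) :
    Tendsto (fun ε : ℝ => Theta (fun z => ε * ℓ z) (x, polarPoint b (ε * r) φ)) (𝓝[>] 0)
      (𝓝 (if r ≤ ℓ x then 0 else 1)) := by
  have hang : Tendsto (fun ε : ℝ => ε⁻¹ * Real.arctan (ε * r)) (𝓝[>] 0) (𝓝 r) := by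
    have h : HasDerivAt (fun ε : ℝ => Real.arctan (ε * r)) r 0 := by
      have := (Real.hasDerivAt_arctan (0 * r)).comp (0 : ℝ) ((hasDerivAt_id (0 : ℝ)).mul_const r)
      simpa [Function.comp_def] using this
    simpa using h.tendsto_slope_zero_right
  have hℓ : Tendsto (fun ε : ℝ => (ℓ x + ℓ (polarPoint b (ε * r) φ)) / 2) (𝓝[>] 0)
      (𝓝 (ℓ x)) := by
    have := (((hc.tendsto x).comp (tendsto_polarPoint hx r φ)).const_add (ℓ x)).div_const 2
    rwa [add_self_div_two] at this
  have hiff : ∀ ε : ℝ, 0 < ε → (InnerProductGeometry.angle (x : E3) (polarPoint b (ε * r) φ) ≤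
      (ε * ℓ x + ε * ℓ (polarPoint b (ε * r) φ)) / 2 ↔
      ε⁻¹ * Real.arctan (ε * r) ≤ (ℓ x + ℓ (polarPoint b (ε * r) φ)) / 2) := by
    intro ε hε
    rw [← hx, angle_polarPoint b (by positivity), inv_mul_le_iff₀ hε, ← mul_add, mul_div_assoc]
  refine tendsto_const_nhds.congr' ?_
  rcases hrℓ.lt_or_gt with h | h
  · filter_upwards [hang.eventually_lt hℓ h, self_mem_nhdsWithin] with ε h1 hε
    rw [Theta, if_pos ((hiff ε hε).2 h1.le), if_pos h.le]
  · filter_upwards [hℓ.eventually_lt hang h, self_mem_nhdsWithin] with ε h1 hε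
    rw [Theta, if_neg fun h2 => not_le.2 h1 ((hiff ε hε).1 h2), if_neg (not_le.2 h)]

theorem tendsto_cutoffDiff (hx : b 2 = x) {ℓ₁ ℓ₂ : S2 → ℝ} (hc₁ : Continuous ℓ₁)
    (hc₂ : Continuous ℓ₂) {r : ℝ} (hr : 0 < r) (h₁ : r ≠ ℓ₁ x) (h₂ : r ≠ ℓ₂ x) (φ : ℝ) :
    Tendsto (fun ε : ℝ => cutoffDiff ℓ₁ ℓ₂ ε x (polarPoint b (ε * r) φ)) (𝓝[>] 0)
      (𝓝 (stepDiff (ℓ₁ x) (ℓ₂ x) r : ℂ)) := by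
  have h := (tendsto_Theta hx hc₁ hr h₁ φ).sub (tendsto_Theta hx hc₂ hr h₂ φ)
  have e : (stepDiff (ℓ₁ x) (ℓ₂ x) r : ℂ) =
      (if r ≤ ℓ₁ x then 0 else 1) - (if r ≤ ℓ₂ x then 0 else 1) := by
    rw [stepDiff]
    split_ifs <;> simp
  rw [e]
  exact h

/-- Here εr is the tangent of the spherical distance θ, so with θ ≤ εM the claim amounts to tan θ ≤
2θ for θ ≤ 1. It confines the rescaled radius to a bounded interval independent of ε. -/
theorem le_of_cutoffDiff_polarPoint_ne_zero (hx : b 2 = x) {ℓ₁ ℓ₂ : S2 → ℝ} {m M : ℝ}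
    (h₁ : ∀ z, m ≤ ℓ₁ z ∧ ℓ₁ z ≤ M) (h₂ : ∀ z, m ≤ ℓ₂ z ∧ ℓ₂ z ≤ M) {ε : ℝ} (hε : 0 < ε)
    (hεM : ε * M ≤ 1) {r φ : ℝ} (hr : 0 < r)
    (h : cutoffDiff ℓ₁ ℓ₂ ε x (polarPoint b (ε * r) φ) ≠ 0) : r ≤ 2 * M := by
  set θ := InnerProductGeometry.angle (x : E3) (polarPoint b (ε * r) φ) with hθ
  have hθM : θ ≤ ε * M := (cutoffDiff_ne_zero h₁ h₂ hε h).2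
  have hθ0 : 0 ≤ θ := InnerProductGeometry.angle_nonneg _ _
  have hcos : Real.cos θ = (√(1 + (ε * r) ^ 2))⁻¹ := by
    rw [hθ, InnerProductGeometry.cos_angle, norm_coe_sphere, norm_coe_sphere, ← hx,
      inner_polarPoint]
    simp
  have hle := Real.one_sub_sq_div_two_le_cos (x := θ)
  have hs0 : 0 < √(1 + (ε * r) ^ 2) := Real.sqrt_pos.2 (by positivity)
  have hs : √(1 + (ε * r) ^ 2) ^ 2 = 1 + (ε * r) ^ 2 := Real.sq_sqrt (by positivity)
  have hθ1 : θ ^ 2 ≤ 1 := by nlinarith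
  have h2 : 0 ≤ 1 - θ ^ 2 / 2 := by linarith
  have h3 : (1 - θ ^ 2 / 2) ^ 2 * (1 + (ε * r) ^ 2) ≤ 1 := by
    have : (1 - θ ^ 2 / 2) * √(1 + (ε * r) ^ 2) ≤ 1 := by
      rw [hcos] at hle
      calc _ ≤ (√(1 + (ε * r) ^ 2))⁻¹ * √(1 + (ε * r) ^ 2) := by gcongr
        _ = 1 := inv_mul_cancel₀ hs0.ne'
    rw [← hs, ← mul_pow]
    exact pow_le_one₀ (by positivity) this
  -- With s = θ² the difference of the two sides is s(3 − 15s/4 + s²), nonnegative for s ≤ 1.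
  -- Together with cos θ ≥ 1 − θ²/2 this bounds the tangent.
  have h4 : 1 ≤ (1 - θ ^ 2 / 2) ^ 2 * (1 + 4 * θ ^ 2) := by
    set s := θ ^ 2
    have hs' : 0 ≤ s := sq_nonneg θ
    have : 0 ≤ s * (3 - 15 / 4 * s + s ^ 2) := mul_nonneg hs' (by nlinarith)
    linarith
  have h5 : 0 < (1 - θ ^ 2 / 2) ^ 2 := by
    have : 0 < 1 - θ ^ 2 / 2 := by linarith
    positivity
  have h6 : (ε * r) ^ 2 ≤ (2 * θ) ^ 2 := by
    have := le_of_mul_le_mul_left (h3.trans h4) h5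
    linarith
  have h7 : ε * r ≤ 2 * θ := (sq_le_sq₀ (by positivity) (by positivity)).1 h6
  have h8 : ε * r ≤ ε * (2 * M) := by linarith
  exact le_of_mul_le_mul_left h8 hε

/-- The step difference is +1 on (l₁, l₂] and −1 on (l₂, l₁], one of which is empty. The sign of the
logarithm is thus handled without a case distinction. -/
theorem integral_stepDiff {l₁ l₂ : ℝ} (h₁ : 0 < l₁) (h₂ : 0 < l₂) :
    ∫ r in Ioi (0 : ℝ), stepDiff l₁ l₂ r * r⁻¹ = -Real.log (l₁ / l₂) := by
  classical
  have hint : ∀ {a b : ℝ}, 0 < a → IntegrableOn (fun r : ℝ => r⁻¹) (Ioc a b) := by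
    intro a b ha
    refine (ContinuousOn.integrableOn_Icc ?_).mono_set Ioc_subset_Icc_self
    exact continuousOn_inv₀.mono fun r hr => (ha.trans_le hr.1).ne'
  have e : ∀ r, stepDiff l₁ l₂ r * r⁻¹ =
      (Ioc l₁ l₂).indicator (fun r => r⁻¹) r - (Ioc l₂ l₁).indicator (fun r => r⁻¹) r := by
    intro r
    simp only [stepDiff, indicator_apply, mem_Ioc]
    split_ifs <;> first | (exfalso; grind) | simp
  have hsub : ∀ {a b : ℝ}, 0 < a → Ioc a b ∩ Ioi 0 = Ioc a b := fun ha =>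
    inter_eq_left.2 fun r hr => ha.trans hr.1
  simp only [e]
  rw [integral_sub, setIntegral_indicator measurableSet_Ioc,
    setIntegral_indicator measurableSet_Ioc, inter_comm, hsub h₁, inter_comm, hsub h₂]
  · rw [← intervalIntegral, integral_inv_of_pos h₁ h₂, ← Real.log_inv, inv_div]
  · exact ((integrable_indicator_iff measurableSet_Ioc).2 (hint h₁)).integrableOn
  · exact ((integrable_indicator_iff measurableSet_Ioc).2 (hint h₂)).integrableOn

end Cutoff

/-! ### The limit of the integral over the second endpoint. -/

section InnerLimit

theorem measurable_fiberIntegral {α β : E3 → E3 →L[ℝ] ℂ} (hα : Continuous α) (hβ : Continuous β) :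
    Measurable fun z : S2 × S2 => fiberIntegral α β z.1 z.2 := by
  have h := (measurable_fiberIntegrand hα hβ).stronglyMeasurable
  exact (StronglyMeasurable.integral_prod_right (ν := volume.restrict paramWedge)
    (f := fun (z : S2 × S2) w => fiberIntegrand α β z.1 z.2 w) h).measurable

/-- The integrand of the integral over the second endpoint. -/
def endpointIntegrand (ℓ₁ ℓ₂ : S2 → ℝ) (α β : E3 → E3 →L[ℝ] ℂ) (ε : ℝ) (x y : S2) : ℂ :=
  cutoffDiff ℓ₁ ℓ₂ ε x y * ((‖(x : E3) - y‖ : ℂ) ^ 4)⁻¹ * fiberIntegral α β x y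

theorem measurable_endpointIntegrand {ℓ₁ ℓ₂ : S2 → ℝ} (hc₁ : Continuous ℓ₁) (hc₂ : Continuous ℓ₂)
    {α β : E3 → E3 →L[ℝ] ℂ} (hα : Continuous α) (hβ : Continuous β) (ε : ℝ) (x : S2) :
    Measurable (endpointIntegrand ℓ₁ ℓ₂ α β ε x) := by
  have hp : Measurable fun y : S2 => (x, y) := measurable_prodMk_left
  have h1 := (measurable_cutoffDiff hc₁ hc₂ ε).comp hp
  have h2 : Measurable fun y : S2 => ((‖(x : E3) - y‖ : ℂ) ^ 4)⁻¹ := by fun_prop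
  have h3 := (measurable_fiberIntegral hα hβ).comp hp
  exact (h1.mul h2).mul h3

/-- The Jacobian of scaled polar coordinates on `S²`. -/
def polarJacobian (ε r : ℝ) : ℝ := r * ε ^ 2 * (√(1 + (ε * r) ^ 2))⁻¹ ^ 3

theorem abs_polarJacobian_le {ε r : ℝ} (hr : 0 ≤ r) : |polarJacobian ε r| ≤ r * ε ^ 2 := by
  have h1 : (√(1 + (ε * r) ^ 2))⁻¹ ≤ 1 :=
    inv_le_one_of_one_le₀ (Real.one_le_sqrt.2 (by nlinarith [sq_nonneg (ε * r)]))
  have h2 : 0 ≤ (√(1 + (ε * r) ^ 2))⁻¹ := by positivity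
  rw [polarJacobian, abs_of_nonneg (by positivity)]
  exact mul_le_of_le_one_right (by positivity) (pow_le_one₀ h2 h1)

theorem integral_endpointIntegrand (b : OrthonormalBasis (Fin 3) ℝ E3) {x : S2} (hx : b 2 = x)
    {ℓ₁ ℓ₂ : S2 → ℝ} (hc₁ : Continuous ℓ₁) (hc₂ : Continuous ℓ₂)
    {m M : ℝ} (h₁ : ∀ z, m ≤ ℓ₁ z ∧ ℓ₁ z ≤ M) (h₂ : ∀ z, m ≤ ℓ₂ z ∧ ℓ₂ z ≤ M)
    {α β : E3 → E3 →L[ℝ] ℂ} (hα : Continuous α) (hβ : Continuous β) {ε : ℝ} (hε : 0 < ε)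
    (hεM : ε * M ≤ 1) :
    ∫ y, endpointIntegrand ℓ₁ ℓ₂ α β ε x y ∂sphereMeasure =
      ∫ p in Ioi (0 : ℝ) ×ˢ Ioo (-Real.pi) Real.pi,
        polarJacobian ε p.1 • endpointIntegrand ℓ₁ ℓ₂ α β ε x (polarPoint b (ε * p.1) p.2) := by
  refine integral_sphere_eq_integral_polar b (measurable_endpointIntegrand hc₁ hc₂ hα hβ ε x) ?_ hε
  intro y hy
  -- Points outside the open hemisphere around x have angle at least π/2 > 1 ≥ εM, beyond the reach
  -- of both cutoffs.
  have : cutoffDiff ℓ₁ ℓ₂ ε x y = 0 := by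
    by_contra h
    have h1 := (cutoffDiff_ne_zero h₁ h₂ hε h).2
    have h2 : 0 < Real.cos (InnerProductGeometry.angle (x : E3) y) := by
      refine Real.cos_pos_of_mem_Ioo ⟨?_, ?_⟩
      · linarith [InnerProductGeometry.angle_nonneg (x : E3) y, Real.pi_gt_three]
      · linarith [Real.pi_gt_three]
    rw [InnerProductGeometry.cos_angle, norm_coe_sphere, norm_coe_sphere, ← hx] at h2
    simp at h2
    linarith
  rw [endpointIntegrand, this, zero_mul, zero_mul]

/-- The bound of the integrand in scaled polar coordinates. -/
def polarBound (m M C : ℝ) (p : ℝ × ℝ) : ℝ :=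
  (Icc 0 (2 * M) ×ˢ univ).indicator (fun _ => 2 * M * (C ^ 2 * (Real.pi / (2 * m)) ^ 2 *
    ∫ w in paramWedge, (1 + w.1 ^ 2)⁻¹ * (1 + w.2 ^ 2)⁻¹)) p

theorem integrable_polarBound (m M C : ℝ) :
    IntegrableOn (polarBound m M C) (Ioi (0 : ℝ) ×ˢ Ioo (-Real.pi) Real.pi) := by
  have hS : MeasurableSet (Icc 0 (2 * M) ×ˢ univ : Set (ℝ × ℝ)) := measurableSet_Icc.prod .univ
  refine (integrable_indicator_iff hS).2 ?_
  rw [IntegrableOn, Measure.restrict_restrict hS]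
  refine IntegrableOn.mono_set (t := Icc 0 (2 * M) ×ˢ Icc (-Real.pi) Real.pi) ?_ ?_
  · exact integrableOn_const (isCompact_Icc.prod isCompact_Icc).measure_lt_top.ne
  · rintro p ⟨hp1, hp2⟩
    exact ⟨hp1.1, Ioo_subset_Icc_self hp2.2⟩

theorem norm_polarIntegrand_le (b : OrthonormalBasis (Fin 3) ℝ E3) {x : S2} (hx : b 2 = x)
    {ℓ₁ ℓ₂ : S2 → ℝ} {m M : ℝ} (hm : 0 < m) (h₁ : ∀ z, m ≤ ℓ₁ z ∧ ℓ₁ z ≤ M)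
    (h₂ : ∀ z, m ≤ ℓ₂ z ∧ ℓ₂ z ≤ M) {α β : E3 → E3 →L[ℝ] ℂ} {C : ℝ}
    (hα : ∀ x, ‖α x‖ ≤ C) (hβ : ∀ x, ‖β x‖ ≤ C) {ε : ℝ} (hε : 0 < ε) (hεM : ε * M ≤ 1)
    {p : ℝ × ℝ} (hp : 0 < p.1) :
    ‖polarJacobian ε p.1 • endpointIntegrand ℓ₁ ℓ₂ α β ε x (polarPoint b (ε * p.1) p.2)‖ ≤
      polarBound m M C p := by
  have hM : 0 < M := hm.trans_le ((h₁ x).1.trans (h₁ x).2)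
  set y := polarPoint b (ε * p.1) p.2 with hy
  set W := ∫ w in paramWedge, (1 + w.1 ^ 2)⁻¹ * (1 + w.2 ^ 2)⁻¹ with hW
  have hW0 : 0 ≤ W := integral_nonneg fun w => by positivity
  by_cases h0 : cutoffDiff ℓ₁ ℓ₂ ε x y = 0
  · rw [endpointIntegrand, h0, zero_mul, zero_mul, smul_zero, norm_zero]
    refine indicator_nonneg (fun _ _ => ?_) p
    positivity
  have hr : p.1 ≤ 2 * M := le_of_cutoffDiff_polarPoint_ne_zero hx h₁ h₂ hε hεM hp h0
  have hmem : p ∈ (Icc 0 (2 * M) ×ˢ univ : Set (ℝ × ℝ)) := ⟨⟨hp.le, hr⟩, mem_univ _⟩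
  rw [polarBound, indicator_of_mem hmem, ← hW]
  set κ := 2 / Real.pi * (ε * m) with hκ
  have hκ0 : 0 < κ := by positivity
  have hc : κ ≤ ‖(x : E3) - y‖ := by
    refine le_trans ?_ (angle_le_norm_sub (norm_coe_sphere x) (norm_coe_sphere y))
    exact mul_le_mul_of_nonneg_left (cutoffDiff_ne_zero h₁ h₂ hε h0).1 (by positivity)
  have hc0 : 0 < ‖(x : E3) - y‖ := hκ0.trans_le hc
  have hK := norm_fiberIntegral_le hα hβ (norm_coe_sphere x) (norm_coe_sphere y)
  have hE : ‖endpointIntegrand ℓ₁ ℓ₂ α β ε x y‖ ≤ (κ ^ 2)⁻¹ * (C ^ 2 * W) := by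
    rw [endpointIntegrand, norm_mul, norm_mul, norm_inv, norm_pow, Complex.norm_real, norm_norm]
    calc _ ≤ 1 * (‖(x : E3) - y‖ ^ 4)⁻¹ * (C ^ 2 * ‖(x : E3) - y‖ ^ 2 * W) := by
          gcongr
          exact norm_cutoffDiff_le _ _ _ _ _
      _ = (‖(x : E3) - y‖ ^ 2)⁻¹ * (C ^ 2 * W) := by field_simp
      _ ≤ _ := by gcongr
  rw [norm_smul, Real.norm_eq_abs]
  -- The ε² of the Jacobian cancels the ε⁻² in κ⁻², so the bound does not depend on ε.
  calc _ ≤ p.1 * ε ^ 2 * ((κ ^ 2)⁻¹ * (C ^ 2 * W)) :=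
        mul_le_mul (abs_polarJacobian_le hp.le) hE (norm_nonneg _) (by positivity)
    _ ≤ 2 * M * ε ^ 2 * ((κ ^ 2)⁻¹ * (C ^ 2 * W)) := by gcongr
    _ = _ := by
        rw [hκ]
        field_simp

/-- The integral over the second endpoint is bounded uniformly in the first one. -/
theorem norm_integral_endpointIntegrand_le {ℓ₁ ℓ₂ : S2 → ℝ} (hc₁ : Continuous ℓ₁)
    (hc₂ : Continuous ℓ₂) {m M : ℝ} (hm : 0 < m) (h₁ : ∀ z, m ≤ ℓ₁ z ∧ ℓ₁ z ≤ M)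
    (h₂ : ∀ z, m ≤ ℓ₂ z ∧ ℓ₂ z ≤ M) {α β : E3 → E3 →L[ℝ] ℂ} (hαc : Continuous α)
    (hβc : Continuous β) {C : ℝ} (hα : ∀ x, ‖α x‖ ≤ C) (hβ : ∀ x, ‖β x‖ ≤ C) {ε : ℝ} (hε : 0 < ε)
    (hεM : ε * M ≤ 1) (b : OrthonormalBasis (Fin 3) ℝ E3) {x : S2} (hx : b 2 = x) :
    ‖∫ y, endpointIntegrand ℓ₁ ℓ₂ α β ε x y ∂sphereMeasure‖ ≤
      ∫ p in Ioi (0 : ℝ) ×ˢ Ioo (-Real.pi) Real.pi, polarBound m M C p := by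
  rw [integral_endpointIntegrand b hx hc₁ hc₂ h₁ h₂ hαc hβc hε hεM]
  refine norm_integral_le_of_norm_le (integrable_polarBound m M C) ?_
  exact ae_restrict_of_forall_mem (measurableSet_Ioi.prod measurableSet_Ioo) fun p hp =>
    norm_polarIntegrand_le b hx hm h₁ h₂ hα hβ hε hεM hp.1

/-- Only the squares have nonzero integral over a full circle. The terms z₄ and z₅ will carry the
normal components of α and β, which disappear here. -/
theorem integral_trigonometric (z₁ z₂ z₃ z₄ z₅ : ℂ) :
    ∫ φ in Ioo (-Real.pi) Real.pi, (((Real.cos φ ^ 2 : ℝ) : ℂ) * z₁ +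
      ((Real.sin φ * Real.cos φ : ℝ) : ℂ) * z₂ + ((Real.sin φ ^ 2 : ℝ) : ℂ) * z₃ +
      ((Real.cos φ : ℝ) : ℂ) * z₄ + ((Real.sin φ : ℝ) : ℂ) * z₅) = Real.pi * (z₁ + z₃) := by
  have key : ∀ {f : ℝ → ℝ}, Continuous f → ∀ z : ℂ,
      IntervalIntegrable (fun φ => (f φ : ℂ) * z) volume (-Real.pi) Real.pi ∧
      ∫ φ in -Real.pi..Real.pi, (f φ : ℂ) * z = (∫ φ in -Real.pi..Real.pi, f φ : ℝ) * z := by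
    intro f hf z
    refine ⟨Continuous.intervalIntegrable (by fun_prop) _ _, ?_⟩
    rw [intervalIntegral.integral_mul_const, intervalIntegral.integral_ofReal]
  obtain ⟨i1, e1⟩ := key (f := fun φ => Real.cos φ ^ 2) (by fun_prop) z₁
  obtain ⟨i2, e2⟩ := key (f := fun φ => Real.sin φ * Real.cos φ) (by fun_prop) z₂
  obtain ⟨i3, e3⟩ := key (f := fun φ => Real.sin φ ^ 2) (by fun_prop) z₃
  obtain ⟨i4, e4⟩ := key (f := fun φ => Real.cos φ) (by fun_prop) z₄
  obtain ⟨i5, e5⟩ := key (f := fun φ => Real.sin φ) (by fun_prop) z₅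
  rw [← integral_Ioc_eq_integral_Ioo, ← intervalIntegral.integral_of_le (by linarith [Real.pi_pos]),
    intervalIntegral.integral_add (((i1.add i2).add i3).add i4) i5,
    intervalIntegral.integral_add ((i1.add i2).add i3) i4,
    intervalIntegral.integral_add (i1.add i2) i3, intervalIntegral.integral_add i1 i2,
    e1, e2, e3, e4, e5, integral_cos_sq, integral_sin_sq, integral_sin_mul_cos₁, integral_cos,
    integral_sin]
  simp
  ring

/-- Powers balance: the Jacobian is about ε²r, the kernel (εr)⁻⁴ and the fiber integral ε²r², so ε
drops out and r⁻¹ remains. -/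
theorem tendsto_polarIntegrand (b : OrthonormalBasis (Fin 3) ℝ E3) {x : S2} (hx : b 2 = x)
    {ℓ₁ ℓ₂ : S2 → ℝ} (hc₁ : Continuous ℓ₁) (hc₂ : Continuous ℓ₂) {α β : E3 → E3 →L[ℝ] ℂ}
    (hαc : Continuous α) (hβc : Continuous β) {C : ℝ} (hα : ∀ x, ‖α x‖ ≤ C)
    (hβ : ∀ x, ‖β x‖ ≤ C) {r : ℝ} (hr : 0 < r) (h₁ : r ≠ ℓ₁ x) (h₂ : r ≠ ℓ₂ x) (φ : ℝ) :
    Tendsto (fun ε => polarJacobian ε r •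
        endpointIntegrand ℓ₁ ℓ₂ α β ε x (polarPoint b (ε * r) φ)) (𝓝[>] 0)
      (𝓝 (((stepDiff (ℓ₁ x) (ℓ₂ x) r * r⁻¹ : ℝ) : ℂ) *
        (1 / 2 * (α x (circleVec b φ) * β x (circleVec b φ)) +
        (∫ w in paramWedge, tangentWeight w.1 * normalWeight w.2 : ℝ) *
          (α x (circleVec b φ) * β x x) +
        (∫ w in paramWedge, normalWeight w.1 * tangentWeight w.2 : ℝ) *
          (α x x * β x (circleVec b φ))))) := by
  have hv := tendsto_polarPoint_velocity b r φ
  rw [hx] at hv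
  have hK := tendsto_fiberIntegral hαc hβc hα hβ hv
  have hD := tendsto_cutoffDiff hx hc₁ hc₂ hr h₁ h₂ φ
  have hpos : ∀ᶠ ε : ℝ in 𝓝[>] 0, 0 < ε := self_mem_nhdsWithin
  have hn : ‖r • circleVec b φ‖ = r := by
    rw [norm_smul, norm_circleVec, mul_one, Real.norm_of_nonneg hr.le]
  have hc : Tendsto (fun ε : ℝ => ((‖ε⁻¹ • ((polarPoint b (ε * r) φ : E3) - x)‖ : ℂ) ^ 4)⁻¹)
      (𝓝[>] 0) (𝓝 (((r : ℂ) ^ 4)⁻¹)) := by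
    have h := hv.norm
    rw [hn] at h
    have hr' : (r : ℂ) ^ 4 ≠ 0 := pow_ne_zero 4 (Complex.ofReal_ne_zero.2 hr.ne')
    exact (((Complex.continuous_ofReal.tendsto r).comp h).pow 4).inv₀ hr'
  have hs : Tendsto (fun ε : ℝ => ((r * (√(1 + (ε * r) ^ 2))⁻¹ ^ 3 : ℝ) : ℂ)) (𝓝[>] 0)
      (𝓝 (r : ℂ)) := by
    have h : Continuous fun ε : ℝ => ((r * (√(1 + (ε * r) ^ 2))⁻¹ ^ 3 : ℝ) : ℂ) := by
      refine Complex.continuous_ofReal.comp (continuous_const.mul (Continuous.pow ?_ 3))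
      refine Continuous.inv₀ (by fun_prop) fun ε => ?_
      exact (Real.sqrt_pos.2 (by positivity)).ne'
    have := (h.tendsto 0).mono_left (nhdsWithin_le_nhds (s := Ioi 0))
    simpa using this
  have key := (hs.mul hD).mul (hc.mul hK)
  rw [hn] at key
  simp only [map_smul, Complex.real_smul] at key
  have hr' : (r : ℂ) ≠ 0 := Complex.ofReal_ne_zero.2 hr.ne'
  convert key.congr' ?_ using 2
  · push_cast
    field_simp
  · filter_upwards [hpos] with ε hε
    have hε' : (ε : ℂ) ≠ 0 := Complex.ofReal_ne_zero.2 hε.ne'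
    rw [norm_smul, norm_sub_rev, Real.norm_of_nonneg (inv_pos.2 hε).le, endpointIntegrand,
      polarJacobian, Complex.real_smul]
    push_cast
    simp only [mul_pow, inv_pow, mul_inv, inv_inv]
    field_simp

theorem tendsto_integral_endpointIntegrand (b : OrthonormalBasis (Fin 3) ℝ E3) {x : S2}
    (hx : b 2 = x) {ℓ₁ ℓ₂ : S2 → ℝ} (hc₁ : Continuous ℓ₁) (hc₂ : Continuous ℓ₂) {m M : ℝ}
    (hm : 0 < m) (h₁ : ∀ z, m ≤ ℓ₁ z ∧ ℓ₁ z ≤ M) (h₂ : ∀ z, m ≤ ℓ₂ z ∧ ℓ₂ z ≤ M)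
    {α β : E3 → E3 →L[ℝ] ℂ} (hαc : Continuous α) (hβc : Continuous β) {C : ℝ}
    (hα : ∀ x, ‖α x‖ ≤ C) (hβ : ∀ x, ‖β x‖ ≤ C) :
    Tendsto (fun ε => ∫ y, endpointIntegrand ℓ₁ ℓ₂ α β ε x y ∂sphereMeasure) (𝓝[>] 0)
      (𝓝 (-(Real.pi / 2) * Real.log (ℓ₁ x / ℓ₂ x) *
        (α x (b 0) * β x (b 0) + α x (b 1) * β x (b 1)))) := by
  have hM : 0 < M := hm.trans_le ((h₁ x).1.trans (h₁ x).2)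
  have hpos : ∀ᶠ ε : ℝ in 𝓝[>] 0, 0 < ε := self_mem_nhdsWithin
  have hsmall : ∀ᶠ ε : ℝ in 𝓝[>] 0, ε * M ≤ 1 := by
    filter_upwards [Ioo_mem_nhdsGT (inv_pos.2 hM)] with ε hε
    have := mul_le_mul_of_nonneg_right hε.2.le hM.le
    rwa [inv_mul_cancel₀ hM.ne'] at this
  set T : Set (ℝ × ℝ) := Ioi (0 : ℝ) ×ˢ Ioo (-Real.pi) Real.pi with hT
  have hTm : MeasurableSet T := measurableSet_Ioi.prod measurableSet_Ioo
  set c₁ : ℂ := ((∫ w in paramWedge, tangentWeight w.1 * normalWeight w.2 : ℝ) : ℂ) with hc₁'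
  set c₂ : ℂ := ((∫ w in paramWedge, normalWeight w.1 * tangentWeight w.2 : ℝ) : ℂ) with hc₂'
  set κ : ℝ → ℂ := fun φ => 1 / 2 * (α x (circleVec b φ) * β x (circleVec b φ)) +
    c₁ * (α x (circleVec b φ) * β x x) + c₂ * (α x x * β x (circleVec b φ)) with hκ
  have hlim : Tendsto (fun ε => ∫ p in T, polarJacobian ε p.1 •
      endpointIntegrand ℓ₁ ℓ₂ α β ε x (polarPoint b (ε * p.1) p.2)) (𝓝[>] 0)
      (𝓝 (∫ p in T, ((stepDiff (ℓ₁ x) (ℓ₂ x) p.1 * p.1⁻¹ : ℝ) : ℂ) * κ p.2)) := by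
    refine tendsto_integral_filter_of_dominated_convergence (polarBound m M C) ?_ ?_
      (integrable_polarBound m M C) ?_
    · refine Eventually.of_forall fun ε => ?_
      have hj : Measurable fun p : ℝ × ℝ => polarJacobian ε p.1 := by
        unfold polarJacobian
        fun_prop
      have he := (measurable_endpointIntegrand hc₁ hc₂ hαc hβc ε x).comp
        (measurable_polarPoint b ε)
      exact (hj.smul he).aestronglyMeasurable
    · filter_upwards [hpos, hsmall] with ε hε hεM
      exact ae_restrict_of_forall_mem hTm fun p hp =>
        norm_polarIntegrand_le b hx hm h₁ h₂ hα hβ hε hεM hp.1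
    -- The radii at which the limiting cutoffs jump form a null set.
    · have hne : ∀ c : ℝ, ∀ᵐ p : ℝ × ℝ, p.1 ≠ c := fun c =>
        Measure.quasiMeasurePreserving_fst.ae (Measure.ae_ne volume c)
      filter_upwards [ae_restrict_mem hTm, ae_restrict_of_ae (hne (ℓ₁ x)),
        ae_restrict_of_ae (hne (ℓ₂ x))] with p hp hp1 hp2
      exact tendsto_polarIntegrand b hx hc₁ hc₂ hαc hβc hα hβ hp.1 hp1 hp2 p.2
  have hI : ∫ p in T, ((stepDiff (ℓ₁ x) (ℓ₂ x) p.1 * p.1⁻¹ : ℝ) : ℂ) * κ p.2 =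
      -(Real.pi / 2) * Real.log (ℓ₁ x / ℓ₂ x) *
        (α x (b 0) * β x (b 0) + α x (b 1) * β x (b 1)) := by
    have hprod := setIntegral_prod_mul (μ := volume) (ν := volume)
      (fun r : ℝ => ((stepDiff (ℓ₁ x) (ℓ₂ x) r * r⁻¹ : ℝ) : ℂ)) κ (Ioi 0)
      (Ioo (-Real.pi) Real.pi)
    have hr : ∫ r in Ioi (0 : ℝ), ((stepDiff (ℓ₁ x) (ℓ₂ x) r * r⁻¹ : ℝ) : ℂ) =
        ((-Real.log (ℓ₁ x / ℓ₂ x) : ℝ) : ℂ) := by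
      rw [← integral_stepDiff (hm.trans_le (h₁ x).1) (hm.trans_le (h₂ x).1)]
      exact integral_ofReal
    -- The mixed constants c₁ and c₂ occur only with a single cosine or sine, so their values are
    -- not needed.
    have hφ : ∀ φ, κ φ = ((Real.cos φ ^ 2 : ℝ) : ℂ) * (1 / 2 * (α x (b 0) * β x (b 0))) +
        ((Real.sin φ * Real.cos φ : ℝ) : ℂ) *
          (1 / 2 * (α x (b 0) * β x (b 1) + α x (b 1) * β x (b 0))) +
        ((Real.sin φ ^ 2 : ℝ) : ℂ) * (1 / 2 * (α x (b 1) * β x (b 1))) +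
        ((Real.cos φ : ℝ) : ℂ) * (c₁ * (α x (b 0) * β x x) + c₂ * (α x x * β x (b 0))) +
        ((Real.sin φ : ℝ) : ℂ) * (c₁ * (α x (b 1) * β x x) + c₂ * (α x x * β x (b 1))) := by
      intro φ
      simp only [hκ, circleVec, map_add, map_smul, Complex.real_smul]
      push_cast
      ring
    rw [hT, Measure.volume_eq_prod, hprod, hr]
    simp only [hφ]
    rw [integral_trigonometric]
    push_cast
    ring
  rw [← hI]
  refine hlim.congr' ?_
  filter_upwards [hpos, hsmall] with ε hε hεM
  exact (integral_endpointIntegrand b hx hc₁ hc₂ h₁ h₂ hαc hβc hε hεM).symm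

end InnerLimit

/-! ### The density of α ∧ *β on the sphere. -/

section BoundaryTerm

theorem apply_eq_sum_stdBasis (φ : E3 →L[ℝ] ℂ) (v : E3) :
    φ v = v 0 * φ (stdBasis 0) + v 1 * φ (stdBasis 1) + v 2 * φ (stdBasis 2) := by
  have h : v = v 0 • stdBasis 0 + v 1 • stdBasis 1 + v 2 • stdBasis 2 := by
    ext i
    fin_cases i <;> simp [stdBasis]
  conv_lhs => rw [h]
  simp only [map_add, map_smul, Complex.real_smul]

/-- Parseval's identity: the matrix of an orthonormal basis has orthonormal columns. -/
theorem sum_basis_mul_basis (b : OrthonormalBasis (Fin 3) ℝ E3) (φ ψ : E3 →L[ℝ] ℂ) :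
    ∑ i, φ (b i) * ψ (b i) = ∑ j, φ (stdBasis j) * ψ (stdBasis j) := by
  have h : ∀ j k : Fin 3, ((b 0 j * b 0 k + b 1 j * b 1 k + b 2 j * b 2 k : ℝ) : ℂ) =
      if k = j then 1 else 0 := by
    intro j k
    have h := b.sum_inner_mul_inner (EuclideanSpace.single j (1 : ℝ)) (EuclideanSpace.single k 1)
    simp only [Fin.sum_univ_three, EuclideanSpace.inner_single_left,
      EuclideanSpace.inner_single_right] at h
    simp only [conj_trivial, one_mul, PiLp.single_apply] at h
    rw [h]
    split_ifs <;> simp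
  simp only [Fin.sum_univ_three]
  rw [apply_eq_sum_stdBasis φ (b 0), apply_eq_sum_stdBasis φ (b 1), apply_eq_sum_stdBasis φ (b 2),
    apply_eq_sum_stdBasis ψ (b 0), apply_eq_sum_stdBasis ψ (b 1), apply_eq_sum_stdBasis ψ (b 2)]
  have h00 := h 0 0
  have h01 := h 0 1
  have h02 := h 0 2
  have h11 := h 1 1
  have h12 := h 1 2
  have h22 := h 2 2
  simp only [Fin.isValue, Fin.reduceEq, if_true, if_false] at h00 h01 h02 h11 h12 h22
  push_cast at h00 h01 h02 h11 h12 h22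
  generalize φ (stdBasis 0) = A0 at *
  generalize φ (stdBasis 1) = A1 at *
  generalize φ (stdBasis 2) = A2 at *
  generalize ψ (stdBasis 0) = B0 at *
  generalize ψ (stdBasis 1) = B1 at *
  generalize ψ (stdBasis 2) = B2 at *
  linear_combination A0 * B0 * h00 + A1 * B1 * h11 + A2 * B2 * h22 + (A0 * B1 + A1 * B0) * h01 +
    (A0 * B2 + A2 * B0) * h02 + (A1 * B2 + A2 * B1) * h12

/-- `φ ∧ *ψ` on the tangent plane spanned by the first two basis vectors. -/
theorem evalForm_mul_hodgeStar (b : OrthonormalBasis (Fin 3) ℝ E3) (φ ψ : E3 →L[ℝ] ℂ) :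
    evalForm stdBasis (oneForm (normalCovector (b 2)) *
      (oneForm φ * oneForm (hodgeStar (b 2) ψ))) = φ (b 0) * ψ (b 0) + φ (b 1) * ψ (b 1) := by
  have hs := sum_basis_mul_basis b φ ψ
  simp only [Fin.sum_univ_three] at hs
  have hn : ((b 2 0 ^ 2 + b 2 1 ^ 2 + b 2 2 ^ 2 : ℝ) : ℂ) = 1 := by
    rw [← norm_sq_eq_sum, b.norm_eq_one]
    simp
  push_cast at hn
  have e : oneForm (normalCovector (b 2)) * (oneForm φ * oneForm (hodgeStar (b 2) ψ)) =
      ExteriorAlgebra.ιMulti ℂ 3 ![normalCovector (b 2), φ, hodgeStar (b 2) ψ] := by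
    simp [ExteriorAlgebra.ιMulti_apply, oneForm]
  rw [e, evalForm_ιMulti, Matrix.det_fin_three]
  have hν : ∀ j, normalCovector (b 2) (stdBasis j) = (b 2 j : ℂ) := by
    intro j
    simp [normalCovector, stdBasis, EuclideanSpace.inner_single_right]
  have hcross : ∀ j, crossMap (b 2) (stdBasis j) =
      WithLp.toLp 2 (crossProduct (b 2).ofLp (stdBasis j).ofLp) := fun _ => rfl
  have hstar : ∀ j, hodgeStar (b 2) ψ (stdBasis j) = -ψ (crossMap (b 2) (stdBasis j)) :=
    fun _ => rfl
  simp only [Matrix.of_apply, Matrix.cons_val_zero, Matrix.cons_val_one, Matrix.cons_val, hν, hstar]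
  rw [apply_eq_sum_stdBasis ψ (crossMap _ (stdBasis 0)),
    apply_eq_sum_stdBasis ψ (crossMap _ (stdBasis 1)),
    apply_eq_sum_stdBasis ψ (crossMap _ (stdBasis 2))]
  simp only [hcross, cross_apply]
  have hd : ∀ i j : Fin 3, stdBasis i j = if j = i then 1 else 0 := by
    intro i j
    simp [stdBasis]
  simp only [hd]
  simp
  have hφ := apply_eq_sum_stdBasis φ (b 2)
  have hψ := apply_eq_sum_stdBasis ψ (b 2)
  -- With n = `b 2`, the determinant is (n × φ)·(n × ψ) = |n|² φ·ψ − φ(n)ψ(n) by Lagrange's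
  -- identity, and `hs` rewrites φ·ψ in the basis `b`, whose last term cancels.
  linear_combination (φ (stdBasis 0) * ψ (stdBasis 0) + φ (stdBasis 1) * ψ (stdBasis 1) +
    φ (stdBasis 2) * ψ (stdBasis 2)) * hn - hs + ψ (b 2) * hφ + (b 2 0 * φ (stdBasis 0) +
    b 2 1 * φ (stdBasis 1) + b 2 2 * φ (stdBasis 2)) * hψ

end BoundaryTerm

/-! ### Global bounded coefficients, adapted bases and bounds for the radii. -/

section Extension

/-- The radial retraction onto the closed unit ball. -/
def ballRetraction (x : E3) : E3 := (max 1 ‖x‖)⁻¹ • x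

theorem continuous_ballRetraction : Continuous ballRetraction := by
  unfold ballRetraction
  refine Continuous.smul (Continuous.inv₀ (continuous_const.max continuous_norm) fun x => ?_)
    continuous_id
  exact (one_pos.trans_le (le_max_left _ _)).ne'

theorem ballRetraction_mem (x : E3) : ballRetraction x ∈ closedBall (0 : E3) 1 := by
  have h : 0 < max 1 ‖x‖ := one_pos.trans_le (le_max_left _ _)
  rw [mem_closedBall_zero_iff, ballRetraction, norm_smul, norm_inv, Real.norm_of_nonneg h.le,
    inv_mul_le_iff₀ h, mul_one]
  exact le_max_right _ _

theorem ballRetraction_eq {x : E3} (hx : ‖x‖ ≤ 1) : ballRetraction x = x := by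
  rw [ballRetraction, max_eq_left hx, inv_one, one_smul]

/-- Composition with the radial retraction turns the one-form part on the ball into a continuous
bounded field on all of ℝ³. Geodesics stay in the ball, so nothing changes there, and measurability
and bounds hold without side conditions. -/
theorem exists_continuous_extension {α : E3 → Forms E3} (hα : IsSmoothFormOnBall α) :
    ∃ a : E3 → E3 →L[ℝ] ℂ, Continuous a ∧ (∀ x, ‖x‖ ≤ 1 → a x = degreeOnePart (α x)) ∧
      ∃ C, ∀ x, ‖a x‖ ≤ C := by
  have hc : ContinuousOn (fun x => degreeOnePart (α x)) (closedBall 0 1) := by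
    refine continuousOn_clm_apply.2 fun v => ?_
    let ev : (E3 →L[ℝ] ℂ) →ₗ[ℂ] ℂ :=
      { toFun := fun φ => φ v
        map_add' := fun _ _ => rfl
        map_smul' := fun _ _ => rfl }
    exact (hα (ev ∘ₗ ExteriorAlgebra.ιInv)).continuousOn
  obtain ⟨C, hC⟩ := (isCompact_closedBall (0 : E3) 1).exists_bound_of_continuousOn hc
  refine ⟨fun x => degreeOnePart (α (ballRetraction x)), ?_, fun x hx => ?_, C,
    fun x => hC _ (ballRetraction_mem x)⟩
  · exact hc.comp_continuous continuous_ballRetraction ballRetraction_mem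
  · simp only [ballRetraction_eq hx]

theorem exists_orthonormalBasis_eq (x : S2) : ∃ b : OrthonormalBasis (Fin 3) ℝ E3, b 2 = x := by
  have h : Orthonormal ℝ (Set.domRestrict ({2} : Set (Fin 3)) fun _ => (x : E3)) := by
    refine ⟨fun i => norm_coe_sphere x, fun i j hij => ?_⟩
    exact absurd (Subsingleton.elim i j) hij
  obtain ⟨b, hb⟩ := h.exists_orthonormalBasis_extension_of_card_eq (by simp)
  exact ⟨b, hb 2 rfl⟩

theorem exists_pos_bounds {ℓ₁ ℓ₂ : S2 → ℝ} (h₁ : Continuous ℓ₁) (h₂ : Continuous ℓ₂)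
    (hp₁ : ∀ z, 0 < ℓ₁ z) (hp₂ : ∀ z, 0 < ℓ₂ z) :
    ∃ m M : ℝ, 0 < m ∧ (∀ z, m ≤ ℓ₁ z ∧ ℓ₁ z ≤ M) ∧ ∀ z, m ≤ ℓ₂ z ∧ ℓ₂ z ≤ M := by
  have key : ∀ {ℓ : S2 → ℝ}, Continuous ℓ → (∀ z, 0 < ℓ z) →
      ∃ m M : ℝ, 0 < m ∧ ∀ z, m ≤ ℓ z ∧ ℓ z ≤ M := by
    intro ℓ h hp
    obtain ⟨z, -, hz⟩ := isCompact_univ.exists_isMinOn univ_nonempty h.continuousOn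
    obtain ⟨z', -, hz'⟩ := isCompact_univ.exists_isMaxOn univ_nonempty h.continuousOn
    exact ⟨ℓ z, ℓ z', hp z, fun w => ⟨hz (mem_univ w), hz' (mem_univ w)⟩⟩
  obtain ⟨m, M, hm, h⟩ := key h₁ hp₁
  obtain ⟨m', M', hm', h'⟩ := key h₂ hp₂
  exact ⟨min m m', max M M', lt_min hm hm',
    fun z => ⟨(min_le_left _ _).trans (h z).1, (h z).2.trans (le_max_left _ _)⟩,
    fun z => ⟨(min_le_right _ _).trans (h' z).1, (h' z).2.trans (le_max_right _ _)⟩⟩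

end Extension

/-! ### Assembly of the limit. -/

section Main

theorem evalForm_boundaryForm (ℓ₁ ℓ₂ : S2 → ℝ) (α β : E3 → Forms E3) {x : S2}
    {b : OrthonormalBasis (Fin 3) ℝ E3} (hx : b 2 = x) :
    evalForm stdBasis (oneForm (normalCovector x) * boundaryForm ℓ₁ ℓ₂ α β x) =
      Real.log (ℓ₁ x / ℓ₂ x) *
        (degreeOnePart (α x) (b 0) * degreeOnePart (β x) (b 0) +
          degreeOnePart (α x) (b 1) * degreeOnePart (β x) (b 1)) := by
  rw [boundaryForm, mul_smul_comm, map_smul, ← hx, evalForm_mul_hodgeStar, smul_eq_mul]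

/-- The integrability and the limit for the product orientation. -/
theorem integrableOn_and_tendsto_integralConf2 {ℓ₁ ℓ₂ : S2 → ℝ} (hc₁ : Continuous ℓ₁)
    (hc₂ : Continuous ℓ₂) (hp₁ : ∀ z, 0 < ℓ₁ z) (hp₂ : ∀ z, 0 < ℓ₂ z) {α β : E3 → Forms E3}
    (hα : IsSmoothFormOnBall α) (hβ : IsSmoothFormOnBall β) :
    (∀ ε : ℝ, 0 < ε →
      IntegrableOn (fun q => evalForm frame12 (cutoffForm ℓ₁ ℓ₂ α β ε q)) Conf2) ∧
    Tendsto (fun ε : ℝ => integralConf2 frame12 (cutoffForm ℓ₁ ℓ₂ α β ε)) (𝓝[>] 0)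
      (𝓝 (1 / (2 * Real.pi) * integralS2 (boundaryForm ℓ₁ ℓ₂ α β))) := by
  obtain ⟨m, M, hm, h₁, h₂⟩ := exists_pos_bounds hc₁ hc₂ hp₁ hp₂
  obtain ⟨a, hac, haα, C, ha⟩ := exists_continuous_extension hα
  obtain ⟨b, hbc, hbβ, C', hb⟩ := exists_continuous_extension hβ
  have ha' : ∀ x, ‖a x‖ ≤ max C C' := fun x => (ha x).trans (le_max_left _ _)
  have hb' : ∀ x, ‖b x‖ ≤ max C C' := fun x => (hb x).trans (le_max_right _ _)
  have hcut : ∀ ε : ℝ, 0 < ε → _ := fun ε hε =>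
    integral_cutoffForm hc₁ hc₂ hm h₁ h₂ hac hbc ha' hb' haα hbβ hε
  refine ⟨fun ε hε => (hcut ε hε).1, ?_⟩
  have hpos : ∀ᶠ ε : ℝ in 𝓝[>] 0, 0 < ε := self_mem_nhdsWithin
  have hM : 0 < M := hm.trans_le ((h₁ (Classical.arbitrary S2)).1.trans (h₁ _).2)
  have hsmall : ∀ᶠ ε : ℝ in 𝓝[>] 0, ε * M ≤ 1 := by
    filter_upwards [Ioo_mem_nhdsGT (inv_pos.2 hM)] with ε hε
    have := mul_le_mul_of_nonneg_right hε.2.le hM.le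
    rwa [inv_mul_cancel₀ hM.ne'] at this
  have hlim : Tendsto (fun ε => ∫ x, ∫ y, endpointIntegrand ℓ₁ ℓ₂ a b ε x y
      ∂sphereMeasure ∂sphereMeasure) (𝓝[>] 0) (𝓝 (∫ x : S2, -(Real.pi / 2 : ℂ) *
        evalForm stdBasis (oneForm (normalCovector x) * boundaryForm ℓ₁ ℓ₂ α β x)
          ∂sphereMeasure)) := by
    refine tendsto_integral_filter_of_dominated_convergence
      (fun _ => ∫ p in Ioi (0 : ℝ) ×ˢ Ioo (-Real.pi) Real.pi, polarBound m M (max C C') p)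
      ?_ ?_ (integrable_const _) ?_
    -- Measurability in x comes from Fubini, so the bases adapted to x below can be chosen point by
    -- point. The bound depends only on m, M and the bounds of the forms, hence is uniform in x.
    · filter_upwards [hpos] with ε hε using (hcut ε hε).2.2
    · filter_upwards [hpos, hsmall] with ε hε hεM
      refine Eventually.of_forall fun x => ?_
      obtain ⟨e, he⟩ := exists_orthonormalBasis_eq x
      exact norm_integral_endpointIntegrand_le hc₁ hc₂ hm h₁ h₂ hac hbc ha' hb' hε hεM e he
    · refine Eventually.of_forall fun x => ?_
      obtain ⟨e, he⟩ := exists_orthonormalBasis_eq x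
      rw [evalForm_boundaryForm ℓ₁ ℓ₂ α β he, ← haα x (norm_coe_sphere x).le,
        ← hbβ x (norm_coe_sphere x).le, ← mul_assoc]
      exact tendsto_integral_endpointIntegrand e he hc₁ hc₂ hm h₁ h₂ hac hbc ha' hb'
  have hfin := hlim.const_mul (-(Real.pi ^ 2 : ℂ)⁻¹)
  -- The constants combine to −π⁻² · (−π/2) = 1/(2π).
  have hval : -(Real.pi ^ 2 : ℂ)⁻¹ * (∫ x : S2, -(Real.pi / 2 : ℂ) *
        evalForm stdBasis (oneForm (normalCovector x) * boundaryForm ℓ₁ ℓ₂ α β x)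
          ∂sphereMeasure) = 1 / (2 * Real.pi) * integralS2 (boundaryForm ℓ₁ ℓ₂ α β) := by
    have hπ : (Real.pi : ℂ) ≠ 0 := Complex.ofReal_ne_zero.2 Real.pi_ne_zero
    rw [integral_const_mul, ← mul_assoc, integralS2]
    congr 1
    field_simp
  rw [hval] at hfin
  refine hfin.congr' ?_
  filter_upwards [hpos] with ε hε using (hcut ε hε).2.1.symm

end Main

end

theorem mainTheorem1 (ℓ₁ ℓ₂ : S2 → ℝ)
    (hℓ₁ : ContMDiff (𝓡 2) 𝓘(ℝ, ℝ) ∞ ℓ₁) (hℓ₂ : ContMDiff (𝓡 2) 𝓘(ℝ, ℝ) ∞ ℓ₂)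
    (hℓ₁_pos : ∀ z, 0 < ℓ₁ z) (hℓ₂_pos : ∀ z, 0 < ℓ₂ z)
    (α β : E3 → Forms E3) (hα : IsSmoothFormOnBall α) (hβ : IsSmoothFormOnBall β) :
    (∀ ε : ℝ, 0 < ε →
      IntegrableOn (fun q => evalForm frame21 (cutoffForm ℓ₁ ℓ₂ α β ε q)) Conf2) ∧
    Tendsto (fun ε : ℝ => integralConf2 frame21 (cutoffForm ℓ₁ ℓ₂ α β ε)) (𝓝[>] 0)
      (𝓝 (-(1 / (2 * Real.pi)) * integralS2 (boundaryForm ℓ₁ ℓ₂ α β))) ∧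
    Tendsto (fun ε : ℝ => integralConf2 frame12 (cutoffForm ℓ₁ ℓ₂ α β ε)) (𝓝[>] 0)
      (𝓝 (1 / (2 * Real.pi) * integralS2 (boundaryForm ℓ₁ ℓ₂ α β))) := by
  obtain ⟨hint, hlim⟩ := integrableOn_and_tendsto_integralConf2 hℓ₁.continuous hℓ₂.continuous
    hℓ₁_pos hℓ₂_pos hα hβ
  refine ⟨fun ε hε => ?_, ?_, hlim⟩
  · simp only [evalForm_frame21]
    exact (hint ε hε).neg
  · have h := hlim.neg
    rw [← neg_mul] at h
    refine h.congr fun ε => ?_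
    simp only [integralConf2, evalForm_frame21, integral_neg]
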